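/- Let $\ell,k,r\ge 0$, let $P$ be the vector space of polynomial maps $\mathbb R^\ell\to\mathbb R^k$ of degree $\le r$, and let $G$ be the group of polynomial maps $\mathbb R^\ell\to\mathbb R^\ell$ which fix the origin and are invertible modulo truncation; $G$ acts on $P$ by precomposition and truncation. Let $\mathfrak X_\bullet$ be an open $G$-invariant subfunctor of the contravariant functor $T\mapsto P^T$ on finite nonempty sets and injective maps: $\mathfrak X_T\subset P^T$ is open and $G^T$-invariant for every $T$. For $f\in P^T$, a nonempty finite $S\subset T$ is a minimal bad event if $f|_S\notin\mathfrak X_S$ and $f|_R\in\mathfrak X_R$ for all nonempty proper $R\subset S$; a bad event is a nonempty finite union of minimal bad events. An element of $P$ is pure if it has a neighbourhood in $P$ none of whose elements occurs as a coordinate $f_t$, $t\in S$, for a bad event $S$ of some multijet $f$. Let $L$ be a smooth compact (Hausdorff) manifold of dimension $\ell$, possibly with boundary, and $\varphi\colon L\to\mathbb R^k$ a smooth map whose $r$-jets at all points of $\partial L$ (in local coordinates) are pure. Let $i\ge 0$ and let $A_i$ be a finite dimensional affine space, of dimension $d_i$, of smooth maps $f\colon L\to\mathbb R^k$ which have the same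 $r$-jets as $\varphi$ at all points of $\partial L$. Suppose that $A_i$ is interpolating: for every $T\subset L\smallsetminus\partial L$ with $|T|\le i$, taking $r$-jets at the points of $T$ (in local coordinates centered at these points) is a surjection $A_i\to P^T$. A finite nonempty $S\subset L\smallsetminus\partial L$ is a bad event for $f\in A_i$ if it is one for the multijet $j^r_Sf\in P^S$. Let $\Lambda$ be the poset of pairs $(f,S)$ with $f\in A_i$ and $S$ a bad event for $f$, ordered by $(f,S)\le(g,T)$ iff $f=g$ and $S\subset T$, with the topology in which $(f_j,S_j)\to(f,S)$ means $f_j\to f$ in the Whitney $C^\infty$ topology and $S_j\to S$ in the Hausdorff topology. The resolved discriminant $RB_i$ is the classifying space of the topological poset $\Lambda$ (the geometric realization of its nerve, a simplicial space), and $F_pRB_i\subset RB_i$ is the set of points which lie in the interior of a nondegenerate simplex $(f,S_0)<\dots<(f,S_n)$ with $|S_n|\le p$. Let $0<p\le i$. Sending a point in the interior of such a simplex to $S_n$ defines a map $$\pi\colon F_pRB_i\smallsetminus F_{p-1}RB_i\longrightarrow\binom{L\smallsetminus\partial L}{p}$$ to the space of unordered configurations of $p$ points in $L\smallsetminus\partial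 L$. **(1)** The map $\pi$ is a locally trivial projection. Every configuration $S$ has a neighbourhood over which $\pi$ is trivial with fiber homeomorphic to the space of triples $(v,h,x)$ where $v\in\mathbb R^b$ with $b=d_i-p\dim P\ge 0$, where $h\in P^S$ is a multijet having $S$ as a bad event, and where $x$ is a point of the open cone on the classifying space of the poset of those proper subsets of $S$ which are bad events for $h$. (The pairs $(h,x)$ are topologized as the fiberwise open cone, over the space of all such $h$, on the classifying space of the topological poset of pairs $(h,R)$ with $R\subsetneq S$ a bad event for $h$.) **(2)** Let instead $\mathfrak X\subset P$ be a single open $G$-invariant subset, let $\varphi$ have all its $r$-jets at points of $\partial L$ in $\mathfrak X$, and define $RB_i$, $F_pRB_i$ and $\pi$ in the same way, where now a bad event for $f$ is a finite nonempty set of points of $L\smallsetminus\partial L$ at each of which the $r$-jet of $f$ is not in $\mathfrak X$. Then, for $0<p\le i$, the map $\pi$ is a locally trivial projection, with fibers homeomorphic to $$\mathbb R^b\times\mathbb R^{p-1}\times(P\smallsetminus\mathfrak X)^p,\qquad b=d_i-p\dim P\ge 0.$$ -/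

import Mathlib

open scoped Manifold ContDiff Topology

universe u v w

noncomputable section

/-! ## Polynomial maps, Taylor polynomials, jets -/

/-- The vector space of polynomial maps `E → F` of degree at most `r`, that is, of sums of
homogeneous polynomial maps `x ↦ c m (x, …, x)` with `c m` an `m`-linear map, `m ≤ r`.
For finite dimensional `E`, `F` it is finite dimensional, and the topology that it has as a
subspace of `E → F` (pointwise convergence) is its usual vector space topology. -/
def PolyMap (E F : Type*) [NormedAddCommGroup E] [NormedSpace ℝ E]
    [NormedAddCommGroup F] [NormedSpace ℝ F] (r : ℕ) : Submodule ℝ (E → F) where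
  carrier := {g | ∃ c : ∀ m : ℕ, ContinuousMultilinearMap ℝ (fun _ : Fin m => E) F,
    ∀ x, g x = ∑ m ∈ Finset.range (r + 1), c m (fun _ => x)}
  add_mem' := by
    rintro a b ⟨c, hc⟩ ⟨d, hd⟩
    exact ⟨fun m => c m + d m, fun x => by simp [hc, hd, Finset.sum_add_distrib]⟩
  zero_mem' := ⟨fun _ => 0, fun x => by simp⟩
  smul_mem' := by
    rintro t a ⟨c, hc⟩
    exact ⟨fun m => t • c m, fun x => by simp [hc, Finset.smul_sum]⟩

/-- The Taylor polynomial of degree `r` at `x₀` of a map `g` defined on `s` (with derivatives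
taken within `s`), as a polynomial map of a variable centered at `x₀`. -/
def taylorPoly {E F : Type*} [NormedAddCommGroup E] [NormedSpace ℝ E]
    [NormedAddCommGroup F] [NormedSpace ℝ F] (r : ℕ) (s : Set E) (g : E → F) (x₀ : E) :
    PolyMap E F r :=
  ⟨fun x => ∑ m ∈ Finset.range (r + 1),
      ((m.factorial : ℝ)⁻¹ • iteratedFDerivWithin ℝ m g s x₀) (fun _ => x),
    fun m => (m.factorial : ℝ)⁻¹ • iteratedFDerivWithin ℝ m g s x₀, fun _ => rfl⟩

/-- `JetSpace ℓ k r` is the vector space `P` of polynomial maps `ℝ^ℓ → ℝ^k` of degree `≤ r`. -/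
abbrev JetSpace (ℓ k r : ℕ) : Type :=
  PolyMap (EuclideanSpace ℝ (Fin ℓ)) (EuclideanSpace ℝ (Fin k)) r

/-- A polynomial map `ℝ^ℓ → ℝ^ℓ` which fixes the origin and is invertible near the origin
(equivalently, invertible modulo truncation). The truncations of these form the group `G`. -/
def IsCoordChange {ℓ : ℕ} (q : EuclideanSpace ℝ (Fin ℓ) → EuclideanSpace ℝ (Fin ℓ)) : Prop :=
  (∃ n : ℕ, q ∈ PolyMap (EuclideanSpace ℝ (Fin ℓ)) (EuclideanSpace ℝ (Fin ℓ)) n) ∧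
    q 0 = 0 ∧ Function.Bijective (fderiv ℝ q 0)

/-- The action on `P` by precomposition and truncation. -/
def precompTrunc {ℓ k r : ℕ} (q : EuclideanSpace ℝ (Fin ℓ) → EuclideanSpace ℝ (Fin ℓ))
    (g : JetSpace ℓ k r) : JetSpace ℓ k r :=
  taylorPoly r Set.univ ((g : EuclideanSpace ℝ (Fin ℓ) → EuclideanSpace ℝ (Fin k)) ∘ q) 0

/-- A subset of `P` which is invariant under the action of `G`. -/
def IsCoordInvariant {ℓ k r : ℕ} (X : Set (JetSpace ℓ k r)) : Prop :=
  ∀ q : EuclideanSpace ℝ (Fin ℓ) → EuclideanSpace ℝ (Fin ℓ), IsCoordChange q →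
    ∀ g ∈ X, precompTrunc q g ∈ X

/-- An open subfunctor `T ↦ X_T` of the contravariant functor `T ↦ P^T` on the category of finite
nonempty sets and injective maps, such that `X_T` is invariant under `G^T` for every `T`.
(The value of `carrier` at empty or infinite `T` plays no role.) -/
structure AdmissibleFamily (ℓ k r : ℕ) where
  carrier : ∀ T : Type u, Set (T → JetSpace ℓ k r)
  isOpen : ∀ (T : Type u) [Finite T] [Nonempty T], IsOpen (carrier T)
  comp_mem : ∀ (R T : Type u) [Finite R] [Nonempty R] [Finite T] [Nonempty T] (j : R → T),
    Function.Injective j → ∀ f ∈ carrier T, f ∘ j ∈ carrier R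
  invariant : ∀ (T : Type u) [Finite T] [Nonempty T]
    (q : T → EuclideanSpace ℝ (Fin ℓ) → EuclideanSpace ℝ (Fin ℓ)), (∀ t, IsCoordChange (q t)) →
    ∀ f ∈ carrier T, (fun t => precompTrunc (q t) (f t)) ∈ carrier T

/-- `S` is a minimal bad event for the multijet `f`: it is nonempty, `f|S` is not admissible and
`f|R` is admissible for all nonempty proper subsets `R` of `S`.
(Only the restriction of `f` to `S` matters, so the index set of `f` may be infinite.) -/
def IsMinimalBadEvent {ℓ k r : ℕ} (X : AdmissibleFamily.{u} ℓ k r) {T : Type u}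
    (f : T → JetSpace ℓ k r) (S : Finset T) : Prop :=
  S.Nonempty ∧ (fun s : S => f s) ∉ X.carrier S ∧
    ∀ R : Finset T, R ⊂ S → R.Nonempty → (fun s : R => f s) ∈ X.carrier R

/-- A bad event for `f` is a nonempty finite union of minimal bad events. -/
def IsBadEvent {ℓ k r : ℕ} (X : AdmissibleFamily.{u} ℓ k r) {T : Type u}
    (f : T → JetSpace ℓ k r) (S : Finset T) : Prop :=
  S.Nonempty ∧ ∃ C : Set (Finset T), (∀ R ∈ C, IsMinimalBadEvent X f R) ∧
    (S : Set T) = ⋃ R ∈ C, (R : Set T)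

/-- `g` is pure: some neighborhood of `g` consists of elements which do not participate in
any bad event of any multijet. -/
def IsPure {ℓ k r : ℕ} (X : AdmissibleFamily.{u} ℓ k r) (g : JetSpace ℓ k r) : Prop :=
  ∃ U ∈ 𝓝 g, ∀ (T : Type u) [Finite T] (f : T → JetSpace ℓ k r) (S : Finset T),
    IsBadEvent X f S → ∀ t ∈ S, f t ∉ U

/-! ## Smooth maps `L → ℝ^k` -/

/-- The vector space of smooth maps `L → ℝ^k`. -/
abbrev SmoothMap {ℓ : ℕ} (k : ℕ) {H : Type v} [TopologicalSpace H]
    (I : ModelWithCorners ℝ (EuclideanSpace ℝ (Fin ℓ)) H)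
    (L : Type u) [TopologicalSpace L] [ChartedSpace H L] : Type u :=
  ContMDiffMap I 𝓘(ℝ, EuclideanSpace ℝ (Fin k)) L (EuclideanSpace ℝ (Fin k)) ∞

section Smooth

variable {ℓ k : ℕ} {H : Type v} [TopologicalSpace H]
  {I : ModelWithCorners ℝ (EuclideanSpace ℝ (Fin ℓ)) H}
  {L : Type u} [TopologicalSpace L] [ChartedSpace H L]

/-- The Whitney `C^∞` topology (for compact `L`): uniform convergence, on the compact subsets of
the images of charts, of all derivatives in these charts. -/
instance whitneyTopology : TopologicalSpace (SmoothMap k I L) :=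
  ⨅ (x : L) (m : ℕ), TopologicalSpace.induced
    (fun f : SmoothMap k I L =>
      UniformOnFun.ofFun {K : Set (EuclideanSpace ℝ (Fin ℓ)) |
          IsCompact K ∧ K ⊆ (extChartAt I x).target}
        (iteratedFDerivWithin ℝ m (f ∘ (extChartAt I x).symm) (Set.range I)))
    inferInstance

/-- The `r`-jet of `f` at `x`, expressed in local coordinates centered at `x` (those given by the
preferred chart at `x`). Another choice of local coordinates changes it by an element of `G`. -/
def jetAt (r : ℕ) (f : SmoothMap k I L) (x : L) : JetSpace ℓ k r :=
  taylorPoly r (Set.range I) (f ∘ (extChartAt I x).symm) (extChartAt I x x)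

/-- `f` has the same `r`-jets as `φ` at the points of the boundary of `L`. -/
def SameBoundaryJets (r : ℕ) (φ f : SmoothMap k I L) : Prop :=
  ∀ x ∈ I.boundary L, jetAt r f x = jetAt r φ x

/-- The interpolation property: for every finite set `T` of at most `i` interior points, every
multijet on `T` is the multijet of some element of `A`. -/
def IsInterpolating (r i : ℕ) (A : AffineSubspace ℝ (SmoothMap k I L)) : Prop :=
  ∀ T : Finset (I.interior L), T.card ≤ i →
    Function.Surjective (fun (f : A) (t : T) => jetAt r (f : SmoothMap k I L) (t : I.interior L))

end Smooth

/-! ## The classifying space of a topological poset -/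

/-- Ordered chains `c 0 ≤ … ≤ c n`, i.e. order preserving maps `{0, …, n} → Λ`, with the subspace
topology of the `(n+1)`-fold power of `Λ`. -/
abbrev NerveSpace (Λ : Type*) [Preorder Λ] (n : ℕ) : Type _ :=
  {c : Fin (n + 1) → Λ // Monotone c}

/-- The disjoint union of the spaces `N_n Λ × Δ^n`. -/
abbrev NerveSimplices (Λ : Type*) [Preorder Λ] : Type _ :=
  Σ n : ℕ, NerveSpace Λ n × stdSimplex ℝ (Fin (n + 1))

/-- The identifications `(θ^* c, t) ∼ (c, θ_* t)`, for monotone `θ : {0, …, m} → {0, …, n}`. -/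
inductive NerveRel (Λ : Type*) [Preorder Λ] : NerveSimplices Λ → NerveSimplices Λ → Prop
  | glue {m n : ℕ} (θ : Fin (m + 1) → Fin (n + 1)) (hθ : Monotone θ) (c : NerveSpace Λ n)
      (t : stdSimplex ℝ (Fin (m + 1))) :
      NerveRel Λ ⟨m, ⟨c.1 ∘ θ, c.2.comp hθ⟩, t⟩ ⟨n, c, stdSimplex.map θ t⟩

/-- The classifying space of a topological poset `Λ`: the geometric realization of the simplicial
space `n ↦ N_n Λ`. -/
def ClassifyingSpace (Λ : Type*) [Preorder Λ] : Type _ := Quot (NerveRel Λ)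

instance (Λ : Type*) [Preorder Λ] [TopologicalSpace Λ] :
    TopologicalSpace (ClassifyingSpace Λ) :=
  inferInstanceAs (TopologicalSpace (Quot (NerveRel Λ)))

/-! ## Posets of bad events -/

/-- Given a notion `bad y S` of "the finite set `S` is a bad event for `y`", the poset of
pairs `(y, S)` such that `S` is a bad event for `y`. -/
def BadPoset {Y : Type u} {X : Type v} (bad : Y → Finset X → Prop) : Type (max u v) :=
  {e : Y × Finset X // bad e.1 e.2}

section BadPoset

variable {Y : Type u} {X : Type v} {bad : Y → Finset X → Prop}

/-- `(y, S) ≤ (z, T)` if and only if `y = z` and `S ⊆ T`. -/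
instance : PartialOrder (BadPoset bad) where
  le a b := a.1.1 = b.1.1 ∧ a.1.2 ⊆ b.1.2
  le_refl a := ⟨rfl, subset_rfl⟩
  le_trans a b c h h' := ⟨h.1.trans h'.1, h.2.trans h'.2⟩
  le_antisymm a b h h' := Subtype.ext (Prod.ext h.1 (h.2.antisymm h'.2))

/-- `(y_j, S_j)` converges to `(y, S)` if `y_j` converges to `y` and `S_j` converges to `S` in the
Vietoris topology, which is the topology of the Hausdorff distance for any metric on `X`. -/
instance [TopologicalSpace Y] [TopologicalSpace X] : TopologicalSpace (BadPoset bad) :=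
  TopologicalSpace.induced (fun e : BadPoset bad => (e.1.1, (e.1.2 : Set X)))
    (@instTopologicalSpaceProd Y (Set X) _ (TopologicalSpace.vietoris X))

/-- The projection `(y, S) ↦ y`, on the classifying space. -/
def ClassifyingSpace.base : ClassifyingSpace (BadPoset bad) → Y :=
  Quot.lift (fun z => (z.2.1.1 0).1.1) (by
    rintro _ _ ⟨θ, hθ, c, t⟩
    exact (c.2 (Fin.zero_le (θ 0))).1.symm)

open scoped Classical in
/-- A point of the classifying space lies in the interior of a unique nondegenerate simplex, given
by a chain `(y, S_0) < ⋯ < (y, S_n)`. This is the largest event `S_n`. (In terms of any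
representative `(c, t)` it is the union of those events in the chain `c` which have nonzero
weight `t j`.) -/
def ClassifyingSpace.topEvent : ClassifyingSpace (BadPoset bad) → Finset X :=
  Quot.lift
    (fun z => (Finset.univ.filter (fun j => z.2.2 j ≠ 0)).biUnion (fun j => (z.2.1.1 j).1.2)) (by
    rintro _ _ ⟨θ, hθ, c, t⟩
    ext x
    simp only [Finset.mem_biUnion, Finset.mem_filter, Finset.mem_univ, true_and,
      stdSimplex.map_coe, FunOnFinite.linearMap_apply_apply, Function.comp_apply]
    constructor
    · rintro ⟨j, hj, hx⟩
      refine ⟨θ j, fun h => hj ?_, hx⟩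
      exact (Finset.sum_eq_zero_iff_of_nonneg (fun i _ => t.2.1 i)).1 h j (by simp)
    · rintro ⟨i, hi, hx⟩
      obtain ⟨j, hj, hj'⟩ := Finset.exists_ne_zero_of_sum_ne_zero hi
      exact ⟨j, hj', by simpa [(Finset.mem_filter.1 hj).2] using hx⟩)

/-- The `p`-th stage of the filtration of the classifying space: the points which lie in the
interior of a nondegenerate simplex `(y, S_0) < ⋯ < (y, S_n)` with `|S_n| ≤ p`. -/
def filtrationStage (bad : Y → Finset X → Prop) (p : ℕ) :
    Set (ClassifyingSpace (BadPoset bad)) :=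
  {z | z.topEvent.card ≤ p}

end BadPoset

/-! ## Configurations -/

/-- Unordered configurations of `p` distinct points in `X`. -/
def Config (X : Type u) (p : ℕ) : Type u := {S : Finset X // S.card = p}

/-- The unordered configuration given by an ordered one. -/
def Config.ofTuple {X : Type u} {p : ℕ} (c : {c : Fin p → X // Function.Injective c}) :
    Config X p :=
  ⟨Finset.univ.map ⟨c.1, c.2⟩, by simp⟩

/-- The quotient topology from the space of ordered configurations. -/
instance (X : Type u) (p : ℕ) [TopologicalSpace X] : TopologicalSpace (Config X p) :=
  TopologicalSpace.coinduced Config.ofTuple inferInstance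

/-- The filtration difference `F_p ∖ F_{p-1}`. -/
abbrev FiltrationDiff {Y : Type u} {X : Type v} (bad : Y → Finset X → Prop) (p : ℕ) : Type _ :=
  ↥(filtrationStage bad p \ filtrationStage bad (p - 1))

/-- The map from the filtration difference `F_p ∖ F_{p-1}` to the configuration space,
`(y, S, x) ↦ S`. -/
def FiltrationDiff.toConfig {Y : Type u} {X : Type v} (bad : Y → Finset X → Prop) (p : ℕ)
    (z : FiltrationDiff bad p) : Config X p :=
  ⟨z.1.topEvent, by
    have h₁ : z.1.topEvent.card ≤ p := z.2.1
    have h₂ : ¬ z.1.topEvent.card ≤ p - 1 := z.2.2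
    omega⟩

/-! ## Fiberwise open cones -/

/-- Glue `(a, 0)` to `q a`. -/
inductive OpenConeRel {K : Type u} {Y : Type v} (q : K → Y) :
    Y ⊕ (K × Set.Ico (0 : ℝ) 1) → Y ⊕ (K × Set.Ico (0 : ℝ) 1) → Prop
  | glue (a : K) : OpenConeRel q (Sum.inr (a, ⟨0, by simp⟩)) (Sum.inl (q a))

/-- The fiberwise open cone on `q : K → Y`, i.e. the open mapping cylinder. Its points are the
pairs `(y, x)` with `y ∈ Y` and `x` in the open cone `q⁻¹(y) × [0,1) / q⁻¹(y) × 0`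
(just the cone point if `q⁻¹(y)` is empty). -/
def FiberwiseOpenCone {K : Type u} {Y : Type v} (q : K → Y) : Type (max u v) :=
  Quot (OpenConeRel q)

instance {K : Type u} {Y : Type v} [TopologicalSpace K] [TopologicalSpace Y] (q : K → Y) :
    TopologicalSpace (FiberwiseOpenCone q) :=
  inferInstanceAs (TopologicalSpace (Quot (OpenConeRel q)))

/-- The multijets `h ∈ P^S` which have `S` (the whole index set) as a bad event. -/
abbrev BadMultijet {ℓ k r : ℕ} (X : AdmissibleFamily.{u} ℓ k r) (S : Type u) [Fintype S] :
    Type u :=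
  {h : S → JetSpace ℓ k r // IsBadEvent X h Finset.univ}

/-- `R` is a proper subset of `S` which is a bad event for `h`. -/
def IsProperBadEvent {ℓ k r : ℕ} (X : AdmissibleFamily.{u} ℓ k r) {S : Type u} [Fintype S]
    (h : BadMultijet X S) (R : Finset S) : Prop :=
  R ≠ Finset.univ ∧ IsBadEvent X h.1 R

/-- The space of pairs `(h, x)` where the multijet `h ∈ P^S` has `S` as a bad event and `x` belongs
to the open cone on the classifying space of the poset of proper subsets of `S` which are bad
events for `h`. -/
abbrev DecoratedBadMultijet {ℓ k r : ℕ} (X : AdmissibleFamily.{u} ℓ k r) (S : Type u) [Fintype S]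
    [TopologicalSpace S] : Type u :=
  FiberwiseOpenCone (ClassifyingSpace.base (bad := IsProperBadEvent X (S := S)))

/-! ## The resolved discriminant -/

section Discriminant

variable {ℓ k r : ℕ} {H : Type v} [TopologicalSpace H]
  {I : ModelWithCorners ℝ (EuclideanSpace ℝ (Fin ℓ)) H}
  {L : Type u} [TopologicalSpace L] [ChartedSpace H L]

/-- The finite set `S` of interior points of `L` is a bad event for `f ∈ A`, i.e. for the multijet
of `f` at `S`. The classifying space of `BadPoset (IsBadFor X A)` is the resolved
discriminant of `A`. -/
def IsBadFor (X : AdmissibleFamily.{u} ℓ k r) (A : AffineSubspace ℝ (SmoothMap k I L))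
    (f : A) (S : Finset (I.interior L)) : Prop :=
  IsBadEvent X (fun x : I.interior L => jetAt r (f : SmoothMap k I L) x) S

/-- `S` is a finite nonempty set of points of `L` (in the interior) at which `f ∈ A` is
inadmissible, for a set `X ⊆ P` of admissible jets. The classifying space of
`BadPoset (IsInadmissibleFor X A)` is the resolved discriminant of `A` for single jets. -/
def IsInadmissibleFor (X : Set (JetSpace ℓ k r)) (A : AffineSubspace ℝ (SmoothMap k I L))
    (f : A) (S : Finset (I.interior L)) : Prop :=
  S.Nonempty ∧ ∀ x ∈ S, jetAt r (f : SmoothMap k I L) x ∉ X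

end Discriminant

/-- The map `π` has a local trivialization with model fiber `F` over some neighborhood of `b`.
In particular `π⁻¹(b)` is homeomorphic to `F`. -/
def IsLocallyTrivialAt {Z : Type*} {B : Type*} [TopologicalSpace Z] [TopologicalSpace B]
    (π : Z → B) (F : Type*) [TopologicalSpace F] (b : B) : Prop :=
  ∃ e : Bundle.Trivialization F π, b ∈ e.baseSet

end

/-! A point of the resolved discriminant is the same as a map `f` together with a probability
measure on a finite chain of bad events for `f`, its barycentric coordinates
(`ClassifyingSpace.ext_base_weight`). If the largest event of the chain is `S`, the weights of the
proper subsets of `S` have total less than one, and they form an arbitrary point of the open cone on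
the poset of proper bad events in `S`; the vertex of the cone puts all weight on `S`. Which subsets
of `S` are bad depends only on the multijet of `f` at `S`. So local triviality of `π` reduces to
trivializing the evaluation maps from `A` to multijets at a moving configuration.

Near a given configuration `S`, jets are taken in charts fixed at the points of `S`, so that they
vary continuously; invariance under coordinate changes shows that the bad events are not affected
(`isBadFor_map_iff`). Interpolation makes the multijet map surjective at `S`. Completed by a fixed
projection to its kernel, it becomes bijective, and it remains so nearby because invertibility is an
open condition (`exists_homeomorph_of_surjective`). This gives coordinates `U × A ≃ U × (ℝ^b × P^S)`
in which the notion of bad event is constant (`exists_eventModel`).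

It remains to pass from such coordinates to classifying spaces, which are quotients of disjoint
unions of simplices. Quotient maps are in general compatible neither with subspaces nor with
products; they are so here because the filtration difference is locally closed
(`continuous_of_isLocallyClosed`) and `U × ℝ^b` is locally compact (`continuous_prod_of`). The
homeomorphism is given by the relation `EventModel.Corresponds`, which compares base points and
weights. It is bijective, and continuity of both directions is tested on simplices
(`EventModel.exists_homeomorph`).

For single jets the minimal bad events are singletons, so all nonempty subsets of a bad event are
bad, and the cone is the open cone on the subdivided boundary of a simplex. Assigning to a point of
`S` the total weight of the sets that miss it identifies this cone with the functions `S → [0, 1)`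
of minimum zero, a copy of `ℝ^(p-1)` (`nonempty_homeomorph_fullCone`). -/

/-! ## Points of classifying spaces -/

namespace ClassifyingSpace

open Topology

open scoped Classical in
/-- The first indices at which `c` takes its values, among those of nonzero weight. -/
noncomputable def firstIndices {Λ : Type*} {n : ℕ} (c : Fin (n + 1) → Λ) (t : Fin (n + 1) → ℝ) : Finset (Fin (n + 1)) :=
  Finset.univ.filter fun j => t j ≠ 0 ∧ ∀ i < j, t i ≠ 0 → c i ≠ c j

theorem exists_firstIndices {Λ : Type*} {n : ℕ} (c : Fin (n + 1) → Λ) (t : Fin (n + 1) → ℝ)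
    (j : Fin (n + 1)) (hj : t j ≠ 0) : ∃ i ∈ firstIndices c t, c i = c j := by
  classical
  let s : Finset (Fin (n + 1)) := Finset.univ.filter fun i => t i ≠ 0 ∧ c i = c j
  have hs : s.Nonempty := ⟨j, by simp [s, hj]⟩
  have h := s.min'_mem hs
  simp only [s, Finset.mem_filter, Finset.mem_univ, true_and] at h
  refine ⟨s.min' hs, ?_, h.2⟩
  simp only [firstIndices, Finset.mem_filter, Finset.mem_univ, true_and]
  refine ⟨h.1, fun i hi hti hci => ?_⟩
  exact absurd (s.min'_le i (by simp [s, hti, hci, h.2])) (not_le.2 hi)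

section Preorder

variable {Λ : Type*} [Preorder Λ]

/-- The point of the classifying space with barycentric coordinates `t` in the simplex `c`. -/
def mk {n : ℕ} (c : NerveSpace Λ n) (t : stdSimplex ℝ (Fin (n + 1))) : ClassifyingSpace Λ :=
  Quot.mk _ ⟨n, c, t⟩

theorem exists_mk (z : ClassifyingSpace Λ) :
    ∃ (n : ℕ) (c : NerveSpace Λ n) (t : stdSimplex ℝ (Fin (n + 1))), mk c t = z := by
  obtain ⟨⟨n, c, t⟩, rfl⟩ := Quot.exists_rep z
  exact ⟨n, c, t, rfl⟩

theorem mk_comp {m n : ℕ} (θ : Fin (m + 1) → Fin (n + 1)) (hθ : Monotone θ) (c : NerveSpace Λ n)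
    (t : stdSimplex ℝ (Fin (m + 1))) :
    mk (Λ := Λ) ⟨c.1 ∘ θ, c.2.comp hθ⟩ t = mk c (stdSimplex.map θ t) :=
  Quot.sound (NerveRel.glue θ hθ c t)

/-- The projection from the disjoint union of all simplices. -/
def ofSimplex (z : NerveSimplices Λ) : ClassifyingSpace Λ := mk z.2.1 z.2.2

theorem isQuotientMap_ofSimplex [TopologicalSpace Λ] :
    IsQuotientMap (ofSimplex : NerveSimplices Λ → ClassifyingSpace Λ) :=
  isQuotientMap_quot_mk (r := NerveRel Λ)

theorem continuous_mk [TopologicalSpace Λ] {n : ℕ} :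
    Continuous fun x : NerveSpace Λ n × stdSimplex ℝ (Fin (n + 1)) => mk x.1 x.2 :=
  isQuotientMap_ofSimplex.continuous.comp
    (continuous_sigmaMk (σ := fun n => NerveSpace Λ n × stdSimplex ℝ (Fin (n + 1))) (i := n))

theorem isOpen_iff_mk [TopologicalSpace Λ] {s : Set (ClassifyingSpace Λ)} : IsOpen s ↔
    ∀ n, IsOpen {x : NerveSpace Λ n × stdSimplex ℝ (Fin (n + 1)) | mk x.1 x.2 ∈ s} := by
  rw [← isQuotientMap_ofSimplex.isOpen_preimage, isOpen_sigma_iff]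
  rfl

theorem stdSimplex_map_apply {m n : ℕ} (θ : Fin m → Fin n) (t : stdSimplex ℝ (Fin m)) (i : Fin n) :
    stdSimplex.map θ t i = ∑ j, if θ j = i then t j else 0 := by
  classical
  rw [stdSimplex.map_coe, FunOnFinite.linearMap_apply_apply, Finset.sum_filter]

end Preorder

section PartialOrder

variable {Λ : Type*} [PartialOrder Λ]

/-- A point of the classifying space of a poset lies in any simplex whose vertices include those
of nonzero weight. -/
theorem mk_eq_of_strictMono {n : ℕ} (c : NerveSpace Λ n) (t : stdSimplex ℝ (Fin (n + 1)))
    {N : ℕ} (d : Fin (N + 1) → Λ) (hd : StrictMono d)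
    (hc : ∀ j, t j ≠ 0 → c.1 j ∈ Set.range d) :
    ∃ t' : stdSimplex ℝ (Fin (N + 1)), mk c t = mk ⟨d, hd.monotone⟩ t' ∧
      ∀ k, t' k = ∑ j, open scoped Classical in if c.1 j = d k then t j else 0 := by
  classical
  -- Two gluings are used: `θ` deletes the vertices of weight zero, and `ρ` locates the remaining
  -- ones, possibly with repetitions, in the chain `d`.
  let J : Finset (Fin (n + 1)) := Finset.univ.filter fun j => t j ≠ 0
  have hJ : J.card ≠ 0 := by
    intro h
    rw [Finset.card_eq_zero] at h
    have : ∀ j, t j = 0 := fun j => by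
      by_contra hj
      have : j ∈ J := by simp [J, hj]
      simp [h] at this
    have h1 : ∑ j, t j = 1 := t.2.2
    simp [this] at h1
  obtain ⟨m, hm⟩ := Nat.exists_eq_succ_of_ne_zero hJ
  let θ := J.orderEmbOfFin hm
  have hθr : Set.range θ = J := J.range_orderEmbOfFin hm
  have hθJ : ∀ j, t (θ j) ≠ 0 := fun j => by
    have : θ j ∈ J := J.orderEmbOfFin_mem hm j
    simpa only [J, Finset.mem_filter, Finset.mem_univ, true_and] using this
  have hθ : ∀ i, t i ≠ 0 → ∃ j, θ j = i := fun i hi => by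
    have : i ∈ Set.range θ := by rw [hθr]; simpa [J] using hi
    exact this
  have key : ∀ i, (∑ j, if θ j = i then t (θ j) else 0) = t i := by
    intro i
    by_cases hi : t i = 0
    · rw [hi]
      refine Finset.sum_eq_zero fun j _ => ?_
      split_ifs with h
      · rw [h, hi]
      · rfl
    · obtain ⟨j, rfl⟩ := hθ i hi
      rw [Finset.sum_eq_single j] <;> simp +contextual [θ.injective.eq_iff]
  let t₁ : stdSimplex ℝ (Fin (m + 1)) := ⟨fun j => t (θ j), fun j => t.2.1 _, by
    have h1 : ∑ j, t j = 1 := t.2.2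
    rw [← h1, ← Finset.sum_congr rfl fun i _ => key i, Finset.sum_comm]
    simp⟩
  have ht₁ : stdSimplex.map θ t₁ = t := by
    ext i
    rw [stdSimplex_map_apply]
    exact key i
  choose ρ hρ using fun j : Fin (m + 1) => hc (θ j) (hθJ j)
  have hρm : Monotone ρ := by
    intro i j hij
    by_contra h
    have h1 := hd (not_le.1 h)
    rw [hρ, hρ] at h1
    exact absurd (c.2 (θ.monotone hij)) (not_le_of_gt h1)
  refine ⟨stdSimplex.map ρ t₁, ?_, fun k => ?_⟩
  · rw [← mk_comp ρ hρm]
    conv_lhs => rw [← ht₁]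
    rw [← mk_comp θ θ.monotone]
    congr 2
    funext j
    exact (hρ j).symm
  · have h2 : ∀ j, (if c.1 j = d k then t j else 0) =
        ∑ i, if θ i = j then (if ρ i = k then t₁ i else 0) else 0 := by
      intro j
      have : ∀ i, (if θ i = j then (if ρ i = k then t₁ i else 0) else 0) =
          if c.1 j = d k then (if θ i = j then t (θ i) else 0) else 0 := by
        intro i
        by_cases h : θ i = j
        · subst h
          rw [← hρ i]
          simp only [hd.injective.eq_iff, if_true]
          rfl
        · simp [h]
      rw [Finset.sum_congr rfl fun i _ => this i]
      by_cases h : c.1 j = d k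
      · simp only [h, if_true, key]
      · simp [h]
    rw [stdSimplex_map_apply, Finset.sum_congr rfl fun j _ => h2 j, Finset.sum_comm]
    simp

/-- Both points can be moved into the simplex spanned by the distinct values of nonzero weight of
`c`; equality of the total weights shows that these include the values of nonzero weight of `c'`.
The vertices of this simplex are not repeated, so that barycentric coordinates there are total
weights. -/
theorem mk_eq_mk_of_weights {m n : ℕ} (c : NerveSpace Λ m) (t : stdSimplex ℝ (Fin (m + 1)))
    (c' : NerveSpace Λ n) (t' : stdSimplex ℝ (Fin (n + 1)))
    (h : ∀ a : Λ, (∑ j, open scoped Classical in if c.1 j = a then t j else 0) =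
      ∑ j, open scoped Classical in if c'.1 j = a then t' j else 0) : mk c t = mk c' t' := by
  classical
  have hpos : ∀ {k : ℕ} (e : NerveSpace Λ k) (s : stdSimplex ℝ (Fin (k + 1))) (a : Λ),
      (∑ j, if e.1 j = a then s j else 0) ≠ 0 ↔ ∃ j, s j ≠ 0 ∧ e.1 j = a := by
    intro k e s a
    rw [Ne, Finset.sum_eq_zero_iff_of_nonneg]
    · simp only [Finset.mem_univ, true_imp_iff, ite_eq_right_iff, not_forall]
      exact ⟨fun ⟨j, h1, h2⟩ => ⟨j, h2, h1⟩, fun ⟨j, h1, h2⟩ => ⟨j, h2, h1⟩⟩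
    · intro j _
      split_ifs
      · exact s.2.1 j
      · exact le_rfl
  let J := firstIndices c.1 t
  have hJ : J.card ≠ 0 := by
    have : ∃ j, t j ≠ 0 := by
      by_contra hcon
      push Not at hcon
      have h1 : ∑ j, t j = 1 := t.2.2
      simp [hcon] at h1
    obtain ⟨j, hj⟩ := this
    obtain ⟨i, hi, -⟩ := exists_firstIndices c.1 t j hj
    exact Finset.card_ne_zero_of_mem hi
  obtain ⟨N, hN⟩ := Nat.exists_eq_succ_of_ne_zero hJ
  let θ := J.orderEmbOfFin hN
  have hθJ : ∀ k, θ k ∈ J := J.orderEmbOfFin_mem hN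
  have hd : StrictMono (c.1 ∘ θ) := by
    refine (c.2.comp θ.monotone).strictMono_of_injective fun a b hab => ?_
    have hmem : ∀ k, t (θ k) ≠ 0 ∧ ∀ i < θ k, t i ≠ 0 → c.1 i ≠ c.1 (θ k) := fun k => by
      simpa [J, firstIndices] using hθJ k
    rcases lt_trichotomy a b with hlt | heq | hlt
    · exact absurd hab ((hmem b).2 _ (θ.strictMono hlt) (hmem a).1)
    · exact heq
    · exact absurd hab.symm ((hmem a).2 _ (θ.strictMono hlt) (hmem b).1)
  have hr : ∀ j, t j ≠ 0 → c.1 j ∈ Set.range (c.1 ∘ θ) := by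
    intro j hj
    obtain ⟨i, hi, hij⟩ := exists_firstIndices c.1 t j hj
    have : i ∈ Set.range θ := by rw [J.range_orderEmbOfFin hN]; exact hi
    obtain ⟨k, rfl⟩ := this
    exact ⟨k, hij⟩
  have hr' : ∀ j, t' j ≠ 0 → c'.1 j ∈ Set.range (c.1 ∘ θ) := by
    intro j hj
    obtain ⟨i, hi, hij⟩ := (hpos c t (c'.1 j)).1 (by rw [h]; exact (hpos c' t' _).2 ⟨j, hj, rfl⟩)
    rw [← hij]
    exact hr i hi
  obtain ⟨s, hs, hsk⟩ := mk_eq_of_strictMono c t _ hd hr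
  obtain ⟨s', hs', hsk'⟩ := mk_eq_of_strictMono c' t' _ hd hr'
  rw [hs, hs']
  congr 1
  ext k
  rw [hsk, hsk', h]

end PartialOrder

section BadPoset

variable {Y : Type u} {X : Type v} {bad : Y → Finset X → Prop}

/-- The weight of an event at a point of the classifying space: its barycentric coordinate. -/
noncomputable def weight : ClassifyingSpace (BadPoset bad) → Finset X → ℝ :=
  Quot.lift (fun z S => ∑ j, open scoped Classical in if (z.2.1.1 j).1.2 = S then z.2.2 j else 0)
    (by
    classical
    rintro _ _ ⟨θ, hθ, c, t⟩
    funext S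
    simp only [stdSimplex_map_apply, Function.comp_apply]
    have : ∀ j, (if (c.1 j).1.2 = S then ∑ i, (if θ i = j then t i else 0) else 0) =
        ∑ i, if θ i = j then (if (c.1 (θ i)).1.2 = S then t i else 0) else 0 := by
      intro j
      split_ifs with h
      · refine Finset.sum_congr rfl fun i _ => ?_
        by_cases hi : θ i = j
        · simp [hi, h]
        · simp [hi]
      · refine (Finset.sum_eq_zero fun i _ => ?_).symm
        by_cases hi : θ i = j
        · simp [hi, h]
        · simp [hi]
    rw [Finset.sum_congr rfl fun j _ => this j, Finset.sum_comm]
    simp)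

open scoped Classical in
theorem weight_mk {n : ℕ} (c : NerveSpace (BadPoset bad) n) (t : stdSimplex ℝ (Fin (n + 1)))
    (S : Finset X) : weight (mk c t) S = ∑ j, if (c.1 j).1.2 = S then t j else 0 := by
  unfold weight mk
  rfl

theorem base_mk {n : ℕ} (c : NerveSpace (BadPoset bad) n) (t : stdSimplex ℝ (Fin (n + 1)))
    (j : Fin (n + 1)) : base (mk c t) = (c.1 j).1.1 :=
  (c.2 (Fin.zero_le j)).1

theorem mem_topEvent_mk {n : ℕ} (c : NerveSpace (BadPoset bad) n)
    (t : stdSimplex ℝ (Fin (n + 1))) (x : X) :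
    x ∈ topEvent (mk c t) ↔ ∃ j, t j ≠ 0 ∧ x ∈ (c.1 j).1.2 := by
  classical
  unfold topEvent mk
  simp

/-- All vertices of a chain have the same first component, so the base and the weights of the finite
sets determine the weights of all pairs `(y, S)`. Points are identified below by comparing these two
invariants. -/
theorem ext_base_weight {z z' : ClassifyingSpace (BadPoset bad)} (hb : base z = base z')
    (hw : weight z = weight z') : z = z' := by
  classical
  obtain ⟨m, c, t, rfl⟩ := exists_mk z
  obtain ⟨n, c', t', rfl⟩ := exists_mk z'
  apply mk_eq_mk_of_weights
  rintro ⟨⟨y, S⟩, hS⟩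
  have key : ∀ {k : ℕ} (e : NerveSpace (BadPoset bad) k) (s : stdSimplex ℝ (Fin (k + 1))),
      (∑ j, if e.1 j = ⟨⟨y, S⟩, hS⟩ then s j else 0) =
        if base (mk e s) = y then weight (mk e s) S else 0 := by
    intro k e s
    rw [weight_mk]
    have : ∀ j, e.1 j = ⟨⟨y, S⟩, hS⟩ ↔ base (mk e s) = y ∧ (e.1 j).1.2 = S := fun j => by
      rw [base_mk e s j]
      exact ⟨fun h => by simp [h], fun ⟨h1, h2⟩ => Subtype.ext (Prod.ext h1 h2)⟩
    simp only [this]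
    split_ifs with h <;> simp [h]
  rw [key, key, hb, hw]

theorem weight_nonneg (z : ClassifyingSpace (BadPoset bad)) (S : Finset X) : 0 ≤ weight z S := by
  classical
  obtain ⟨m, c, t, rfl⟩ := exists_mk z
  rw [weight_mk]
  refine Finset.sum_nonneg fun j _ => ?_
  split_ifs
  · exact t.2.1 j
  · exact le_rfl

theorem weight_mk_ne_zero_iff {n : ℕ} (c : NerveSpace (BadPoset bad) n)
    (t : stdSimplex ℝ (Fin (n + 1))) (S : Finset X) :
    weight (mk c t) S ≠ 0 ↔ ∃ j, t j ≠ 0 ∧ (c.1 j).1.2 = S := by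
  classical
  rw [weight_mk, Ne, Finset.sum_eq_zero_iff_of_nonneg]
  · simp only [Finset.mem_univ, true_imp_iff, ite_eq_right_iff, not_forall]
    exact ⟨fun ⟨j, h1, h2⟩ => ⟨j, h2, h1⟩, fun ⟨j, h1, h2⟩ => ⟨j, h2, h1⟩⟩
  · intro j _
    split_ifs
    · exact t.2.1 j
    · exact le_rfl

theorem mem_topEvent {z : ClassifyingSpace (BadPoset bad)} {x : X} :
    x ∈ topEvent z ↔ ∃ S, weight z S ≠ 0 ∧ x ∈ S := by
  obtain ⟨m, c, t, rfl⟩ := exists_mk z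
  simp only [mem_topEvent_mk, weight_mk_ne_zero_iff]
  constructor
  · rintro ⟨j, h1, h2⟩
    exact ⟨_, ⟨j, h1, rfl⟩, h2⟩
  · rintro ⟨S, ⟨j, h1, rfl⟩, h2⟩
    exact ⟨j, h1, h2⟩

theorem bad_base_of_weight_ne_zero {z : ClassifyingSpace (BadPoset bad)} {S : Finset X}
    (h : weight z S ≠ 0) : bad (base z) S := by
  obtain ⟨m, c, t, rfl⟩ := exists_mk z
  obtain ⟨j, -, rfl⟩ := (weight_mk_ne_zero_iff c t S).1 h
  rw [base_mk c t j]
  exact (c.1 j).2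

theorem subset_or_subset_of_weight_ne_zero {z : ClassifyingSpace (BadPoset bad)} {S T : Finset X}
    (hS : weight z S ≠ 0) (hT : weight z T ≠ 0) : S ⊆ T ∨ T ⊆ S := by
  obtain ⟨m, c, t, rfl⟩ := exists_mk z
  obtain ⟨i, -, rfl⟩ := (weight_mk_ne_zero_iff c t S).1 hS
  obtain ⟨j, -, rfl⟩ := (weight_mk_ne_zero_iff c t T).1 hT
  rcases le_total i j with h | h
  · exact Or.inl (c.2 h).2
  · exact Or.inr (c.2 h).2

end BadPoset

end ClassifyingSpace

/-! ## Topology of configuration spaces and posets of events -/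

theorem exists_disjoint_opens {X : Type*} [TopologicalSpace X] [T2Space X] (S : Finset X)
    {O : S → Set X} (hO : ∀ s, IsOpen (O s)) (hmem : ∀ s : S, (s : X) ∈ O s) :
    ∃ V : S → Set X, (∀ s, IsOpen (V s)) ∧ (∀ s : S, (s : X) ∈ V s) ∧ (∀ s, V s ⊆ O s) ∧
      Pairwise fun s t => Disjoint (V s) (V t) := by
  obtain ⟨U, hU, hd⟩ := S.finite_toSet.t2_separation
  refine ⟨fun s => U s ∩ O s, fun s => (hU s).2.inter (hO s), fun s => ⟨(hU s).1, hmem s⟩,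
    fun s => Set.inter_subset_right, fun s t hst => ?_⟩
  exact (hd s.2 t.2 (fun h => hst (Subtype.ext h))).mono Set.inter_subset_left
    Set.inter_subset_left

/-- A finite set which meets all members of a disjoint family is at least as large as the family. -/
theorem card_le_card_of_hits {X ι : Type*} [Fintype ι] {V : ι → Set X}
    (hd : Pairwise fun s t => Disjoint (V s) (V t)) {A : Finset X}
    (hA : ∀ s, ∃ x ∈ A, x ∈ V s) : Fintype.card ι ≤ A.card := by
  choose f hf hfV using hA
  have hinj : Function.Injective fun s => (⟨f s, hf s⟩ : A) := by
    intro s t hst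
    by_contra hne
    have h : f s = f t := congrArg Subtype.val hst
    exact Set.disjoint_left.1 (hd hne) (hfV s) (h ▸ hfV t)
  simpa using Fintype.card_le_of_injective _ hinj

namespace BadPoset

variable {Y : Type u} {X : Type v} {bad : Y → Finset X → Prop} [TopologicalSpace Y]
  [TopologicalSpace X]

theorem continuous_fst : Continuous fun e : BadPoset bad => e.1.1 :=
  let _ := TopologicalSpace.vietoris X
  have h : Continuous fun e : BadPoset bad => (e.1.1, (e.1.2 : Set X)) := continuous_induced_dom
  h.fst

theorem isOpen_hit {V : Set X} (hV : IsOpen V) :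
    IsOpen {e : BadPoset bad | ∃ x ∈ e.1.2, x ∈ V} := by
  let _ := TopologicalSpace.vietoris X
  have h : Continuous fun e : BadPoset bad => (e.1.2 : Set X) :=
    Continuous.comp (g := Prod.snd) _root_.continuous_snd
    (continuous_induced_dom (f := fun e : BadPoset bad => (e.1.1, (e.1.2 : Set X))))
  exact (TopologicalSpace.vietoris.isOpen_inter_nonempty_of_isOpen hV).preimage h

theorem isOpen_subset {V : Set X} (hV : IsOpen V) :
    IsOpen {e : BadPoset bad | ∀ x ∈ e.1.2, x ∈ V} := by
  let _ := TopologicalSpace.vietoris X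
  have h : Continuous fun e : BadPoset bad => (e.1.2 : Set X) :=
    Continuous.comp (g := Prod.snd) _root_.continuous_snd
    (continuous_induced_dom (f := fun e : BadPoset bad => (e.1.1, (e.1.2 : Set X))))
  exact hV.powerset_vietoris.preimage h

theorem continuous_of {A : Type*} [TopologicalSpace A] {f : A → BadPoset bad}
    (h1 : Continuous fun a => (f a).1.1)
    (h2 : ∀ V : Set X, IsOpen V → IsOpen {a | ∃ x ∈ (f a).1.2, x ∈ V})
    (h3 : ∀ V : Set X, IsOpen V → IsOpen {a | ∀ x ∈ (f a).1.2, x ∈ V}) : Continuous f := by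
  let _ := TopologicalSpace.vietoris X
  refine continuous_induced_rng.2 (h1.prodMk (continuous_generateFrom_iff.2 ?_))
  rintro _ (⟨V, hV, rfl⟩ | ⟨V, hV, rfl⟩)
  · exact h3 V hV
  · exact h2 V hV

/-- Continuity of a family of events given by finitely many continuous families of points. -/
theorem continuous_of_map {A ι : Type*} [TopologicalSpace A] {f : A → BadPoset bad}
    (h1 : Continuous fun a => (f a).1.1) (R : Finset ι) (x : A → ι → X)
    (hx : ∀ s ∈ R, Continuous fun a => x a s)
    (hf : ∀ a y, y ∈ (f a).1.2 ↔ ∃ s ∈ R, x a s = y) : Continuous f := by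
  refine continuous_of h1 (fun V hV => ?_) (fun V hV => ?_)
  · have : {a | ∃ y ∈ (f a).1.2, y ∈ V} = ⋃ s ∈ R, {a | x a s ∈ V} := by
      ext a
      simp only [hf, Set.mem_ofPred_eq, Set.mem_iUnion]
      constructor
      · rintro ⟨_, ⟨s, hs, rfl⟩, h⟩
        exact ⟨s, hs, h⟩
      · rintro ⟨s, hs, h⟩
        exact ⟨_, ⟨s, hs, rfl⟩, h⟩
    rw [this]
    exact isOpen_biUnion fun s hs => hV.preimage (hx s hs)
  · have : {a | ∀ y ∈ (f a).1.2, y ∈ V} = ⋂ s ∈ R, {a | x a s ∈ V} := by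
      ext a
      simp only [hf, Set.mem_ofPred_eq, Set.mem_iInter]
      constructor
      · exact fun h s hs => h _ ⟨s, hs, rfl⟩
      · rintro h _ ⟨s, hs, rfl⟩
        exact h s hs
    rw [this]
    exact isOpen_biInter_finset fun s hs => hV.preimage (hx s hs)

/-- Cardinality is lower semicontinuous: an event near `e` meets disjoint neighborhoods of all
points of `e`. It may be larger, since several points can converge to one. -/
theorem isOpen_le_card [T2Space X] (n : ℕ) : IsOpen {e : BadPoset bad | n ≤ e.1.2.card} := by
  rw [isOpen_iff_mem_nhds]
  intro e he
  obtain ⟨V, hV, hmem, -, hd⟩ := exists_disjoint_opens e.1.2 (O := fun _ => Set.univ)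
    (fun _ => isOpen_univ) (fun _ => trivial)
  have hopen : IsOpen (⋂ s : e.1.2, {e' : BadPoset bad | ∃ x ∈ e'.1.2, x ∈ V s}) :=
    isOpen_iInter_of_finite fun s => isOpen_hit (hV s)
  refine Filter.mem_of_superset (hopen.mem_nhds (Set.mem_iInter.2 fun s => ⟨s, s.2, hmem s⟩)) ?_
  intro e' he'
  refine le_trans (show n ≤ e.1.2.card from he) ?_
  have := card_le_card_of_hits hd (A := e'.1.2) (fun s => Set.mem_iInter.1 he' s)
  simpa using this

end BadPoset

namespace Config

open Topology

variable {X : Type u} {p : ℕ}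

theorem ofTuple_surjective : Function.Surjective (ofTuple : _ → Config X p) := by
  rintro ⟨S, rfl⟩
  let e := S.equivFin.symm
  refine ⟨⟨fun i => (e i : X), Subtype.val_injective.comp e.injective⟩, Subtype.ext ?_⟩
  ext x
  simp only [ofTuple, Finset.mem_map, Finset.mem_univ, true_and, Function.Embedding.coeFn_mk]
  exact ⟨by rintro ⟨i, rfl⟩; exact (e i).2, fun h => ⟨e.symm ⟨x, h⟩, by simp⟩⟩

theorem mem_ofTuple {c : {c : Fin p → X // Function.Injective c}} {x : X} :
    x ∈ (ofTuple c).1 ↔ ∃ i, c.1 i = x := by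
  simp [ofTuple]

variable [TopologicalSpace X]

theorem continuous_ofTuple :
    Continuous (ofTuple : {c : Fin p → X // Function.Injective c} → Config X p) :=
  continuous_coinduced_rng

theorem isOpen_hit {V : Set X} (hV : IsOpen V) :
    IsOpen {S : Config X p | ∃ x ∈ S.1, x ∈ V} := by
  refine isOpen_coinduced.2 ?_
  have : ofTuple ⁻¹' {S : Config X p | ∃ x ∈ S.1, x ∈ V} = ⋃ i, {c | c.1 i ∈ V} := by
    ext c
    simp [mem_ofTuple]
  rw [this]
  exact isOpen_iUnion fun i => hV.preimage ((continuous_apply i).comp continuous_subtype_val)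

/-- The events which meet neighborhoods of all the points of a configuration are close to it. -/
theorem exists_hits_subset [T2Space X] {O : Set (Config X p)} (hO : IsOpen O) {S : Config X p}
    (hS : S ∈ O) : ∃ V : S.1 → Set X, (∀ s, IsOpen (V s)) ∧ (∀ s : S.1, (s : X) ∈ V s) ∧
      ∀ T : Config X p, (∀ s, ∃ x ∈ T.1, x ∈ V s) → T ∈ O := by
  obtain ⟨c, rfl⟩ := ofTuple_surjective S
  have h1 : IsOpen (ofTuple ⁻¹' O) := hO.preimage continuous_ofTuple
  obtain ⟨O', hO', hO'eq⟩ := isOpen_induced_iff.1 h1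
  have hc : c.1 ∈ O' := by
    have : c ∈ Subtype.val ⁻¹' O' := by rw [hO'eq]; exact hS
    exact this
  obtain ⟨I, W, hW, hWO⟩ := isOpen_pi_iff.1 hO' c.1 hc
  let Q : Fin p → Set X := fun i => if i ∈ I then W i else Set.univ
  have hQ : ∀ i, IsOpen (Q i) ∧ c.1 i ∈ Q i := fun i => by
    by_cases h : i ∈ I
    · simpa [Q, h] using hW i h
    · simp [Q, h]
  have hmem : ∀ s : (ofTuple c).1, ∃ i, c.1 i = s := fun s => mem_ofTuple.1 s.2
  choose j hj using hmem
  have hji : ∀ i (h : c.1 i ∈ (ofTuple c).1), j ⟨c.1 i, h⟩ = i := fun i h => c.2 (hj ⟨c.1 i, h⟩)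
  obtain ⟨V, hV, hVm, hVQ, hVd⟩ := exists_disjoint_opens (ofTuple c).1 (O := fun s => Q (j s))
    (fun s => (hQ _).1) (fun s => by have := (hQ (j s)).2; rwa [hj] at this)
  -- As `T` has only `p` points and the sets `V s` are disjoint, one point chosen in each of them
  -- exhausts `T` and orders it like `c`.
  refine ⟨V, hV, hVm, fun T hT => ?_⟩
  have hci : ∀ i, c.1 i ∈ (ofTuple c).1 := fun i => mem_ofTuple.2 ⟨i, rfl⟩
  choose y hy hyV using fun i => hT ⟨c.1 i, hci i⟩
  have hyinj : Function.Injective y := by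
    intro a b hab
    by_contra hne
    refine Set.disjoint_left.1 (hVd (i := ⟨c.1 a, hci a⟩) (j := ⟨c.1 b, hci b⟩)
      fun h => hne (c.2 (congrArg Subtype.val h))) (hyV a) (hab ▸ hyV b)
  have hTy : T = ofTuple ⟨y, hyinj⟩ := by
    apply Subtype.ext
    refine (Finset.eq_of_subset_of_card_le ?_ ?_).symm
    · intro x hx
      obtain ⟨i, rfl⟩ := mem_ofTuple.1 hx
      exact hy i
    · rw [T.2, (ofTuple ⟨y, hyinj⟩).2]
  rw [hTy]
  have : (⟨y, hyinj⟩ : {c : Fin p → X // Function.Injective c}) ∈ Subtype.val ⁻¹' O' := by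
    refine hWO fun i hi => ?_
    have := hVQ _ (hyV i)
    rw [hji] at this
    simpa [Q, Finset.mem_coe.1 hi] using this
  rw [hO'eq] at this
  exact this

/-- In contrast with the Vietoris topology on events of all sizes, only hit sets have to be tested:
with the number of points fixed, a configuration that has a point near each point of another one has
no room for further points. -/
theorem continuous_of [T2Space X] {A : Type*} [TopologicalSpace A] {f : A → Config X p}
    (h : ∀ V : Set X, IsOpen V → IsOpen {a | ∃ x ∈ (f a).1, x ∈ V}) : Continuous f := by
  refine continuous_def.2 fun O hO => isOpen_iff_mem_nhds.2 fun a ha => ?_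
  obtain ⟨V, hV, hm, hVO⟩ := exists_hits_subset hO (S := f a) ha
  have hopen : IsOpen (⋂ s : (f a).1, {b | ∃ x ∈ (f b).1, x ∈ V s}) :=
    isOpen_iInter_of_finite fun s => h _ (hV s)
  exact Filter.mem_of_superset (hopen.mem_nhds (Set.mem_iInter.2 fun s => ⟨s, s.2, hm s⟩))
    fun b hb => hVO _ (Set.mem_iInter.1 hb)

end Config

/-! ### The quotient topology and the filtration of the classifying space -/

namespace ClassifyingSpace

open Topology

/-- Continuity on a locally closed subset may be checked on simplices. -/
theorem continuous_of_isLocallyClosed {Λ : Type*} [Preorder Λ] [TopologicalSpace Λ] {T : Type*}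
    [TopologicalSpace T] {s : Set (ClassifyingSpace Λ)} (hs : IsLocallyClosed s) (g : s → T)
    (hg : ∀ n, Continuous fun x : {x : NerveSpace Λ n × stdSimplex ℝ (Fin (n + 1)) //
      mk x.1 x.2 ∈ s} => g ⟨mk x.1.1 x.1.2, x.2⟩) : Continuous g := by
  obtain ⟨O, C, hO, hC, rfl⟩ := hs
  refine continuous_def.2 fun G hG => ?_
  -- Over a locally closed set a quotient map remains a quotient map. The image of `g ⁻¹' G` need
  -- not be open, but it becomes so after adding the points of the open set `O` outside the closed
  -- set `C`, and this does not change its trace on `O ∩ C`.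
  have hopen : IsOpen (Subtype.val '' (g ⁻¹' G) ∪ (O \ C)) := by
    rw [isOpen_iff_mk]
    intro n
    obtain ⟨G', hG', hG'eq⟩ := isOpen_induced_iff.1 (hG.preimage (hg n))
    have hmk : Continuous fun x : NerveSpace Λ n × stdSimplex ℝ (Fin (n + 1)) => mk x.1 x.2 :=
      continuous_mk
    convert (hO.preimage hmk).inter (hG'.union (hC.isOpen_compl.preimage hmk)) using 1
    ext x
    have hx : ∀ h : mk x.1 x.2 ∈ O ∩ C, x ∈ G' ↔ g ⟨mk x.1 x.2, h⟩ ∈ G := fun h => by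
      have := Set.ext_iff.1 hG'eq ⟨x, h⟩
      exact this
    rw [Set.mem_ofPred_eq]
    simp only [Set.mem_union, Set.mem_image, Set.mem_preimage, Subtype.exists, exists_and_right,
      exists_eq_right, Set.mem_sdiff, Set.mem_inter_iff, Set.mem_compl_iff]
    constructor
    · rintro (⟨h, h2⟩ | ⟨h1, h2⟩)
      · exact ⟨h.1, Or.inl ((hx h).2 h2)⟩
      · exact ⟨h1, Or.inr h2⟩
    · rintro ⟨h1, h2⟩
      by_cases h3 : mk x.1 x.2 ∈ C
      · exact Or.inl ⟨⟨h1, h3⟩, (hx ⟨h1, h3⟩).1 (h2.resolve_right (fun h => h h3))⟩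
      · exact Or.inr ⟨h1, h3⟩
  convert hopen.preimage (continuous_subtype_val (p := fun z => z ∈ O ∩ C)) using 1
  ext z
  simp only [Set.mem_preimage, Set.mem_union, Set.mem_image, Subtype.exists, Set.mem_sdiff,
    exists_and_right, exists_eq_right]
  constructor
  · exact fun h => Or.inl ⟨z.2, h⟩
  · rintro (⟨_, h⟩ | ⟨_, h⟩)
    · exact h
    · exact absurd z.2.2 h

variable {Y : Type u} {X : Type v} {bad : Y → Finset X → Prop}

/-- Events increase along a chain, so the union that defines the top event is the last member of
nonzero weight. -/
theorem exists_mem_topEvent_eq {n : ℕ} (c : NerveSpace (BadPoset bad) n)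
    (t : stdSimplex ℝ (Fin (n + 1))) :
    ∃ J, t J ≠ 0 ∧ (∀ j, t j ≠ 0 → j ≤ J) ∧ topEvent (mk c t) = (c.1 J).1.2 := by
  classical
  let s : Finset (Fin (n + 1)) := Finset.univ.filter fun j => t j ≠ 0
  have hs : s.Nonempty := by
    by_contra hcon
    rw [Finset.not_nonempty_iff_eq_empty, Finset.filter_eq_empty_iff] at hcon
    have h1 : ∑ j, t j = 1 := t.2.2
    rw [Finset.sum_eq_zero fun j _ => by simpa using hcon (Finset.mem_univ j)] at h1
    exact zero_ne_one h1
  have hJ : t (s.max' hs) ≠ 0 := by simpa [s] using s.max'_mem hs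
  have hm : ∀ j, t j ≠ 0 → j ≤ s.max' hs := fun j hj => s.le_max' j (by simpa [s] using hj)
  refine ⟨s.max' hs, hJ, hm, ?_⟩
  ext x
  rw [mem_topEvent_mk]
  exact ⟨fun ⟨j, h1, h2⟩ => (c.2 (hm j h1)).2 h2, fun h => ⟨_, hJ, h⟩⟩

theorem subset_topEvent_mk {n : ℕ} (c : NerveSpace (BadPoset bad) n)
    (t : stdSimplex ℝ (Fin (n + 1))) {j : Fin (n + 1)} (hj : t j ≠ 0) :
    (c.1 j).1.2 ⊆ topEvent (mk c t) :=
  fun _ hx => (mem_topEvent_mk c t _).2 ⟨j, hj, hx⟩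

variable [TopologicalSpace Y] [TopologicalSpace X]

theorem continuous_coord {n : ℕ} (j : Fin (n + 1)) : Continuous
    fun x : NerveSpace (BadPoset bad) n × stdSimplex ℝ (Fin (n + 1)) => x.2 j :=
  (continuous_apply j).comp (continuous_subtype_val.comp continuous_snd)

theorem continuous_vertex {Λ : Type*} [Preorder Λ] [TopologicalSpace Λ] {n : ℕ}
    (j : Fin (n + 1)) : Continuous
    fun x : NerveSpace Λ n × stdSimplex ℝ (Fin (n + 1)) => x.1.1 j :=
  (continuous_apply j).comp (continuous_subtype_val.comp continuous_fst)

/-- A point is outside the stage when some vertex has nonzero weight and more than `p` points. Both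
are open conditions, the second by lower semicontinuity of the cardinality. -/
theorem isClosed_filtrationStage [T2Space X] (p : ℕ) : IsClosed (filtrationStage bad p) := by
  rw [← isOpen_compl_iff, isOpen_iff_mk]
  intro n
  have : {x : NerveSpace (BadPoset bad) n × stdSimplex ℝ (Fin (n + 1)) |
      mk x.1 x.2 ∈ (filtrationStage bad p)ᶜ} =
      ⋃ j, {x | x.2 j ≠ 0 ∧ p + 1 ≤ (x.1.1 j).1.2.card} := by
    ext x
    change ¬ ((topEvent (mk x.1 x.2)).card ≤ p) ↔ _
    simp only [Set.mem_iUnion, Set.mem_ofPred_eq, not_le]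
    constructor
    · intro h
      obtain ⟨J, hJ, -, hJ'⟩ := exists_mem_topEvent_eq x.1 x.2
      exact ⟨J, hJ, hJ' ▸ h⟩
    · rintro ⟨j, h1, h2⟩
      exact lt_of_lt_of_le (Nat.lt_of_succ_le h2)
        (Finset.card_le_card (subset_topEvent_mk x.1 x.2 h1))
  rw [this]
  refine isOpen_iUnion fun j => IsOpen.inter ?_ ?_
  · exact isOpen_ne.preimage (continuous_coord j)
  · exact (BadPoset.isOpen_le_card (p + 1)).preimage (continuous_vertex j)

theorem isLocallyClosed_filtrationDiff [T2Space X] (p : ℕ) :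
    IsLocallyClosed (filtrationStage bad p \ filtrationStage bad (p - 1)) :=
  (isClosed_filtrationStage p).isLocallyClosed.inter
    (isClosed_filtrationStage (p - 1)).isOpen_compl.isLocallyClosed

theorem continuous_toConfig [T2Space X] (p : ℕ) :
    Continuous (FiltrationDiff.toConfig bad p) := by
  refine continuous_of_isLocallyClosed (isLocallyClosed_filtrationDiff p) _ fun n => ?_
  refine Config.continuous_of fun V hV => ?_
  let Q := {x : NerveSpace (BadPoset bad) n × stdSimplex ℝ (Fin (n + 1)) //
      mk x.1 x.2 ∈ filtrationStage bad p \ filtrationStage bad (p - 1)}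
  have : {a : Q | ∃ x ∈ topEvent (mk a.1.1 a.1.2), x ∈ V} =
      ⋃ j, {a : Q | a.1.2 j ≠ 0 ∧ ∃ x ∈ (a.1.1.1 j).1.2, x ∈ V} := by
    ext a
    simp only [Set.mem_ofPred_eq, mem_topEvent_mk, Set.mem_iUnion]
    constructor
    · rintro ⟨x, ⟨j, h1, h2⟩, h3⟩
      exact ⟨j, h1, x, h2, h3⟩
    · rintro ⟨j, h1, x, h2, h3⟩
      exact ⟨x, ⟨j, h1, h2⟩, h3⟩
  change IsOpen {a : Q | ∃ x ∈ topEvent (mk a.1.1 a.1.2), x ∈ V}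
  rw [this]
  refine isOpen_iUnion fun j => IsOpen.inter ?_ ?_
  · exact isOpen_ne.preimage ((continuous_coord j).comp continuous_subtype_val)
  · exact (BadPoset.isOpen_hit hV).preimage ((continuous_vertex j).comp continuous_subtype_val)

end ClassifyingSpace

/-! ## Open cones on classifying spaces -/

namespace FiberwiseOpenCone

open Topology

section General

variable {K : Type u} {Y : Type v} {q : K → Y}

/-- The cone point over `y`. -/
def vertex (q : K → Y) (y : Y) : FiberwiseOpenCone q := Quot.mk _ (Sum.inl y)

/-- The point of the cone at distance `s` from the vertex. -/
def mk (q : K → Y) (z : K) (s : Set.Ico (0 : ℝ) 1) : FiberwiseOpenCone q :=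
  Quot.mk _ (Sum.inr (z, s))

theorem mk_zero (z : K) (s : Set.Ico (0 : ℝ) 1) (hs : (s : ℝ) = 0) :
    mk q z s = vertex q (q z) := by
  obtain rfl : s = ⟨0, by simp⟩ := Subtype.ext hs
  exact Quot.sound (OpenConeRel.glue z)

theorem cases (x : FiberwiseOpenCone q) : (∃ y, x = vertex q y) ∨ ∃ z s, x = mk q z s := by
  obtain ⟨y | ⟨z, s⟩, rfl⟩ := Quot.exists_rep x
  · exact Or.inl ⟨y, rfl⟩
  · exact Or.inr ⟨z, s, rfl⟩

variable [TopologicalSpace K] [TopologicalSpace Y]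

theorem isQuotientMap_elim :
    IsQuotientMap (Sum.elim (vertex q) fun z : K × Set.Ico (0 : ℝ) 1 => mk q z.1 z.2) := by
  have : (Sum.elim (vertex q) fun z : K × Set.Ico (0 : ℝ) 1 => mk q z.1 z.2) =
      (Quot.mk (OpenConeRel q) : _ → FiberwiseOpenCone q) := by
    funext z
    rcases z with y | z <;> rfl
  rw [this]
  exact isQuotientMap_quot_mk (r := OpenConeRel q)

theorem continuous_vertex : Continuous (vertex q) :=
  isQuotientMap_elim.continuous.comp continuous_inl

theorem continuous_mk : Continuous fun z : K × Set.Ico (0 : ℝ) 1 => mk q z.1 z.2 :=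
  isQuotientMap_elim.continuous.comp continuous_inr

end General

section BadPoset

variable {Y : Type u} {X : Type v} {bad : Y → Finset X → Prop}

/-- The projection from the fiberwise cone to the base. -/
def base : FiberwiseOpenCone (ClassifyingSpace.base (bad := bad)) → Y :=
  Quot.lift (Sum.elim id fun z => ClassifyingSpace.base z.1) (by rintro _ _ ⟨a⟩; rfl)

/-- The barycentric coordinates of a point of the cone. -/
noncomputable def weight :
    FiberwiseOpenCone (ClassifyingSpace.base (bad := bad)) → Finset X → ℝ :=
  Quot.lift (Sum.elim (fun _ _ => 0) fun z S => z.2 * ClassifyingSpace.weight z.1 S) (by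
    rintro _ _ ⟨a⟩
    funext S
    simp)

theorem base_vertex (y : Y) : base (vertex (ClassifyingSpace.base (bad := bad)) y) = y := rfl

theorem weight_vertex (y : Y) (S : Finset X) :
    weight (vertex (ClassifyingSpace.base (bad := bad)) y) S = 0 := rfl

theorem weight_mk (z : ClassifyingSpace (BadPoset bad)) (s : Set.Ico (0 : ℝ) 1) (S : Finset X) :
    weight (mk ClassifyingSpace.base z s) S = s * ClassifyingSpace.weight z S := rfl

theorem weight_nonneg (x : FiberwiseOpenCone (ClassifyingSpace.base (bad := bad)))
    (S : Finset X) : 0 ≤ weight x S := by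
  rcases cases x with ⟨y, rfl⟩ | ⟨z, s, rfl⟩
  · rw [weight_vertex]
  · exact mul_nonneg s.2.1 (ClassifyingSpace.weight_nonneg z S)

theorem bad_base_of_weight_ne_zero
    {x : FiberwiseOpenCone (ClassifyingSpace.base (bad := bad))} {S : Finset X}
    (h : weight x S ≠ 0) : bad (base x) S := by
  rcases cases x with ⟨y, rfl⟩ | ⟨z, s, rfl⟩
  · exact absurd (weight_vertex y S) h
  · exact ClassifyingSpace.bad_base_of_weight_ne_zero (right_ne_zero_of_mul h)

theorem subset_or_subset_of_weight_ne_zero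
    {x : FiberwiseOpenCone (ClassifyingSpace.base (bad := bad))} {S T : Finset X}
    (hS : weight x S ≠ 0) (hT : weight x T ≠ 0) : S ⊆ T ∨ T ⊆ S := by
  rcases cases x with ⟨y, rfl⟩ | ⟨z, s, rfl⟩
  · exact absurd (weight_vertex y S) hS
  · exact ClassifyingSpace.subset_or_subset_of_weight_ne_zero (right_ne_zero_of_mul hS)
      (right_ne_zero_of_mul hT)

variable [Fintype X]

theorem _root_.ClassifyingSpace.sum_weight (z : ClassifyingSpace (BadPoset bad)) :
    ∑ S, ClassifyingSpace.weight z S = 1 := by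
  classical
  obtain ⟨m, c, t, rfl⟩ := ClassifyingSpace.exists_mk z
  simp only [ClassifyingSpace.weight_mk]
  rw [Finset.sum_comm]
  refine (Finset.sum_congr rfl fun j _ => ?_).trans t.2.2
  exact (Finset.sum_eq_single (c.1 j).1.2 (fun S _ hS => if_neg hS.symm)
    fun h => absurd (Finset.mem_univ _) h).trans (if_pos rfl)

theorem sum_weight_mk (z : ClassifyingSpace (BadPoset bad))
    (s : Set.Ico (0 : ℝ) 1) : ∑ S, weight (mk ClassifyingSpace.base z s) S = s := by
  simp only [weight_mk]
  rw [← Finset.mul_sum, ClassifyingSpace.sum_weight, mul_one]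

theorem sum_weight_lt_one
    (x : FiberwiseOpenCone (ClassifyingSpace.base (bad := bad))) : ∑ S, weight x S < 1 := by
  rcases cases x with ⟨y, rfl⟩ | ⟨z, s, rfl⟩
  · simp [weight_vertex]
  · rw [sum_weight_mk]
    exact s.2.2

/-- The total weight is the distance from the vertex of the cone. If it is zero, both points are
vertices; otherwise dividing by it reduces the claim to the classifying space. -/
theorem ext_base_weight {x x' : FiberwiseOpenCone (ClassifyingSpace.base (bad := bad))}
    (hb : base x = base x') (hw : weight x = weight x') : x = x' := by
  classical
  have hs : ∑ S, weight x S = ∑ S, weight x' S := by rw [hw]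
  rcases cases x with ⟨y, rfl⟩ | ⟨z, s, rfl⟩ <;> rcases cases x' with ⟨y', rfl⟩ | ⟨z', s', rfl⟩
  · exact congrArg _ hb
  · rw [sum_weight_mk] at hs
    simp only [weight_vertex, Finset.sum_const_zero] at hs
    rw [mk_zero _ _ hs.symm]
    exact congrArg _ hb
  · rw [sum_weight_mk] at hs
    simp only [weight_vertex, Finset.sum_const_zero] at hs
    rw [mk_zero _ _ hs]
    exact congrArg _ hb
  · rw [sum_weight_mk, sum_weight_mk] at hs
    obtain rfl : s = s' := Subtype.ext hs
    by_cases h0 : (s : ℝ) = 0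
    · rw [mk_zero _ _ h0, mk_zero _ _ h0]
      exact congrArg _ hb
    · congr 1
      refine ClassifyingSpace.ext_base_weight hb (funext fun S => ?_)
      have := congrFun hw S
      rw [weight_mk, weight_mk] at this
      exact mul_left_cancel₀ h0 this

end BadPoset

end FiberwiseOpenCone

/-- The simplex with its face opposite to a further vertex removed, in affine coordinates. -/
def openFaceSimplex (n : ℕ) : Set (Fin (n + 1) → ℝ) := {a | (∀ j, 0 ≤ a j) ∧ ∑ j, a j < 1}

namespace FiberwiseOpenCone

open Topology

variable {Y : Type u} {X : Type v} {bad : Y → Finset X → Prop}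

/-- The point of the cone with given affine coordinates in the cone on a simplex. -/
noncomputable def ofCoords {n : ℕ} (c : NerveSpace (BadPoset bad) n) (a : openFaceSimplex n) :
    FiberwiseOpenCone (ClassifyingSpace.base (bad := bad)) :=
  if h : ∑ j, a.1 j = 0 then vertex _ (c.1 0).1.1 else
    mk _ (ClassifyingSpace.mk c ⟨fun j => a.1 j / ∑ j, a.1 j,
      fun j => div_nonneg (a.2.1 j) (Finset.sum_nonneg fun j _ => a.2.1 j), by
        rw [← Finset.sum_div, div_self h]⟩)
      ⟨∑ j, a.1 j, Finset.sum_nonneg fun j _ => a.2.1 j, a.2.2⟩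

/-- Affine coordinates agree with polar ones, also for `s = 0`, where all `t` give the same point.
-/
theorem ofCoords_smul {n : ℕ} (c : NerveSpace (BadPoset bad) n) (a : openFaceSimplex n)
    (t : stdSimplex ℝ (Fin (n + 1))) (s : Set.Ico (0 : ℝ) 1) (h : ∀ j, a.1 j = s * t j) :
    ofCoords c a = mk _ (ClassifyingSpace.mk c t) s := by
  have h1 : ∑ j, a.1 j = s := by
    simp only [h]
    rw [← Finset.mul_sum, show ∑ j, t j = 1 from t.2.2, mul_one]
  unfold ofCoords
  split_ifs with h0
  · rw [mk_zero _ _ (h1.symm.trans h0)]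
    rfl
  · congr 2
    · ext j
      change a.1 j / _ = _
      rw [h1] at h0 ⊢
      rw [h, mul_div_cancel_left₀ _ h0]

theorem exists_ofCoords {n : ℕ} (c : NerveSpace (BadPoset bad) n)
    (t : stdSimplex ℝ (Fin (n + 1))) (s : Set.Ico (0 : ℝ) 1) :
    ∃ a : openFaceSimplex n, (∀ j, a.1 j = s * t j) ∧
      mk _ (ClassifyingSpace.mk c t) s = ofCoords c a := by
  let a : openFaceSimplex n := ⟨fun j => s * t j, fun j => mul_nonneg s.2.1 (t.2.1 j), by
    rw [← Finset.mul_sum, show ∑ j, t j = 1 from t.2.2, mul_one]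
    exact s.2.2⟩
  exact ⟨a, fun j => rfl, (ofCoords_smul c a t s fun j => rfl).symm⟩

theorem base_ofCoords {n : ℕ} (c : NerveSpace (BadPoset bad) n) (a : openFaceSimplex n) :
    base (ofCoords c a) = (c.1 0).1.1 := by
  unfold ofCoords
  split_ifs <;> rfl

open scoped Classical in
theorem weight_ofCoords {n : ℕ} (c : NerveSpace (BadPoset bad) n) (a : openFaceSimplex n)
    (S : Finset X) : weight (ofCoords c a) S = ∑ j, if (c.1 j).1.2 = S then a.1 j else 0 := by
  unfold ofCoords
  split_ifs with h0
  · rw [Finset.sum_eq_zero_iff_of_nonneg fun j _ => a.2.1 j] at h0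
    rw [weight_vertex]
    refine (Finset.sum_eq_zero fun j hj => ?_).symm
    rw [h0 j hj, ite_self]
  · rw [weight_mk, ClassifyingSpace.weight_mk, Finset.mul_sum]
    refine Finset.sum_congr rfl fun j _ => ?_
    split_ifs
    · exact mul_div_cancel₀ _ h0
    · rw [mul_zero]

variable [TopologicalSpace Y] [TopologicalSpace X]

/-- The difficulty is at the vertex, where the normalized coordinates have no limit. Polar
coordinates `(t, s) ↦ s t` on the compact space `Δ^n × [0, 1]` are a proper map. Properness survives
restriction to a preimage and the product with the identity of the nerve space, so the affine
coordinates carry the quotient topology even in families. -/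
theorem continuous_ofCoords {n : ℕ} : Continuous
    fun x : NerveSpace (BadPoset bad) n × openFaceSimplex n => ofCoords x.1 x.2 := by
  let ψ : stdSimplex ℝ (Fin (n + 1)) × Set.Icc (0 : ℝ) 1 → Fin (n + 1) → ℝ :=
    fun x j => x.2 * x.1 j
  have hψ : Continuous ψ := by
    refine continuous_pi fun j => ?_
    exact (continuous_subtype_val.comp continuous_snd).mul
      ((continuous_apply j).comp (continuous_subtype_val.comp continuous_fst))
  have hsum : ∀ x, ∑ j, ψ x j = x.2 := fun x => by
    rw [← Finset.mul_sum, show ∑ j, x.1 j = 1 from x.1.2.2, mul_one]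
  have hprop : IsProperMap ((openFaceSimplex n).restrictPreimage ψ) :=
    hψ.isProperMap.restrictPreimage _
  have hsurj : Function.Surjective ((openFaceSimplex n).restrictPreimage ψ) := by
    rintro ⟨a, ha⟩
    by_cases h : ∑ j, a j = 0
    · have h0 := (Finset.sum_eq_zero_iff_of_nonneg fun j _ => ha.1 j).1 h
      have hz : ψ (stdSimplex.vertex 0, ⟨0, by simp⟩) = a := by
        funext j
        simp [ψ, h0 j (Finset.mem_univ j)]
      exact ⟨⟨_, by rw [Set.mem_preimage, hz]; exact ha⟩, Subtype.ext hz⟩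
    · have hz : ψ (⟨fun j => a j / ∑ j, a j,
          fun j => div_nonneg (ha.1 j) (Finset.sum_nonneg fun j _ => ha.1 j), by
          rw [← Finset.sum_div, div_self h]⟩,
          ⟨∑ j, a j, Finset.sum_nonneg fun j _ => ha.1 j, ha.2.le⟩) = a := by
        funext j
        exact mul_div_cancel₀ _ h
      exact ⟨⟨_, by rw [Set.mem_preimage, hz]; exact ha⟩, Subtype.ext hz⟩
  have hq : IsQuotientMap (Prod.map (id : NerveSpace (BadPoset bad) n → _)
      ((openFaceSimplex n).restrictPreimage ψ)) :=
    (isProperMap_id.prodMap hprop).isClosedMap.isQuotientMap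
      (continuous_id.prodMap hprop.continuous) (Function.surjective_id.prodMap hsurj)
  rw [hq.continuous_iff]
  have hlt : ∀ y : ψ ⁻¹' openFaceSimplex n, (y.1.2 : ℝ) ∈ Set.Ico (0 : ℝ) 1 := fun y =>
    ⟨y.1.2.2.1, by rw [← hsum y.1]; exact y.2.2⟩
  have hform : ((fun x : NerveSpace (BadPoset bad) n × openFaceSimplex n => ofCoords x.1 x.2) ∘
      Prod.map (id : NerveSpace (BadPoset bad) n → _) ((openFaceSimplex n).restrictPreimage ψ)) =
      fun x => mk _ (ClassifyingSpace.mk x.1 x.2.1.1) ⟨x.2.1.2, hlt x.2⟩ := by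
    funext x
    exact ofCoords_smul _ _ _ _ fun j => rfl
  rw [hform]
  refine continuous_mk.comp (Continuous.prodMk (ClassifyingSpace.continuous_mk.comp
    (continuous_fst.prodMk ?_)) (Continuous.subtype_mk ?_ _))
  · exact continuous_fst.comp (continuous_subtype_val.comp continuous_snd)
  · exact continuous_subtype_val.comp
      (continuous_snd.comp (continuous_subtype_val.comp continuous_snd))

/-- Continuity on the product of a locally compact space with a cone. -/
theorem continuous_prod_of {P T : Type*} [TopologicalSpace P] [LocallyCompactSpace P]
    [TopologicalSpace T] {g : P × FiberwiseOpenCone (ClassifyingSpace.base (bad := bad)) → T}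
    (h1 : Continuous fun x : P × Y => g (x.1, vertex _ x.2))
    (h2 : ∀ n, Continuous fun x : P × (NerveSpace (BadPoset bad) n × openFaceSimplex n) =>
      g (x.1, ofCoords x.2.1 x.2.2)) : Continuous g := by
  -- A quotient map times a locally compact space is a quotient map. This is used twice: here for
  -- the mapping cylinder with the factor `P`, and below for the classifying space with the factor
  -- `P × [0, 1)`.
  apply isQuotientMap_elim.continuous_lift_prod_right
  rw [← (Homeomorph.prodSumDistrib (X := P)).symm.comp_continuous_iff']
  refine continuous_sum_dom.2 ⟨h1, ?_⟩
  change Continuous fun x : P × (ClassifyingSpace (BadPoset bad) × Set.Ico (0 : ℝ) 1) =>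
    g (x.1, mk _ x.2.1 x.2.2)
  have key : Continuous fun x : (P × Set.Ico (0 : ℝ) 1) × ClassifyingSpace (BadPoset bad) =>
      g (x.1.1, mk _ x.2 x.1.2) := by
    have : LocallyCompactSpace (Set.Ico (0 : ℝ) 1) :=
      (isLocallyClosed_Ico).locallyCompactSpace
    apply ClassifyingSpace.isQuotientMap_ofSimplex.continuous_lift_prod_right
    rw [← (Homeomorph.prodComm _ _).comp_continuous_iff',
      ← (Homeomorph.sigmaProdDistrib).symm.comp_continuous_iff']
    refine continuous_sigma fun n => ?_
    have hlt : ∀ x : (NerveSpace (BadPoset bad) n × stdSimplex ℝ (Fin (n + 1))) ×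
        (P × Set.Ico (0 : ℝ) 1), (fun j => (x.2.2 : ℝ) * x.1.2 j) ∈ openFaceSimplex n := fun x =>
      ⟨fun j => mul_nonneg x.2.2.2.1 (x.1.2.2.1 j), by
        rw [← Finset.mul_sum, show ∑ j, x.1.2 j = 1 from x.1.2.2.2, mul_one]
        exact x.2.2.2.2⟩
    have hc : Continuous fun x : (NerveSpace (BadPoset bad) n × stdSimplex ℝ (Fin (n + 1))) ×
        (P × Set.Ico (0 : ℝ) 1) => g (x.2.1, ofCoords x.1.1 ⟨_, hlt x⟩) := by
      refine (h2 n).comp (Continuous.prodMk (by fun_prop) (Continuous.prodMk (by fun_prop)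
        (Continuous.subtype_mk (continuous_pi fun j => ?_) _)))
      exact (continuous_subtype_val.comp (continuous_snd.comp continuous_snd)).mul
        ((ClassifyingSpace.continuous_coord j).comp continuous_fst)
    refine hc.congr fun x => ?_
    rw [ofCoords_smul x.1.1 _ x.1.2 x.2.2 fun j => rfl]
    rfl
  exact key.comp (((continuous_fst.prodMk (continuous_snd.comp continuous_snd))).prodMk
    (continuous_fst.comp continuous_snd))

end FiberwiseOpenCone

/-! ## Local triviality from a local model of the events -/

section PushWeight

variable {Y : Type u} {ι : Type v} [Fintype ι] {bad : Y → Finset ι → Prop} {X : Type w}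

open scoped Classical in
/-- The barycentric coordinates that a point of the cone on proper subsets of `ι` gets when the
subsets of `ι` are regarded as sets in `X` and the vertex of the cone as the image of `ι`. -/
noncomputable def pushWeight (e : ι ↪ X)
    (x : FiberwiseOpenCone (ClassifyingSpace.base (bad := bad))) (S : Finset X) : ℝ :=
  (∑ R : Finset ι, if R.map e = S then x.weight R else 0) +
    if Finset.univ.map e = S then 1 - ∑ R, x.weight R else 0

open scoped Classical in
theorem pushWeight_vertex (e : ι ↪ X) (y : Y) (S : Finset X) :
    pushWeight e (FiberwiseOpenCone.vertex (ClassifyingSpace.base (bad := bad)) y) S =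
      if Finset.univ.map e = S then 1 else 0 := by
  simp [pushWeight, FiberwiseOpenCone.weight_vertex]

theorem sum_weight_ofCoords {n : ℕ} (c : NerveSpace (BadPoset bad) n) (a : openFaceSimplex n) :
    ∑ R, (FiberwiseOpenCone.ofCoords c a).weight R = ∑ j, a.1 j := by
  classical
  simp only [FiberwiseOpenCone.weight_ofCoords]
  rw [Finset.sum_comm]
  refine Finset.sum_congr rfl fun j _ => ?_
  exact (Finset.sum_eq_single (c.1 j).1.2 (fun S _ hS => if_neg hS.symm)
    fun h => absurd (Finset.mem_univ _) h).trans (if_pos rfl)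

open scoped Classical in
-- In this form the weights are those of a simplex with one further vertex, the image of `ι`, which
-- receives the missing weight; `EventModel.chain` spans this simplex.
theorem pushWeight_ofCoords (e : ι ↪ X) {n : ℕ} (c : NerveSpace (BadPoset bad) n)
    (a : openFaceSimplex n) (S : Finset X) :
    pushWeight e (FiberwiseOpenCone.ofCoords c a) S =
      (∑ j, if (c.1 j).1.2.map e = S then a.1 j else 0) +
        if Finset.univ.map e = S then 1 - ∑ j, a.1 j else 0 := by
  unfold pushWeight
  rw [sum_weight_ofCoords]
  congr 1
  have : ∀ R : Finset ι, (if R.map e = S then (FiberwiseOpenCone.ofCoords c a).weight R else 0) =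
      ∑ j, if (c.1 j).1.2 = R then (if (c.1 j).1.2.map e = S then a.1 j else 0) else 0 := by
    intro R
    rw [FiberwiseOpenCone.weight_ofCoords]
    split_ifs with h
    · refine Finset.sum_congr rfl fun j _ => ?_
      by_cases hj : (c.1 j).1.2 = R
      · rw [if_pos hj, if_pos hj, hj, if_pos h]
      · rw [if_neg hj, if_neg hj]
    · refine (Finset.sum_eq_zero fun j _ => ?_).symm
      by_cases hj : (c.1 j).1.2 = R
      · rw [if_pos hj, hj, if_neg h]
      · rw [if_neg hj]
  rw [Finset.sum_congr rfl fun R _ => this R, Finset.sum_comm]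
  refine Finset.sum_congr rfl fun j _ => ?_
  exact (Finset.sum_eq_single (c.1 j).1.2 (fun S _ hS => if_neg hS.symm)
    fun h => absurd (Finset.mem_univ _) h).trans (if_pos rfl)

variable (hbad : ∀ y R, bad y R → R ≠ Finset.univ)
include hbad

theorem weight_univ_eq_zero (x : FiberwiseOpenCone (ClassifyingSpace.base (bad := bad))) :
    x.weight Finset.univ = 0 := by
  by_contra h
  exact hbad _ _ (FiberwiseOpenCone.bad_base_of_weight_ne_zero h) rfl

omit hbad in
theorem pushWeight_map (e : ι ↪ X)
    (x : FiberwiseOpenCone (ClassifyingSpace.base (bad := bad))) {R : Finset ι}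
    (hR : R ≠ Finset.univ) : pushWeight e x (R.map e) = x.weight R := by
  classical
  unfold pushWeight
  simp only [Finset.map_inj]
  rw [if_neg hR.symm, add_zero, Finset.sum_ite_eq', if_pos (Finset.mem_univ _)]

/-- The whole set is not an event of the cone, so its weight is just the complement to one of a
total that is less than one. This positivity forces the top event to be the entire configuration. -/
theorem pushWeight_map_univ (e : ι ↪ X)
    (x : FiberwiseOpenCone (ClassifyingSpace.base (bad := bad))) :
    0 < pushWeight e x (Finset.univ.map e) := by
  classical
  unfold pushWeight
  simp only [Finset.map_inj]
  rw [if_pos trivial, Finset.sum_ite_eq', if_pos (Finset.mem_univ _), weight_univ_eq_zero hbad,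
    zero_add, sub_pos]
  exact x.sum_weight_lt_one

omit hbad in
theorem subset_of_pushWeight_ne_zero (e : ι ↪ X)
    (x : FiberwiseOpenCone (ClassifyingSpace.base (bad := bad))) {S : Finset X}
    (h : pushWeight e x S ≠ 0) : S ⊆ Finset.univ.map e := by
  classical
  by_contra hS
  apply h
  unfold pushWeight
  rw [if_neg (fun h' => hS h'.ge), add_zero]
  refine Finset.sum_eq_zero fun R _ => if_neg fun h' => hS ?_
  rw [← h']
  exact Finset.map_subset_map.2 (Finset.subset_univ R)

end PushWeight

/-- The part of the classifying space over a set of configurations of `p` points. -/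
def overConfig {Y : Type u} {X : Type v} (bad : Y → Finset X → Prop) (p : ℕ)
    (U : Set (Config X p)) : Set (ClassifyingSpace (BadPoset bad)) :=
  {z | ∃ hz, FiltrationDiff.toConfig bad p ⟨z, hz⟩ ∈ U}

theorem mem_overConfig {Y : Type u} {X : Type v} {bad : Y → Finset X → Prop} {p : ℕ} (hp : 0 < p)
    {U : Set (Config X p)} {u : U} {z : ClassifyingSpace (BadPoset bad)}
    (h : z.topEvent = u.1.1) : z ∈ overConfig bad p U := by
  have hc : z.topEvent.card = p := h ▸ u.1.2
  have hz : z ∈ filtrationStage bad p \ filtrationStage bad (p - 1) := by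
    refine ⟨hc.le, fun h' => ?_⟩
    have : z.topEvent.card ≤ p - 1 := h'
    omega
  have : FiltrationDiff.toConfig bad p ⟨z, hz⟩ = u.1 := Subtype.ext h
  exact ⟨hz, this ▸ u.2⟩

theorem isLocallyClosed_overConfig {Y : Type u} {X : Type v} {bad : Y → Finset X → Prop} {p : ℕ}
    [TopologicalSpace Y] [TopologicalSpace X] [T2Space X] {U : Set (Config X p)} (hU : IsOpen U) :
    IsLocallyClosed (overConfig bad p U) := by
  obtain ⟨O, hO, hOU⟩ := isOpen_induced_iff.1
    (hU.preimage (ClassifyingSpace.continuous_toConfig (bad := bad) p))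
  have : overConfig bad p U = (filtrationStage bad p \ filtrationStage bad (p - 1)) ∩ O := by
    ext z
    constructor
    · rintro ⟨hz, h⟩
      have : (⟨z, hz⟩ : FiltrationDiff bad p) ∈ Subtype.val ⁻¹' O := by rw [hOU]; exact h
      exact ⟨hz, this⟩
    · rintro ⟨hz, h⟩
      have : (⟨z, hz⟩ : FiltrationDiff bad p) ∈ Subtype.val ⁻¹' O := h
      rw [hOU] at this
      exact ⟨hz, this⟩
  rw [this]
  exact (ClassifyingSpace.isLocallyClosed_filtrationDiff p).inter hO.isLocallyClosed

/-- A description of the events over an open set `U` of configurations of `p` points by a fixed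
space `M × N` and a fixed notion of bad subsets of a `p`-element set `ι` for elements of `N`. -/
structure EventModel {Y : Type u} {X : Type v} [TopologicalSpace Y] [TopologicalSpace X]
    (bad : Y → Finset X → Prop) {p : ℕ} (U : Set (Config X p)) {ι : Type w} [Fintype ι]
    (M N : Type*) [TopologicalSpace M] [TopologicalSpace N] (badN : N → Finset ι → Prop) where
  isOpen : IsOpen U
  point : U → ι ↪ X
  map_point : ∀ u, Finset.univ.map (point u) = u.1.1
  continuous_point : ∀ s, Continuous fun u => point u s
  -- These disjoint sets serve to recognize which points of a configuration belong to an event that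
  -- is close to a given one.
  nhd : ι → Set X
  isOpen_nhd : ∀ s, IsOpen (nhd s)
  disjoint_nhd : Pairwise fun s t => Disjoint (nhd s) (nhd t)
  point_mem : ∀ u s, point u s ∈ nhd s
  coord : U × Y ≃ₜ U × (M × N)
  coord_fst : ∀ z, (coord z).1 = z.1
  bad_iff : ∀ u y R, bad y (R.map (point u)) ↔ badN (coord (u, y)).2.2 R

namespace EventModel

variable {Y : Type u} {X : Type v} [TopologicalSpace Y] [TopologicalSpace X]
  {bad : Y → Finset X → Prop} {p : ℕ} {U : Set (Config X p)} {ι : Type w} [Fintype ι]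
  {M N : Type*} [TopologicalSpace M] [TopologicalSpace N] {badN : N → Finset ι → Prop}
  (E : EventModel bad U M N badN)
  {bad₀ : {h : N // badN h Finset.univ} → Finset ι → Prop}

include E in
theorem card_eq (u : U) : Fintype.card ι = p := by
  rw [← u.1.2, ← E.map_point u, Finset.card_map, Finset.card_univ]

/-- The element of `Y` with given coordinates. -/
def elem (u : U) (q : M × N) : Y := (E.coord.symm (u, q)).2

theorem coord_symm (u : U) (q : M × N) : E.coord.symm (u, q) = (u, E.elem u q) := by
  refine Prod.ext ?_ rfl
  rw [← E.coord_fst, Homeomorph.apply_symm_apply]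

theorem coord_elem (u : U) (q : M × N) : E.coord (u, E.elem u q) = (u, q) := by
  rw [← coord_symm, Homeomorph.apply_symm_apply]

theorem elem_coord (u : U) (y : Y) : E.elem u (E.coord (u, y)).2 = y := by
  have h : E.coord (u, y) = (u, (E.coord (u, y)).2) := Prod.ext (E.coord_fst _) rfl
  unfold elem
  rw [← h, Homeomorph.symm_apply_apply]

theorem bad_elem (u : U) (q : M × N) (R : Finset ι) :
    bad (E.elem u q) (R.map (E.point u)) ↔ badN q.2 R := by
  rw [E.bad_iff, coord_elem]

theorem continuous_elem : Continuous fun x : U × (M × N) => E.elem x.1 x.2 :=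
  continuous_snd.comp E.coord.symm.continuous

/-- The point `z` of the classifying space corresponds to the point `t` of the model. -/
def Corresponds (z : ClassifyingSpace (BadPoset bad))
    (t : (U × M) × FiberwiseOpenCone (ClassifyingSpace.base (bad := bad₀))) : Prop :=
  z.base = E.elem t.1.1 (t.1.2, t.2.base.1) ∧ ∀ S, z.weight S = pushWeight (E.point t.1.1) t.2 S

theorem Corresponds.left_unique {E : EventModel bad U M N badN}
    {z z' : ClassifyingSpace (BadPoset bad)}
    {t : (U × M) × FiberwiseOpenCone (ClassifyingSpace.base (bad := bad₀))}
    (h : E.Corresponds z t) (h' : E.Corresponds z' t) : z = z' :=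
  ClassifyingSpace.ext_base_weight (h.1.trans h'.1.symm)
    (funext fun S => (h.2 S).trans (h'.2 S).symm)

section

variable (hbad₀ : ∀ h R, bad₀ h R ↔ R ≠ Finset.univ ∧ badN h.1 R)
include hbad₀

theorem Corresponds.topEvent_eq {E : EventModel bad U M N badN}
    {z : ClassifyingSpace (BadPoset bad)}
    {t : (U × M) × FiberwiseOpenCone (ClassifyingSpace.base (bad := bad₀))}
    (h : E.Corresponds z t) : z.topEvent = t.1.1.1.1 := by
  have hne : ∀ y R, bad₀ y R → R ≠ Finset.univ := fun y R hR => ((hbad₀ y R).1 hR).1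
  rw [← E.map_point]
  ext x
  rw [ClassifyingSpace.mem_topEvent]
  constructor
  · rintro ⟨S, hS, hx⟩
    rw [h.2] at hS
    exact subset_of_pushWeight_ne_zero _ _ hS hx
  · intro hx
    refine ⟨_, ?_, hx⟩
    rw [h.2]
    exact (pushWeight_map_univ hne _ _).ne'

/-- The top event of `z` recovers the configuration `u`, then the base of `z` recovers the
coordinates in `M × N`, and the weights of the proper subsets recover the point of the cone. -/
theorem Corresponds.right_unique {E : EventModel bad U M N badN}
    {z : ClassifyingSpace (BadPoset bad)}
    {t t' : (U × M) × FiberwiseOpenCone (ClassifyingSpace.base (bad := bad₀))}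
    (h : E.Corresponds z t) (h' : E.Corresponds z t') : t = t' := by
  have hne : ∀ y R, bad₀ y R → R ≠ Finset.univ := fun y R hR => ((hbad₀ y R).1 hR).1
  have hu := (h.topEvent_eq hbad₀).symm.trans (h'.topEvent_eq hbad₀)
  obtain ⟨⟨u, m⟩, x⟩ := t
  obtain ⟨⟨u', m'⟩, x'⟩ := t'
  obtain rfl : u = u' := Subtype.ext (Subtype.ext hu)
  have h1 : E.elem u (m, x.base.1) = E.elem u (m', x'.base.1) := h.1.symm.trans h'.1
  have h2 : (m, x.base.1) = (m', x'.base.1) := by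
    have := congrArg (fun y => (E.coord (u, y)).2) h1
    simpa only [coord_elem] using this
  obtain rfl : m = m' := congrArg Prod.fst h2
  refine Prod.ext rfl (FiberwiseOpenCone.ext_base_weight (Subtype.ext (congrArg Prod.snd h2))
    (funext fun R => ?_))
  by_cases hR : R = Finset.univ
  · subst hR
    rw [weight_univ_eq_zero hne, weight_univ_eq_zero hne]
  · rw [← pushWeight_map (E.point u) x hR, ← pushWeight_map (E.point u) x' hR]
    exact (h.2 _).symm.trans (h'.2 _)

end

/-- The vertex of the classifying space given by a point of the model. -/
def topVertex (u : U) (m : M) (h : {h : N // badN h Finset.univ}) : BadPoset bad :=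
  ⟨(E.elem u (m, h.1), u.1.1), by
    rw [← E.map_point u]
    exact (E.bad_elem u (m, h.1) _).2 h.2⟩

/-- The subset of the configuration given by an event of the model. -/
def subVertex (hbad₀ : ∀ h R, bad₀ h R ↔ R ≠ Finset.univ ∧ badN h.1 R) (u : U) (m : M)
    (r : BadPoset bad₀) : BadPoset bad :=
  ⟨(E.elem u (m, r.1.1.1), r.1.2.map (E.point u)),
    (E.bad_elem u (m, r.1.1.1) _).2 ((hbad₀ _ _).1 r.2).2⟩

theorem continuous_topVertex :
    Continuous fun x : (U × M) × {h : N // badN h Finset.univ} =>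
      E.topVertex x.1.1 x.1.2 x.2 := by
  refine BadPoset.continuous_of_map ?_ Finset.univ (fun x s => E.point x.1.1 s)
    (fun s _ => (E.continuous_point s).comp (continuous_fst.comp continuous_fst)) fun x y => ?_
  · exact E.continuous_elem.comp ((continuous_fst.comp continuous_fst).prodMk
      ((continuous_snd.comp continuous_fst).prodMk (continuous_subtype_val.comp continuous_snd)))
  · change y ∈ x.1.1.1.1 ↔ _
    rw [← E.map_point]
    simp

section

variable [TopologicalSpace ι] [DiscreteTopology ι]
  (hbad₀ : ∀ h R, bad₀ h R ↔ R ≠ Finset.univ ∧ badN h.1 R)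

/-- Since `ι` is discrete, membership of `s` in an event of the model is both an open and a closed
condition. Locally the event in `X` is therefore a constant subset of the moving points. -/
theorem continuous_subVertex :
    Continuous fun x : (U × M) × BadPoset bad₀ => E.subVertex hbad₀ x.1.1 x.1.2 x.2 := by
  have hmem : ∀ s, IsOpen {r : BadPoset bad₀ | s ∈ r.1.2} := fun s => by
    simpa using BadPoset.isOpen_hit (bad := bad₀) (isOpen_discrete {s})
  have hnot : ∀ s, IsOpen {r : BadPoset bad₀ | s ∉ r.1.2} := fun s => by
    convert BadPoset.isOpen_subset (bad := bad₀) (isOpen_discrete {s}ᶜ) using 1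
    ext r
    simp only [Set.mem_ofPred_eq, Set.mem_compl_iff, Set.mem_singleton_iff]
    exact ⟨fun h x hx hxs => h (hxs ▸ hx), fun h hs => h s hs rfl⟩
  have hpt : ∀ s, Continuous fun x : (U × M) × BadPoset bad₀ => E.point x.1.1 s := fun s =>
    (E.continuous_point s).comp (continuous_fst.comp continuous_fst)
  refine BadPoset.continuous_of ?_ (fun V hV => ?_) (fun V hV => ?_)
  · exact E.continuous_elem.comp ((continuous_fst.comp continuous_fst).prodMk
      ((continuous_snd.comp continuous_fst).prodMk
        (continuous_subtype_val.comp (BadPoset.continuous_fst.comp continuous_snd))))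
  · convert isOpen_iUnion fun s => ((hmem s).preimage continuous_snd).inter
      (hV.preimage (hpt s)) using 1
    ext x
    simp [subVertex]
  · convert isOpen_iInter_of_finite fun s => ((hnot s).preimage continuous_snd).union
      (hV.preimage (hpt s)) using 1
    ext x
    simp only [subVertex, Finset.mem_map, forall_exists_index, and_imp, forall_apply_eq_imp_iff₂,
      Set.mem_ofPred_eq, Set.mem_iInter, Set.mem_union, Set.mem_preimage]
    exact forall_congr' fun s => by tauto

/-- The simplex of the classifying space spanned by a simplex of events of the model and the
whole configuration. -/
def chain {n : ℕ} (u : U) (m : M) (c : NerveSpace (BadPoset bad₀) n) :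
    NerveSpace (BadPoset bad) (n + 1) :=
  ⟨Fin.snoc (α := fun _ => BadPoset bad) (fun j => E.subVertex hbad₀ u m (c.1 j))
      (E.topVertex u m (c.1 0).1.1), by
    have hbase : ∀ j, (c.1 j).1.1 = (c.1 0).1.1 := fun j => (c.2 (Fin.zero_le j)).1.symm
    intro i j hij
    induction j using Fin.lastCases with
    | last =>
      induction i using Fin.lastCases with
      | last => exact le_rfl
      | cast i =>
        rw [Fin.snoc_castSucc, Fin.snoc_last]
        refine ⟨congrArg (fun h : {h : N // badN h Finset.univ} => E.elem u (m, h.1)) (hbase i), ?_⟩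
        change (c.1 i).1.2.map _ ⊆ u.1.1
        rw [← E.map_point]
        exact Finset.map_subset_map.2 (Finset.subset_univ _)
    | cast j =>
      induction i using Fin.lastCases with
      | last => exact absurd hij (not_le_of_gt (Fin.castSucc_lt_last j))
      | cast i =>
        rw [Fin.snoc_castSucc, Fin.snoc_castSucc]
        have := c.2 (Fin.castSucc_le_castSucc_iff.1 hij)
        exact ⟨congrArg (fun h : {h : N // badN h Finset.univ} => E.elem u (m, h.1)) this.1, Finset.map_subset_map.2 this.2⟩⟩

theorem continuous_chain {n : ℕ} :
    Continuous fun x : (U × M) × NerveSpace (BadPoset bad₀) n =>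
      E.chain hbad₀ x.1.1 x.1.2 x.2 := by
  have hv : ∀ j, Continuous fun x : (U × M) × NerveSpace (BadPoset bad₀) n => x.2.1 j :=
    fun j => (continuous_apply j).comp (continuous_subtype_val.comp continuous_snd)
  refine Continuous.subtype_mk (Continuous.finSnoc (continuous_pi fun j => ?_) ?_) _
  · exact (E.continuous_subVertex hbad₀).comp (continuous_fst.prodMk (hv j))
  · exact E.continuous_topVertex.comp
      (continuous_fst.prodMk (BadPoset.continuous_fst.comp (hv 0)))

end

/-- Completion of affine to barycentric coordinates. -/
def _root_.openFaceSimplex.toStdSimplex {n : ℕ} (a : openFaceSimplex n) :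
    stdSimplex ℝ (Fin (n + 2)) :=
  ⟨Fin.snoc (α := fun _ => ℝ) a.1 (1 - ∑ j, a.1 j), fun i => by
    induction i using Fin.lastCases with
    | last => rw [Fin.snoc_last]; exact sub_nonneg.2 a.2.2.le
    | cast i => rw [Fin.snoc_castSucc]; exact a.2.1 i, by
    rw [Fin.sum_univ_castSucc]
    simp⟩

theorem _root_.openFaceSimplex.continuous_toStdSimplex {n : ℕ} :
    Continuous (openFaceSimplex.toStdSimplex (n := n)) := by
  refine Continuous.subtype_mk (Continuous.finSnoc (A := fun _ => ℝ)
    (f := fun a : openFaceSimplex n => a.1) continuous_subtype_val ?_) _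
  exact continuous_const.sub (continuous_finsetSum _ fun j _ =>
    (continuous_apply j).comp continuous_subtype_val)

theorem corresponds_vertex (u : U) (m : M) (h : {h : N // badN h Finset.univ}) :
    E.Corresponds (ClassifyingSpace.mk (n := 0) ⟨fun _ => E.topVertex u m h, monotone_const⟩
      (stdSimplex.vertex 0)) ((u, m), FiberwiseOpenCone.vertex
        (ClassifyingSpace.base (bad := bad₀)) h) := by
  classical
  refine ⟨rfl, fun S => ?_⟩
  rw [ClassifyingSpace.weight_mk, pushWeight_vertex, E.map_point]
  simp [topVertex]

theorem corresponds_ofCoords (hbad₀ : ∀ h R, bad₀ h R ↔ R ≠ Finset.univ ∧ badN h.1 R) (u : U)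
    (m : M) {n : ℕ} (c : NerveSpace (BadPoset bad₀) n) (a : openFaceSimplex n) :
    E.Corresponds (ClassifyingSpace.mk (E.chain hbad₀ u m c) (openFaceSimplex.toStdSimplex a))
      ((u, m), FiberwiseOpenCone.ofCoords c a) := by
  classical
  refine ⟨?_, fun S => ?_⟩
  · rw [ClassifyingSpace.base_mk _ _ (Fin.last _), FiberwiseOpenCone.base_ofCoords]
    simp only [chain, Fin.snoc_last]
    rfl
  · rw [ClassifyingSpace.weight_mk, pushWeight_ofCoords, Fin.sum_univ_castSucc, E.map_point]
    simp only [chain, openFaceSimplex.toStdSimplex, Fin.snoc_castSucc, Fin.snoc_last]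
    congr 1
    · refine Finset.sum_congr rfl fun j _ => ?_
      congr 1
      exact Fin.snoc_castSucc (α := fun _ => ℝ) _ _ j
    · congr 1
      exact Fin.snoc_last (α := fun _ => ℝ) _ _

end EventModel

/-! ### The homeomorphism over an open set of configurations -/

namespace EventModel

open Topology

variable {Y : Type u} {X : Type v} [TopologicalSpace Y] [TopologicalSpace X]
  {bad : Y → Finset X → Prop} {p : ℕ} {U : Set (Config X p)} {ι : Type w} [Fintype ι]
  {M N : Type*} [TopologicalSpace M] [TopologicalSpace N] {badN : N → Finset ι → Prop}
  (E : EventModel bad U M N badN)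
  {bad₀ : {h : N // badN h Finset.univ} → Finset ι → Prop}
  (hbad₀ : ∀ h R, bad₀ h R ↔ R ≠ Finset.univ ∧ badN h.1 R)

section

variable [TopologicalSpace ι]

include hbad₀ in
/-- The chains of events near a given one: with `J` the index of the top event, the events up to
`J` are given by constant subsets `R j` of the configuration. -/
theorem exists_corresponds_near [T2Space X] {n : ℕ} (w₀ : {x : NerveSpace (BadPoset bad) n ×
      stdSimplex ℝ (Fin (n + 1)) // ClassifyingSpace.mk x.1 x.2 ∈ overConfig bad p U}) :
    ∃ O : Set {x : NerveSpace (BadPoset bad) n × stdSimplex ℝ (Fin (n + 1)) //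
        ClassifyingSpace.mk x.1 x.2 ∈ overConfig bad p U}, IsOpen O ∧ w₀ ∈ O ∧
      ∃ G : O → (U × M) × FiberwiseOpenCone (ClassifyingSpace.base (bad := bad₀)),
        Continuous G ∧ ∀ w : O, E.Corresponds (ClassifyingSpace.mk w.1.1.1 w.1.1.2) (G w) := by
  classical
  let W := {x : NerveSpace (BadPoset bad) n × stdSimplex ℝ (Fin (n + 1)) //
    ClassifyingSpace.mk x.1 x.2 ∈ overConfig bad p U}
  let conf : W → U := fun w => ⟨_, w.2.choose_spec⟩
  have hconf : ∀ w : W, (ClassifyingSpace.mk w.1.1 w.1.2).topEvent = (conf w).1.1 := fun w => rfl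
  have hconfc : Continuous conf := by
    refine Continuous.subtype_mk ?_ _
    exact (ClassifyingSpace.continuous_toConfig p).comp
      (Continuous.subtype_mk (ClassifyingSpace.continuous_mk.comp continuous_subtype_val) _)
  obtain ⟨J, hJ, hJmax, hJtop⟩ := ClassifyingSpace.exists_mem_topEvent_eq w₀.1.1 w₀.1.2
  let R : Fin (n + 1) → Finset ι := fun j =>
    Finset.univ.filter fun s => E.point (conf w₀) s ∈ (w₀.1.1.1 j).1.2
  have hRmono : Monotone R := fun i j hij s hs => by
    simp only [R, Finset.mem_filter, Finset.mem_univ, true_and] at hs ⊢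
    exact (w₀.1.1.2 hij).2 hs
  have hRJ : R J = Finset.univ := by
    ext s
    simp only [R, Finset.mem_filter, Finset.mem_univ, true_and, iff_true]
    rw [← hJtop, hconf, ← E.map_point]
    exact Finset.mem_map_of_mem _ (Finset.mem_univ s)
  have hvc : ∀ j, Continuous fun w : W => w.1.1.1 j := fun j =>
    (ClassifyingSpace.continuous_vertex j).comp continuous_subtype_val
  have htc : ∀ j, Continuous fun w : W => w.1.2 j := fun j =>
    (ClassifyingSpace.continuous_coord j).comp continuous_subtype_val
  -- On `O` the vertex `J` keeps nonzero weight, and for `j ≤ J` the `j`-th event is covered by the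
  -- sets `E.nhd s` with `s ∈ R j` and meets each of them. Vertices after `J` are not constrained:
  -- their weights vanish at `w₀`, but perhaps not nearby.
  let O : Set W := {w | w.1.2 J ≠ 0} ∩ ⋂ j : Fin (n + 1), ⋂ _ : j ≤ J,
    (⋂ s ∈ R j, {w | ∃ y ∈ (w.1.1.1 j).1.2, y ∈ E.nhd s}) ∩
      {w | ∀ y ∈ (w.1.1.1 j).1.2, y ∈ ⋃ s ∈ R j, E.nhd s}
  have hO : IsOpen O := by
    refine (isOpen_ne.preimage (htc J)).inter (isOpen_iInter_of_finite fun j =>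
      isOpen_iInter_of_finite fun _ => IsOpen.inter (isOpen_biInter_finset fun s _ => ?_) ?_)
    · exact (BadPoset.isOpen_hit (E.isOpen_nhd s)).preimage (hvc j)
    · exact (BadPoset.isOpen_subset (isOpen_biUnion fun s _ => E.isOpen_nhd s)).preimage (hvc j)
  have hw₀ : w₀ ∈ O := by
    refine ⟨hJ, Set.mem_iInter₂.2 fun j hj => ⟨Set.mem_iInter₂.2 fun s hs => ?_, ?_⟩⟩
    · simp only [R, Finset.mem_filter, Finset.mem_univ, true_and] at hs
      exact ⟨_, hs, E.point_mem _ s⟩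
    · intro y hy
      have : y ∈ (conf w₀).1.1 := by
        rw [← hconf, hJtop]
        exact (w₀.1.1.2 hj).2 hy
      rw [← E.map_point] at this
      obtain ⟨s, -, rfl⟩ := Finset.mem_map.1 this
      exact Set.mem_iUnion₂.2 ⟨s, by simpa [R] using hy, E.point_mem _ s⟩
  -- The event at `J` lies in the top event because its weight is nonzero, and it has at least as
  -- many points because it meets all the disjoint sets `E.nhd s`.
  have hOJ : ∀ w ∈ O, (w.1.1.1 J).1.2 = (conf w).1.1 := by
    intro w hw
    refine Finset.eq_of_subset_of_card_le ?_ ?_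
    · rw [← hconf]
      exact ClassifyingSpace.subset_topEvent_mk _ _ hw.1
    · have hc : (conf w).1.1.card = Fintype.card ι := (conf w).1.2.trans (E.card_eq (conf w)).symm
      rw [hc]
      refine card_le_card_of_hits E.disjoint_nhd fun s => ?_
      exact Set.mem_iInter₂.1 (Set.mem_iInter₂.1 hw.2 J le_rfl).1 s (hRJ ▸ Finset.mem_univ s)
  have hOle : ∀ w ∈ O, ∀ j ≤ J, (w.1.1.1 j).1.2 = (R j).map (E.point (conf w)) := by
    intro w hw j hj
    have hsub : (w.1.1.1 j).1.2 ⊆ Finset.univ.map (E.point (conf w)) := by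
      rw [E.map_point, ← hOJ w hw]
      exact (w.1.1.2 hj).2
    have huniq : ∀ s s', E.point (conf w) s ∈ E.nhd s' → s = s' := fun s s' h => by
      by_contra hne
      exact Set.disjoint_left.1 (E.disjoint_nhd hne) (E.point_mem _ s) h
    obtain ⟨h1, h2⟩ := Set.mem_iInter₂.1 hw.2 j hj
    ext y
    constructor
    · intro hy
      obtain ⟨s, -, rfl⟩ := Finset.mem_map.1 (hsub hy)
      obtain ⟨s', hs', hys'⟩ := Set.mem_iUnion₂.1 (h2 _ hy)
      rw [huniq s s' hys']
      exact Finset.mem_map_of_mem _ hs'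
    · intro hy
      obtain ⟨s, hs, rfl⟩ := Finset.mem_map.1 hy
      obtain ⟨y, hy, hys⟩ := Set.mem_iInter₂.1 h1 s hs
      obtain ⟨s', -, rfl⟩ := Finset.mem_map.1 (hsub hy)
      rwa [← huniq s' s hys]
  -- An event after `J` contains the one at `J`, which is the whole configuration, and it lies in
  -- the top event if it has nonzero weight.
  have hOgt : ∀ w ∈ O, ∀ j, J < j → w.1.2 j ≠ 0 → (w.1.1.1 j).1.2 = (conf w).1.1 := by
    intro w hw j hj htj
    refine subset_antisymm ?_ ?_
    · rw [← hconf]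
      exact ClassifyingSpace.subset_topEvent_mk _ _ htj
    · rw [← hOJ w hw]
      exact (w.1.1.2 hj.le).2
  let q : W → M × N := fun w => (E.coord (conf w, (w.1.1.1 0).1.1)).2
  have hqc : Continuous q := continuous_snd.comp (E.coord.continuous.comp
    (hconfc.prodMk (BadPoset.continuous_fst.comp (hvc 0))))
  have hbase : ∀ (w : W) j, (w.1.1.1 j).1.1 = (w.1.1.1 0).1.1 := fun w j =>
    (w.1.1.2 (Fin.zero_le j)).1.symm
  have hq : ∀ (w : W) (Q : Finset ι) j, (w.1.1.1 j).1.2 = Q.map (E.point (conf w)) →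
      badN (q w).2 Q := by
    intro w Q j hj
    rw [← E.bad_iff, ← hj, ← hbase w j]
    exact (w.1.1.1 j).2
  have hqu : ∀ w ∈ O, badN (q w).2 Finset.univ := fun w hw => hq w _ J (by
    rw [hOJ w hw, E.map_point])
  refine ⟨O, hO, hw₀, ?_⟩
  have hGc : Continuous fun w : O => (⟨(q w.1).2, hqu w.1 w.2⟩ : {h : N // badN h Finset.univ}) :=
    Continuous.subtype_mk (continuous_snd.comp (hqc.comp continuous_subtype_val)) _
  have hUM : Continuous fun w : O => (conf w.1, (q w.1).1) :=
    (hconfc.comp continuous_subtype_val).prodMk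
      (continuous_fst.comp (hqc.comp continuous_subtype_val))
  have hsum : ∀ w : W, ∑ j, w.1.2 j = 1 := fun w => w.1.2.2.2
  have hite : ∀ (P : Prop) [Decidable P] (f : Fin (n + 1) → ℝ),
      (if P then ∑ j, f j else 0) = ∑ j, if P then f j else 0 := by
    intro P _ f
    split_ifs <;> simp
  by_cases hex : ∃ j ≤ J, R j ≠ Finset.univ
  -- The index `k` is the last one up to `J` whose event is a proper subset. All later vertices of
  -- nonzero weight are the whole configuration, and their weight is implicit in affine coordinates.
  · let D : Finset (Fin (n + 1)) := Finset.univ.filter fun j => j ≤ J ∧ R j ≠ Finset.univ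
    have hD : D.Nonempty := by
      obtain ⟨j, hj⟩ := hex
      exact ⟨j, by simpa [D] using hj⟩
    let k := D.max' hD
    obtain ⟨hkJ, hkR⟩ : k ≤ J ∧ R k ≠ Finset.univ :=
      (Finset.mem_filter.1 (D.max'_mem hD)).2
    have hkmax : ∀ j, k < j → j ≤ J → R j = Finset.univ := by
      intro j hkj hjJ
      by_contra hj
      exact absurd (D.le_max' j (by simp [D, hjJ, hj])) (not_le.2 hkj)
    have hkJ' : k < J := lt_of_le_of_ne hkJ fun h => hkR (h ▸ hRJ)
    -- The chain keeps its length by repeating the event at `k`; the superfluous vertices get weight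
    -- zero in `a`.
    let c : O → NerveSpace (BadPoset bad₀) n := fun w =>
      ⟨fun j => ⟨(⟨(q w.1).2, hqu w.1 w.2⟩, R (min j k)), (hbad₀ _ _).2
        ⟨fun h => hkR (Finset.eq_univ_of_forall fun s =>
          hRmono (min_le_right j k) (by
            have h' : R (min j k) = Finset.univ := h
            exact h' ▸ Finset.mem_univ s)),
        hq w.1 _ (min j k) (hOle w.1 w.2 _ ((min_le_right j k).trans hkJ))⟩⟩,
      fun i j hij => ⟨rfl, hRmono (min_le_min_right k hij)⟩⟩
    let a : O → openFaceSimplex n := fun w =>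
      ⟨fun j => if j ≤ k then w.1.1.2 j else 0, fun j => by
        dsimp only
        split_ifs
        · exact w.1.1.2.2.1 j
        · exact le_rfl, by
        rw [← hsum w.1]
        -- The inequality is strict because the vertex `J`, which comes after `k`, is omitted and
        -- has nonzero weight on `O`.
        refine Finset.sum_lt_sum (fun j _ => ?_) ⟨J, Finset.mem_univ J, ?_⟩
        · split_ifs
          · exact le_rfl
          · exact w.1.1.2.2.1 j
        · rw [if_neg (not_le.2 hkJ')]
          exact lt_of_le_of_ne (w.1.1.2.2.1 J) (Ne.symm w.2.1)⟩
    have hcc : Continuous c := by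
      refine Continuous.subtype_mk (continuous_pi fun j => ?_) _
      exact BadPoset.continuous_of_map hGc (R (min j k)) (fun _ s => s)
        (fun s _ => continuous_const) fun w y => by simp
    have hac : Continuous a := by
      refine Continuous.subtype_mk (continuous_pi fun j => ?_) _
      by_cases hj : j ≤ k
      · simp only [hj, if_true]
        exact (htc j).comp continuous_subtype_val
      · simpa [hj] using continuous_const
    refine ⟨fun w => ((conf w.1, (q w.1).1), FiberwiseOpenCone.ofCoords (c w) (a w)),
      hUM.prodMk (FiberwiseOpenCone.continuous_ofCoords.comp (hcc.prodMk hac)),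
      fun w => ⟨?_, fun S => ?_⟩⟩
    · rw [FiberwiseOpenCone.base_ofCoords]
      exact (E.elem_coord _ _).symm
    · rw [ClassifyingSpace.weight_mk, pushWeight_ofCoords, ← hsum w.1,
        ← Finset.sum_sub_distrib, hite,
        ← Finset.sum_add_distrib]
      refine Finset.sum_congr rfl fun j _ => ?_
      by_cases hj : j ≤ k
      · have h1 : (w.1.1.1.1 j).1.2 = (R (min j k)).map (E.point (conf w.1)) := by
          rw [min_eq_left hj]
          exact hOle w.1 w.2 j (hj.trans hkJ)
        rw [h1]
        simp [a, c, hj]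
      · have h2 : w.1.1.2 j = 0 ∨ (w.1.1.1.1 j).1.2 = Finset.univ.map (E.point (conf w.1)) := by
          by_cases ht : w.1.1.2 j = 0
          · exact Or.inl ht
          · right
            rcases le_or_gt j J with h | h
            · rw [hOle w.1 w.2 j h, hkmax j (not_le.1 hj) h]
            · rw [E.map_point]
              exact hOgt w.1 w.2 j h ht
        rcases h2 with h2 | h2
        · simp [a, hj, h2]
        · rw [h2]
          simp [a, hj]
  -- Here every vertex of nonzero weight is the whole configuration, so the point is the vertex of
  -- the cone.
  · push Not at hex
    refine ⟨fun w => ((conf w.1, (q w.1).1), FiberwiseOpenCone.vertex _ ⟨(q w.1).2, hqu w.1 w.2⟩),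
      hUM.prodMk (FiberwiseOpenCone.continuous_vertex.comp hGc), fun w => ⟨?_, fun S => ?_⟩⟩
    · rw [FiberwiseOpenCone.base_vertex]
      exact (E.elem_coord _ _).symm
    · rw [ClassifyingSpace.weight_mk, pushWeight_vertex]
      have h2 : ∀ j, w.1.1.2 j ≠ 0 →
          (w.1.1.1.1 j).1.2 = Finset.univ.map (E.point (conf w.1)) := by
        intro j ht
        rcases le_or_gt j J with h | h
        · rw [hOle w.1 w.2 j h, hex j h]
        · rw [E.map_point]
          exact hOgt w.1 w.2 j h ht
      rw [← hsum w.1, hite]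
      refine Finset.sum_congr rfl fun j _ => ?_
      by_cases ht : w.1.1.2 j = 0
      · simp [ht]
      · rw [h2 j ht]

include hbad₀ in
theorem exists_corresponds [DiscreteTopology ι]
    (t : (U × M) × FiberwiseOpenCone (ClassifyingSpace.base (bad := bad₀))) :
    ∃ z, E.Corresponds z t := by
  obtain ⟨⟨u, m⟩, x⟩ := t
  rcases FiberwiseOpenCone.cases x with ⟨y, rfl⟩ | ⟨z, s, rfl⟩
  · exact ⟨_, E.corresponds_vertex u m y⟩
  · obtain ⟨n, c, t, rfl⟩ := ClassifyingSpace.exists_mk z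
    obtain ⟨a, -, ha⟩ := FiberwiseOpenCone.exists_ofCoords c t s
    rw [ha]
    exact ⟨_, E.corresponds_ofCoords hbad₀ u m c a⟩

include hbad₀ in
-- The correspondence is a bijection by existence and uniqueness on both sides, and both directions
-- can be tested on simplices. Starting from the model this uses that `U × M` is locally compact; in
-- the other direction, that the part over `U` is locally closed.
theorem exists_homeomorph [DiscreteTopology ι] [T2Space X] [LocallyCompactSpace U]
    [LocallyCompactSpace M] (hp : 0 < p) :
    ∃ e : overConfig bad p U ≃ₜ
        (U × M) × FiberwiseOpenCone (ClassifyingSpace.base (bad := bad₀)),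
      ∀ z, E.Corresponds z.1 (e z) := by
  choose B hB using E.exists_corresponds hbad₀
  have hmem : ∀ t, B t ∈ overConfig bad p U := fun t =>
    mem_overConfig hp ((hB t).topEvent_eq hbad₀)
  have hBc : Continuous B := by
    apply FiberwiseOpenCone.continuous_prod_of
    · have : (fun x : (U × M) × {h : N // badN h Finset.univ} =>
          B (x.1, FiberwiseOpenCone.vertex _ x.2)) = fun x => ClassifyingSpace.mk (n := 0)
            ⟨fun _ => E.topVertex x.1.1 x.1.2 x.2, monotone_const⟩ (stdSimplex.vertex 0) :=
        funext fun x => (hB _).left_unique (E.corresponds_vertex x.1.1 x.1.2 x.2)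
      rw [this]
      exact ClassifyingSpace.continuous_mk.comp ((Continuous.subtype_mk
        (continuous_pi fun _ => E.continuous_topVertex) _).prodMk continuous_const)
    · intro n
      have : (fun x : (U × M) × (NerveSpace (BadPoset bad₀) n × openFaceSimplex n) =>
          B (x.1, FiberwiseOpenCone.ofCoords x.2.1 x.2.2)) = fun x => ClassifyingSpace.mk
            (E.chain hbad₀ x.1.1 x.1.2 x.2.1) (openFaceSimplex.toStdSimplex x.2.2) :=
        funext fun x => (hB _).left_unique (E.corresponds_ofCoords hbad₀ x.1.1 x.1.2 x.2.1 x.2.2)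
      rw [this]
      exact ClassifyingSpace.continuous_mk.comp (((E.continuous_chain hbad₀).comp
        (continuous_fst.prodMk (continuous_fst.comp continuous_snd))).prodMk
        (openFaceSimplex.continuous_toStdSimplex.comp (continuous_snd.comp continuous_snd)))
  have hex : ∀ z : overConfig bad p U,
      ∃ t : (U × M) × FiberwiseOpenCone (ClassifyingSpace.base (bad := bad₀)),
        E.Corresponds z.1 t := by
    rintro ⟨z, hz⟩
    obtain ⟨n, c, t, rfl⟩ := ClassifyingSpace.exists_mk z
    obtain ⟨O, -, hO, G, -, hG⟩ := E.exists_corresponds_near hbad₀ ⟨(c, t), hz⟩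
    exact ⟨_, hG ⟨_, hO⟩⟩
  choose g hg using hex
  -- By uniqueness, `g` coincides near each point of each simplex with the continuous correspondence
  -- constructed there.
  have hgc : Continuous g := by
    refine ClassifyingSpace.continuous_of_isLocallyClosed (isLocallyClosed_overConfig E.isOpen) g
      fun n => continuous_iff_continuousAt.2 fun w₀ => ?_
    obtain ⟨O, hO, hw₀, G, hGc, hG⟩ := E.exists_corresponds_near hbad₀ w₀
    refine ContinuousOn.continuousAt (s := O) ?_ (hO.mem_nhds hw₀)
    refine continuousOn_iff_continuous_domRestrict.2 (hGc.congr fun w => ?_)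
    exact (hG w).right_unique hbad₀ (hg ⟨_, w.1.2⟩)
  exact ⟨{ toFun := g
           invFun := fun t => ⟨B t, hmem t⟩
           left_inv := fun z => Subtype.ext ((hB _).left_unique (hg z))
           right_inv := fun t => (hg _).right_unique hbad₀ (hB t)
           continuous_toFun := hgc
           continuous_invFun := hBc.subtype_mk _ }, hg⟩

end

end EventModel

open scoped Classical in
-- A trivialization consists of functions defined everywhere, which need some value outside their
-- domains. For this reason the fiber has to be nonempty whenever the total space is.
theorem isLocallyTrivialAt_of_homeomorph {Z B F : Type*} [TopologicalSpace Z] [TopologicalSpace B]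
    [TopologicalSpace F] {π : Z → B} (hπ : Continuous π) {U : Set B} (hU : IsOpen U)
    (e : π ⁻¹' U ≃ₜ U × F) (he : ∀ z, ((e z).1 : B) = π z) (hF : Z → Nonempty F) {b : B}
    (hb : b ∈ U) : IsLocallyTrivialAt π F b :=
  ⟨{ toFun := fun z => if hz : π z ∈ U then ⟨(e ⟨z, hz⟩).1, (e ⟨z, hz⟩).2⟩ else
       ⟨b, (hF z).some⟩
     invFun := fun x => e.symm (if hx : x.1 ∈ U then ⟨x.1, hx⟩ else ⟨b, hb⟩, x.2)
     source := π ⁻¹' U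
     target := U ×ˢ Set.univ
     map_source' := fun z (hz : π z ∈ U) => by simp [hz]
     map_target' := fun _ _ => Subtype.coe_prop _
     left_inv' := fun z (hz : π z ∈ U) => by simp [hz]
     right_inv' := fun x => by
       rintro ⟨hx, -⟩
       simpa [hx] using fun h => (h (e.symm _).2).elim
     open_source := hU.preimage hπ
     open_target := hU.prod isOpen_univ
     continuousOn_toFun := continuousOn_iff_continuous_domRestrict.mpr <|
       ((continuous_subtype_val.prodMap continuous_id).comp e.continuous).congr
       fun ⟨z, (hz : π z ∈ U)⟩ => by simp [Prod.map, hz]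
     continuousOn_invFun := continuousOn_iff_continuous_domRestrict.mpr <|
       ((continuous_subtype_val.comp e.symm.continuous).comp (by fun_prop :
         Continuous fun ui => ⟨⟨_, ui.2.1⟩, ui.1.2⟩)).congr fun ⟨⟨x, i⟩, ⟨hx, _⟩⟩ => by simp [hx]
     baseSet := U
     open_baseSet := hU
     source_eq := rfl
     target_eq := rfl
     proj_toFun := fun z (hz : π z ∈ U) => by simp [hz, he] }, hb⟩

theorem EventModel.isLocallyTrivialAt {Y : Type u} {X : Type v} [TopologicalSpace Y]
    [TopologicalSpace X] {bad : Y → Finset X → Prop} {p : ℕ} {U : Set (Config X p)} {ι : Type w}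
    [Fintype ι] {M N : Type*} [TopologicalSpace M] [TopologicalSpace N]
    {badN : N → Finset ι → Prop} (E : EventModel bad U M N badN)
    {bad₀ : {h : N // badN h Finset.univ} → Finset ι → Prop}
    (hbad₀ : ∀ h R, bad₀ h R ↔ R ≠ Finset.univ ∧ badN h.1 R)
    [TopologicalSpace ι] [DiscreteTopology ι] [T2Space X] [LocallyCompactSpace U]
    [LocallyCompactSpace M] [Nonempty M] (hp : 0 < p) {S : Config X p} (hS : S ∈ U)
    (hne : FiltrationDiff bad p → ∃ h, badN h Finset.univ) :
    IsLocallyTrivialAt (FiltrationDiff.toConfig bad p)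
      (M × FiberwiseOpenCone (ClassifyingSpace.base (bad := bad₀))) S := by
  obtain ⟨e, he⟩ := E.exists_homeomorph hbad₀ hp
  let e₁ : FiltrationDiff.toConfig bad p ⁻¹' U ≃ₜ overConfig bad p U :=
    { toFun := fun z => ⟨z.1.1, z.1.2, z.2⟩
      invFun := fun z => ⟨⟨z.1, z.2.choose⟩, z.2.choose_spec⟩
      left_inv := fun z => rfl
      right_inv := fun z => rfl
      continuous_toFun := (continuous_subtype_val.comp continuous_subtype_val).subtype_mk _
      continuous_invFun := (continuous_subtype_val.subtype_mk _).subtype_mk _ }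
  refine isLocallyTrivialAt_of_homeomorph (ClassifyingSpace.continuous_toConfig p) E.isOpen
    ((e₁.trans e).trans (Homeomorph.prodAssoc U M _)) (fun z => ?_) (fun z => ?_) hS
  · exact Subtype.ext ((he (e₁ z)).topEvent_eq hbad₀).symm
  · obtain ⟨h, hh⟩ := hne z
    exact ⟨Classical.arbitrary M, FiberwiseOpenCone.vertex _ ⟨h, hh⟩⟩

/-! ## The cone on the poset of all proper nonempty subsets -/

section ChainWeights

variable {ι : Type*} [Fintype ι]

open scoped Classical in
/-- The total weight of the sets which do not contain a point. -/
noncomputable def depth (w : Finset ι → ℝ) (s : ι) : ℝ := ∑ R, if s ∈ R then 0 else w R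

/-- A set of the chain that misses `x` cannot contain `R`, hence it is contained in `R` and misses
`y` too. The set `R` itself contributes only to the depth of `y`. -/
theorem depth_lt_depth {w : Finset ι → ℝ} (hw : ∀ R, 0 ≤ w R)
    (hc : ∀ R R', w R ≠ 0 → w R' ≠ 0 → R ⊆ R' ∨ R' ⊆ R) {R : Finset ι} (hR : w R ≠ 0) {x y : ι}
    (hx : x ∈ R) (hy : y ∉ R) : depth w x < depth w y := by
  classical
  refine Finset.sum_lt_sum (fun Q _ => ?_) ⟨R, Finset.mem_univ R, ?_⟩
  · by_cases hQ : w Q = 0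
    · simp [hQ]
    by_cases hxQ : x ∈ Q
    · rw [if_pos hxQ]
      split_ifs
      · exact le_rfl
      · exact hw Q
    · have hyQ : y ∉ Q := by
        rcases hc R Q hR hQ with h | h
        · exact absurd (h hx) hxQ
        · exact fun h' => hy (h h')
      rw [if_neg hxQ, if_neg hyQ]
  · rw [if_pos hx, if_neg hy]
    exact lt_of_le_of_ne (hw R) (Ne.symm hR)

/-- The sets of a chain are sublevel sets of the depth function, and their weights are its jumps;
only the whole set contributes nothing to the depth, so its weight has to vanish. For the proof,
incomparable sets from the two supports would order some pair of points in opposite ways. So the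
sets whose weights differ form a chain, and a point outside the smallest one but in all others has
depths that differ in a single term. -/
theorem eq_of_depth_eq {w w' : Finset ι → ℝ} (hw : ∀ R, 0 ≤ w R) (hw' : ∀ R, 0 ≤ w' R)
    (hc : ∀ R R', w R ≠ 0 → w R' ≠ 0 → R ⊆ R' ∨ R' ⊆ R)
    (hc' : ∀ R R', w' R ≠ 0 → w' R' ≠ 0 → R ⊆ R' ∨ R' ⊆ R)
    (hu : w Finset.univ = 0) (hu' : w' Finset.univ = 0) (h : depth w = depth w') : w = w' := by
  classical
  have hcc : ∀ R R', w R ≠ 0 → w' R' ≠ 0 → R ⊆ R' ∨ R' ⊆ R := by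
    intro R R' hR hR'
    by_contra hcon
    push Not at hcon
    obtain ⟨x, hx, hx'⟩ := Finset.not_subset.1 hcon.1
    obtain ⟨y, hy, hy'⟩ := Finset.not_subset.1 hcon.2
    have h1 := depth_lt_depth hw hc hR hx hy'
    have h2 := depth_lt_depth hw' hc' hR' hy hx'
    rw [h] at h1
    exact lt_asymm h1 h2
  by_contra hne
  let D : Finset (Finset ι) := Finset.univ.filter fun R => w R ≠ w' R
  have hmemD : ∀ R, R ∈ D ↔ w R ≠ w' R := fun R => by simp [D]
  have hDc : ∀ R ∈ D, ∀ R' ∈ D, R ⊆ R' ∨ R' ⊆ R := by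
    intro R hR R' hR'
    rw [hmemD] at hR hR'
    by_cases h1 : w R = 0
    · have h1' : w' R ≠ 0 := fun h => hR (h1.trans h.symm)
      by_cases h2 : w R' = 0
      · exact hc' R R' h1' fun h => hR' (h2.trans h.symm)
      · exact (hcc R' R h2 h1').symm
    · by_cases h2 : w R' = 0
      · exact hcc R R' h1 fun h => hR' (h2.trans h.symm)
      · exact hc R R' h1 h2
  have hsub : ∀ R ∈ D, ∀ R' ∈ D, R.card ≤ R'.card → R ⊆ R' := by
    intro R hR R' hR' hle
    rcases hDc R hR R' hR' with h | h
    · exact h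
    · exact (Finset.eq_of_subset_of_card_le h hle).ge
  have hDne : D.Nonempty := by
    obtain ⟨R, hR⟩ := Function.ne_iff.1 hne
    exact ⟨R, (hmemD R).2 hR⟩
  obtain ⟨R, hR, hRmin⟩ := D.exists_min_image Finset.card hDne
  have hex : ∃ s, s ∉ R ∧ ∀ R' ∈ D, R' ≠ R → s ∈ R' := by
    by_cases hE : (D.erase R).Nonempty
    · obtain ⟨Q, hQ, hQmin⟩ := (D.erase R).exists_min_image Finset.card hE
      obtain ⟨hQR, hQD⟩ := Finset.mem_erase.1 hQ
      have hRQ : R ⊂ Q := (hsub R hR Q hQD (hRmin Q hQD)).ssubset_of_ne hQR.symm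
      obtain ⟨s, hs, hs'⟩ := Finset.exists_of_ssubset hRQ
      exact ⟨s, hs', fun R' hR' hne' =>
        hsub Q hQD R' hR' (hQmin R' (Finset.mem_erase.2 ⟨hne', hR'⟩)) hs⟩
    · have hRu : R ≠ Finset.univ := by
        rintro rfl
        exact (hmemD _).1 hR (hu.trans hu'.symm)
      obtain ⟨s, hs⟩ : ∃ s, s ∉ R := by
        by_contra hcon
        push Not at hcon
        exact hRu (Finset.eq_univ_of_forall hcon)
      exact ⟨s, hs, fun R' hR' hne' => absurd ⟨R', Finset.mem_erase.2 ⟨hne', hR'⟩⟩ hE⟩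
  obtain ⟨s, hsR, hs⟩ := hex
  have h0 : depth w s - depth w' s = 0 := by rw [h, sub_self]
  unfold depth at h0
  rw [← Finset.sum_sub_distrib, Finset.sum_eq_single R] at h0
  · rw [if_neg hsR, if_neg hsR, sub_eq_zero] at h0
    exact (hmemD R).1 hR h0
  · intro Q _ hQR
    by_cases hQ : Q ∈ D
    · simp [hs Q hQ hQR]
    · rw [hmemD, not_not] at hQ
      rw [hQ, sub_self]
  · exact fun h => absurd (Finset.mem_univ R) h

end ChainWeights

/-- Functions on `ι` with values in `[0, 1)` and minimum `0`. -/
def depthFunctions (ι : Type*) : Set (ι → ℝ) := {d | (∀ s, 0 ≤ d s ∧ d s < 1) ∧ ∃ s, d s = 0}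

/-- The space of depth functions is a Euclidean space. -/
noncomputable def depthFunctionsHomeomorph {ι : Type*} {n : ℕ} (e : Fin (n + 1) ≃ ι) :
    depthFunctions ι ≃ₜ (Fin n → ℝ) where
  -- The map `x ↦ x / (1 - x)` identifies `[0, 1)` with `[0, ∞)`. Functions with values in `[0, ∞)`
  -- and minimum zero represent all functions modulo constants, which can also be normalized to
  -- vanish at `e 0`. The inverse subtracts the minimum and applies `x ↦ x / (1 + x)`.
  toFun d i := d.1 (e i.succ) / (1 - d.1 (e i.succ)) - d.1 (e 0) / (1 - d.1 (e 0))
  invFun y := ⟨fun s =>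
      (Fin.cons (α := fun _ => ℝ) 0 y (e.symm s) -
        Finset.univ.inf' Finset.univ_nonempty (Fin.cons (α := fun _ => ℝ) 0 y)) /
      (1 + (Fin.cons (α := fun _ => ℝ) 0 y (e.symm s) -
        Finset.univ.inf' Finset.univ_nonempty (Fin.cons (α := fun _ => ℝ) 0 y))), by
    have h : ∀ s, 0 ≤ Fin.cons (α := fun _ => ℝ) 0 y (e.symm s) -
        Finset.univ.inf' Finset.univ_nonempty (Fin.cons (α := fun _ => ℝ) 0 y) := fun s =>
      sub_nonneg.2 (Finset.inf'_le _ (Finset.mem_univ _))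
    refine ⟨fun s => ⟨div_nonneg (h s) (by linarith [h s]), ?_⟩, ?_⟩
    · rw [div_lt_one (by linarith [h s])]
      linarith
    · obtain ⟨i, -, hi⟩ := Finset.exists_mem_eq_inf' (s := (Finset.univ : Finset (Fin (n + 1))))
        Finset.univ_nonempty (Fin.cons (α := fun _ => ℝ) 0 y)
      refine ⟨e i, ?_⟩
      dsimp only
      rw [Equiv.symm_apply_apply, hi, sub_self, zero_div]⟩
  left_inv := by
    rintro ⟨d, hd, s₀, hs₀⟩
    have hpos : ∀ s, 0 < 1 - d s := fun s => sub_pos.2 (hd s).2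
    have hcons : (Fin.cons (α := fun _ => ℝ) 0 fun i : Fin n =>
        d (e i.succ) / (1 - d (e i.succ)) - d (e 0) / (1 - d (e 0))) =
        fun i => d (e i) / (1 - d (e i)) - d (e 0) / (1 - d (e 0)) := by
      funext i
      induction i using Fin.cases with
      | zero => simp
      | succ i => simp
    have hinf : Finset.univ.inf' Finset.univ_nonempty
        (fun i => d (e i) / (1 - d (e i)) - d (e 0) / (1 - d (e 0))) =
        - (d (e 0) / (1 - d (e 0))) := by
      apply le_antisymm
      · refine (Finset.inf'_le _ (Finset.mem_univ (e.symm s₀))).trans ?_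
        simp [hs₀]
      · refine Finset.le_inf' _ _ fun i _ => ?_
        have := div_nonneg (hd (e i)).1 (hpos (e i)).le
        linarith
    apply Subtype.ext
    funext s
    simp only [hcons, hinf, Equiv.apply_symm_apply, sub_neg_eq_add, sub_add_cancel]
    have := hpos s
    field_simp
    ring
  right_inv := by
    intro y
    funext i
    have h : ∀ i, 0 ≤ Fin.cons (α := fun _ => ℝ) 0 y i -
        Finset.univ.inf' Finset.univ_nonempty (Fin.cons (α := fun _ => ℝ) 0 y) := fun i =>
      sub_nonneg.2 (Finset.inf'_le _ (Finset.mem_univ _))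
    have key : ∀ x : ℝ, 0 ≤ x → x / (1 + x) / (1 - x / (1 + x)) = x := by
      intro x hx
      have : 1 - x / (1 + x) = 1 / (1 + x) := by
        field_simp
        ring
      rw [this]
      field_simp
    simp only [Equiv.symm_apply_apply]
    rw [key _ (h _), key _ (h _)]
    simp
  continuous_toFun := by
    have hs : ∀ s, Continuous fun d : depthFunctions ι => d.1 s / (1 - d.1 s) := fun s => by
      have hc : Continuous fun d : depthFunctions ι => d.1 s :=
        (continuous_apply s).comp continuous_subtype_val
      exact hc.div (continuous_const.sub hc) fun d => (sub_pos.2 (d.2.1 s).2).ne'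
    exact continuous_pi fun i => (hs _).sub (hs _)
  continuous_invFun := by
    refine Continuous.subtype_mk (continuous_pi fun s => ?_) _
    have hcons : ∀ i, Continuous fun y : Fin n → ℝ => Fin.cons (α := fun _ => ℝ) 0 y i := by
      intro i
      induction i using Fin.cases with
      | zero => simpa using continuous_const
      | succ i => simpa using continuous_apply i
    have hc := (hcons (e.symm s)).sub (Continuous.finset_inf'_apply Finset.univ_nonempty
      fun i (_ : i ∈ Finset.univ) => hcons i)
    have h0 : Continuous fun y : Fin n → ℝ => Fin.cons (α := fun _ => ℝ) 0 y (e.symm s) -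
        Finset.univ.inf' Finset.univ_nonempty (Fin.cons (α := fun _ => ℝ) 0 y) := hc
    refine h0.div (continuous_const.add h0) fun y => ?_
    have : 0 ≤ Fin.cons (α := fun _ => ℝ) 0 y (e.symm s) -
        Finset.univ.inf' Finset.univ_nonempty (Fin.cons (α := fun _ => ℝ) 0 y) :=
      sub_nonneg.2 (Finset.inf'_le _ (Finset.mem_univ _))
    exact (by linarith : (0 : ℝ) < 1 + _).ne'

section FullCone

open Topology

variable {Y : Type u} {ι : Type v} [Fintype ι] {bad : Y → Finset ι → Prop}
  (hbad : ∀ y R, bad y R ↔ R.Nonempty ∧ R ≠ Finset.univ)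
include hbad

/-- The smallest set of nonzero weight is nonempty, and its points have depth zero; if there is no
such set, all depths vanish. Depths are less than one because the total weight is. -/
theorem depth_weight_mem_depthFunctions [Nonempty ι]
    (x : FiberwiseOpenCone (ClassifyingSpace.base (bad := bad))) :
    depth x.weight ∈ depthFunctions ι := by
  classical
  refine ⟨fun s => ⟨Finset.sum_nonneg fun R _ => ?_, ?_⟩, ?_⟩
  · split_ifs
    · exact le_rfl
    · exact x.weight_nonneg R
  · refine lt_of_le_of_lt (Finset.sum_le_sum fun R _ => ?_) x.sum_weight_lt_one
    split_ifs
    · exact x.weight_nonneg R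
    · exact le_rfl
  · let D : Finset (Finset ι) := Finset.univ.filter fun R => x.weight R ≠ 0
    by_cases hD : D.Nonempty
    · obtain ⟨R, hR, hmin⟩ := D.exists_min_image Finset.card hD
      have hR' : x.weight R ≠ 0 := by simpa [D] using hR
      obtain ⟨s, hs⟩ := ((hbad _ _).1 (FiberwiseOpenCone.bad_base_of_weight_ne_zero hR')).1
      refine ⟨s, Finset.sum_eq_zero fun Q _ => ?_⟩
      split_ifs with hsQ
      · rfl
      · by_contra hQ
        have hle := hmin Q (by simpa [D] using hQ)
        rcases FiberwiseOpenCone.subset_or_subset_of_weight_ne_zero hR' hQ with h | h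
        · exact hsQ (h hs)
        · exact hsQ ((Finset.eq_of_subset_of_card_le h hle).ge hs)
    · refine ⟨Classical.arbitrary ι, Finset.sum_eq_zero fun Q _ => ?_⟩
      have : x.weight Q = 0 := by
        by_contra hQ
        exact hD ⟨Q, by simpa [D] using hQ⟩
      simp [this]

theorem ext_base_depth {x x' : FiberwiseOpenCone (ClassifyingSpace.base (bad := bad))}
    (hb : x.base = x'.base) (hd : depth x.weight = depth x'.weight) : x = x' := by
  have hne : ∀ y R, bad y R → R ≠ Finset.univ := fun y R h => ((hbad y R).1 h).2
  exact FiberwiseOpenCone.ext_base_weight hb (eq_of_depth_eq x.weight_nonneg x'.weight_nonneg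
    (fun _ _ => FiberwiseOpenCone.subset_or_subset_of_weight_ne_zero)
    (fun _ _ => FiberwiseOpenCone.subset_or_subset_of_weight_ne_zero)
    (weight_univ_eq_zero hne x) (weight_univ_eq_zero hne x') hd)

omit hbad in
open scoped Classical in
theorem depth_weight_ofCoords {n : ℕ} (c : NerveSpace (BadPoset bad) n) (a : openFaceSimplex n)
    (s : ι) : depth (FiberwiseOpenCone.ofCoords c a).weight s =
      ∑ j, if s ∈ (c.1 j).1.2 then 0 else a.1 j := by
  unfold depth
  have : ∀ R : Finset ι, (if s ∈ R then 0 else (FiberwiseOpenCone.ofCoords c a).weight R) =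
      ∑ j, if (c.1 j).1.2 = R then (if s ∈ (c.1 j).1.2 then 0 else a.1 j) else 0 := by
    intro R
    rw [FiberwiseOpenCone.weight_ofCoords]
    split_ifs with h
    · refine (Finset.sum_eq_zero fun j _ => ?_).symm
      by_cases hj : (c.1 j).1.2 = R
      · rw [if_pos hj, hj, if_pos h]
      · rw [if_neg hj]
    · refine Finset.sum_congr rfl fun j _ => ?_
      by_cases hj : (c.1 j).1.2 = R
      · rw [if_pos hj, if_pos hj, hj, if_neg h]
      · rw [if_neg hj, if_neg hj]
  rw [Finset.sum_congr rfl fun R _ => this R, Finset.sum_comm]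
  refine Finset.sum_congr rfl fun j _ => ?_
  exact (Finset.sum_eq_single (c.1 j).1.2 (fun S _ hS => if_neg hS.symm)
    fun h => absurd (Finset.mem_univ _) h).trans (if_pos rfl)

omit [Fintype ι] hbad in
-- Only the increments with `j < i` remain, and they telescope.
theorem sum_ite_sub_succ {m : ℕ} (f : Fin (m + 2) → ℝ) (i : Fin (m + 2)) :
    (∑ j : Fin (m + 1), if i ≤ j.castSucc then 0 else f j.succ - f j.castSucc) = f i - f 0 := by
  induction i using Fin.induction with
  | zero => simp
  | succ k ih =>
    have : ∀ j : Fin (m + 1), (if k.succ ≤ j.castSucc then 0 else f j.succ - f j.castSucc) =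
        (if k.castSucc ≤ j.castSucc then 0 else f j.succ - f j.castSucc) +
          if k = j then f k.succ - f k.castSucc else 0 := by
      intro j
      rcases lt_trichotomy k j with h | rfl | h
      · rw [if_pos (Fin.succ_le_castSucc_iff.2 h), if_pos (Fin.castSucc_le_castSucc_iff.2 h.le),
          if_neg h.ne, add_zero]
      · rw [if_neg (not_le.2 (Fin.castSucc_lt_succ)), if_pos le_rfl, if_pos rfl, zero_add]
      · rw [if_neg (not_le.2 ((Fin.castSucc_lt_castSucc_iff.2 h).trans Fin.castSucc_lt_succ)),
          if_neg (not_le.2 (Fin.castSucc_lt_castSucc_iff.2 h)), if_neg h.ne', add_zero]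
    rw [Finset.sum_congr rfl fun j _ => this j, Finset.sum_add_distrib, ih, Finset.sum_ite_eq,
      if_pos (Finset.mem_univ _)]
    ring

variable [TopologicalSpace Y] [TopologicalSpace ι]

/-- The point of the cone with prescribed depths, for depths ordered by `σ`. -/
theorem exists_section_of_monotone {n : ℕ} (σ : Fin (n + 1) ≃ ι) :
    ∃ G : Y × {d : depthFunctions ι // Monotone (d.1 ∘ σ)} →
        FiberwiseOpenCone (ClassifyingSpace.base (bad := bad)),
      Continuous G ∧ ∀ z, (G z).base = z.1 ∧ depth (G z).weight = z.2.1.1 := by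
  classical
  have h0 : ∀ d : {d : depthFunctions ι // Monotone (d.1 ∘ σ)}, d.1.1 (σ 0) = 0 := by
    rintro ⟨⟨d, hd, s, hs⟩, hm⟩
    refine le_antisymm ?_ (hd _).1
    have := hm (Fin.zero_le (σ.symm s))
    simpa [hs] using this
  rcases n with _ | m
  · refine ⟨fun z => FiberwiseOpenCone.vertex _ z.1,
      FiberwiseOpenCone.continuous_vertex.comp continuous_fst, fun z => ⟨rfl, ?_⟩⟩
    funext s
    obtain ⟨i, rfl⟩ := σ.surjective s
    obtain rfl : i = 0 := Fin.fin_one_eq_zero i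
    rw [h0]
    simp [depth, FiberwiseOpenCone.weight_vertex]
  -- The chain consists of the proper initial segments in the order `σ`, each weighted by the
  -- increment of the depth right after it.
  · let R : Fin (m + 1) → Finset ι := fun j =>
      (Finset.univ.filter fun i => i ≤ j.castSucc).map σ.toEmbedding
    have hmemR : ∀ j i, σ i ∈ R j ↔ i ≤ j.castSucc := fun j i => by simp [R]
    have hRbad : ∀ y j, bad y (R j) := fun y j => (hbad y _).2
      ⟨⟨σ 0, (hmemR j 0).2 (Fin.zero_le _)⟩, fun h => by
        have := (hmemR j (Fin.last _)).1 (h ▸ Finset.mem_univ _)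
        exact absurd this (not_le.2 (Fin.castSucc_lt_last j))⟩
    have hRmono : Monotone R := fun i j hij s hs => by
      obtain ⟨k, rfl⟩ := σ.surjective s
      rw [hmemR] at hs ⊢
      exact hs.trans (Fin.castSucc_le_castSucc_iff.2 hij)
    have htel : ∀ (d : {d : depthFunctions ι // Monotone (d.1 ∘ σ)}) i,
        (∑ j : Fin (m + 1), if σ i ∈ R j then 0 else
          d.1.1 (σ j.succ) - d.1.1 (σ j.castSucc)) = d.1.1 (σ i) := by
      intro d i
      simp only [hmemR]
      rw [sum_ite_sub_succ (fun i => d.1.1 (σ i)), h0, sub_zero]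
    let a : {d : depthFunctions ι // Monotone (d.1 ∘ σ)} → openFaceSimplex m := fun d =>
      ⟨fun j => d.1.1 (σ j.succ) - d.1.1 (σ j.castSucc),
        fun j => sub_nonneg.2 (d.2 Fin.castSucc_lt_succ.le), by
          have h1 := htel d (Fin.last _)
          rw [Finset.sum_congr rfl fun j _ => if_neg (by
            rw [hmemR]; exact not_le.2 (Fin.castSucc_lt_last j))] at h1
          rw [h1]
          exact (d.1.2.1 _).2⟩
    have ha : Continuous a := by
      refine Continuous.subtype_mk (continuous_pi fun j => ?_) _
      have hs : ∀ s, Continuous fun d : {d : depthFunctions ι // Monotone (d.1 ∘ σ)} => d.1.1 s :=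
        fun s => (continuous_apply s).comp (continuous_subtype_val.comp continuous_subtype_val)
      exact (hs _).sub (hs _)
    let c : Y → NerveSpace (BadPoset bad) m := fun y =>
      ⟨fun j => ⟨(y, R j), hRbad y j⟩, fun i j hij => ⟨rfl, hRmono hij⟩⟩
    have hc : Continuous c := Continuous.subtype_mk (continuous_pi fun j =>
      BadPoset.continuous_of_map continuous_id (R j) (fun _ s => s)
        (fun s _ => continuous_const) fun w y => by simp) _
    refine ⟨fun z => FiberwiseOpenCone.ofCoords (c z.1) (a z.2),
      FiberwiseOpenCone.continuous_ofCoords.comp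
        ((hc.comp continuous_fst).prodMk (ha.comp continuous_snd)), fun z => ⟨?_, ?_⟩⟩
    · rw [FiberwiseOpenCone.base_ofCoords]
    · funext s
      obtain ⟨i, rfl⟩ := σ.surjective s
      rw [depth_weight_ofCoords, ← htel]

variable [DiscreteTopology ι]

omit hbad in
theorem continuous_base_depth_weight : Continuous
    fun x : FiberwiseOpenCone (ClassifyingSpace.base (bad := bad)) =>
      (x.base, depth x.weight) := by
  classical
  suffices h : Continuous fun x : Unit × FiberwiseOpenCone (ClassifyingSpace.base (bad := bad)) =>
      (x.2.base, depth x.2.weight) from h.comp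
      (Continuous.prodMk (continuous_const (y := ())) continuous_id)
  apply FiberwiseOpenCone.continuous_prod_of
  · refine continuous_snd.prodMk (continuous_pi fun s => ?_)
    simpa [depth, FiberwiseOpenCone.weight_vertex] using continuous_const
  · intro n
    have hv : ∀ j, Continuous fun x : Unit × (NerveSpace (BadPoset bad) n × openFaceSimplex n) =>
        x.2.1.1 j := fun j => (continuous_apply j).comp
      (continuous_subtype_val.comp (continuous_fst.comp continuous_snd))
    refine Continuous.prodMk ?_ (continuous_pi fun s => ?_)
    · simp only [FiberwiseOpenCone.base_ofCoords]
      exact BadPoset.continuous_fst.comp (hv 0)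
    · simp only [depth_weight_ofCoords]
      refine continuous_finsetSum _ fun j _ => ?_
      have hclopen : IsClopen {x : Unit × (NerveSpace (BadPoset bad) n × openFaceSimplex n) |
          s ∈ (x.2.1.1 j).1.2} := by
        refine ⟨isOpen_compl_iff.1 ?_, ?_⟩
        · convert (BadPoset.isOpen_subset (bad := bad) (isOpen_discrete {s}ᶜ)).preimage (hv j)
            using 1
          ext x
          simp only [Set.mem_compl_iff, Set.mem_ofPred_eq, Set.mem_preimage, Set.mem_singleton_iff]
          exact ⟨fun h y hy hys => h (hys ▸ hy), fun h hs => h s hs rfl⟩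
        · convert (BadPoset.isOpen_hit (bad := bad) (isOpen_discrete {s})).preimage (hv j) using 1
          ext x
          simp
      refine Continuous.if (fun x hx => ?_) continuous_const
        ((continuous_apply j).comp (continuous_subtype_val.comp
          (continuous_snd.comp continuous_snd)))
      rw [hclopen.frontier_eq] at hx
      exact hx.elim

/-- The fiberwise open cone on the posets of all proper nonempty subsets of a finite set is
trivial with fiber a Euclidean space. -/
theorem nonempty_homeomorph_fullCone {n : ℕ} (e : Fin (n + 1) ≃ ι) :
    Nonempty (FiberwiseOpenCone (ClassifyingSpace.base (bad := bad)) ≃ₜ Y × (Fin n → ℝ)) := by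
  classical
  have : Nonempty ι := ⟨e 0⟩
  have hmem := depth_weight_mem_depthFunctions hbad
  have hsort : ∀ d : depthFunctions ι, ∃ σ : Fin (n + 1) ≃ ι, Monotone (d.1 ∘ σ) := fun d =>
    ⟨(Tuple.sort (d.1 ∘ e)).trans e, Tuple.monotone_sort (d.1 ∘ e)⟩
  choose G hGc hG using fun σ : Fin (n + 1) ≃ ι => exists_section_of_monotone hbad σ
  have hex : ∀ z : Y × depthFunctions ι,
      ∃ x : FiberwiseOpenCone (ClassifyingSpace.base (bad := bad)),
        x.base = z.1 ∧ depth x.weight = z.2.1 := fun z => by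
    obtain ⟨σ, hσ⟩ := hsort z.2
    exact ⟨_, hG σ (z.1, ⟨z.2, hσ⟩)⟩
  choose g hg using hex
  -- The orderings `σ` divide the depth functions into finitely many closed sets. The continuous
  -- sections over these agree with `g`, since base and depth determine a point.
  have hgc : Continuous g := by
    have hfin : Finite (Fin (n + 1) ≃ ι) := inferInstance
    refine LocallyFinite.continuous (g := g) (f := fun σ : Fin (n + 1) ≃ ι =>
      {z : Y × depthFunctions ι | Monotone (z.2.1 ∘ σ)}) (locallyFinite_of_finite _) ?_ ?_ ?_
    · refine Set.eq_univ_of_forall fun z => ?_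
      obtain ⟨σ, hσ⟩ := hsort z.2
      exact Set.mem_iUnion.2 ⟨σ, hσ⟩
    · intro σ
      have hs : ∀ s, Continuous fun z : Y × depthFunctions ι => z.2.1 s := fun s =>
        (continuous_apply s).comp (continuous_subtype_val.comp continuous_snd)
      have : {z : Y × depthFunctions ι | Monotone (z.2.1 ∘ σ)} =
          ⋂ i, ⋂ j, ⋂ _ : i ≤ j, {z | z.2.1 (σ i) ≤ z.2.1 (σ j)} := by
        ext z
        simp only [Set.mem_ofPred_eq, Set.mem_iInter]
        rfl
      rw [this]
      exact isClosed_iInter fun i => isClosed_iInter fun j => isClosed_iInter fun _ =>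
        isClosed_le (hs _) (hs _)
    · intro σ
      refine continuousOn_iff_continuous_domRestrict.2 ?_
      have hc : Continuous fun z : {z : Y × depthFunctions ι | Monotone (z.2.1 ∘ σ)} =>
          G σ (z.1.1, ⟨z.1.2, z.2⟩) := (hGc σ).comp
        ((continuous_fst.comp continuous_subtype_val).prodMk
          ((continuous_snd.comp continuous_subtype_val).subtype_mk _))
      refine hc.congr fun z => ?_
      have h1 := hG σ (z.1.1, ⟨z.1.2, z.2⟩)
      have h2 := hg z.1
      exact ext_base_depth hbad (h1.1.trans h2.1.symm) (h1.2.trans h2.2.symm)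
  have hF := continuous_base_depth_weight (bad := bad)
  let f : FiberwiseOpenCone (ClassifyingSpace.base (bad := bad)) ≃ₜ Y × depthFunctions ι :=
    { toFun := fun x => (x.base, ⟨depth x.weight, hmem x⟩)
      invFun := g
      left_inv := fun x => ext_base_depth hbad (hg _).1 (hg _).2
      right_inv := fun z => Prod.ext (hg z).1 (Subtype.ext (hg z).2)
      continuous_toFun := (continuous_fst.comp hF).prodMk
        ((continuous_snd.comp hF).subtype_mk _)
      continuous_invFun := hgc }
  exact ⟨f.trans ((Homeomorph.refl Y).prodCongr (depthFunctionsHomeomorph e))⟩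

end FullCone

/-! ## Taylor polynomials and changes of coordinates -/

section Symmetric

variable {E F : Type*} [NormedAddCommGroup E] [NormedSpace ℝ E] [NormedAddCommGroup F]
  [NormedSpace ℝ F]

theorem differentiableAt_iteratedFDeriv {f : E → F} {x : E} {N n : ℕ} (hf : ContDiffAt ℝ N f x)
    (hn : n < N) : DifferentiableAt ℝ (iteratedFDeriv ℝ n f) x :=
  (hf.iteratedFDeriv_right (m := 1) (by exact_mod_cast (by omega : 1 + n ≤ N))).differentiableAt
    one_ne_zero

/-- For the first two arguments this is symmetry of the second derivative of a lower iterated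
derivative. Any other adjacent transposition leaves the first argument alone and acts within a
derivative of lower order, whose symmetry holds at all nearby points and can be differentiated. -/
theorem iteratedFDeriv_comp_swap {f : E → F} {N : ℕ} {n : ℕ} (hn : n < N) (i : Fin n) {x : E}
    (hf : ContDiffAt ℝ N f x) (v : Fin (n + 1) → E) :
    iteratedFDeriv ℝ (n + 1) f x (v ∘ Equiv.swap i.castSucc i.succ) =
      iteratedFDeriv ℝ (n + 1) f x v := by
  induction n generalizing x with
  | zero => exact i.elim0
  | succ n ih =>
    have hd : ∀ {y}, ContDiffAt ℝ N f y → ∀ w : Fin (n + 2) → E,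
        iteratedFDeriv ℝ (n + 2) f y w =
          fderiv ℝ (fun z => iteratedFDeriv ℝ (n + 1) f z (Fin.tail w)) y (w 0) := by
      intro y hy w
      exact (differentiableAt_iteratedFDeriv hy hn).iteratedFDeriv_succ_apply_left'
    induction i using Fin.cases with
    | zero =>
      have hs : IsSymmSndFDerivAt ℝ (iteratedFDeriv ℝ n f) x :=
        ContDiffAt.isSymmSndFDerivAt (n := 2) (hf.iteratedFDeriv_right
          (by exact_mod_cast (by omega : 2 + n ≤ N))) (by simp)
      have h2 : ∀ w : Fin (n + 2) → E, iteratedFDeriv ℝ (n + 2) f x w =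
          fderiv ℝ (fderiv ℝ (iteratedFDeriv ℝ n f)) x (w 0) (w 1) (Fin.tail (Fin.tail w)) := by
        intro w
        rw [hd hf]
        have hev : (fun z => iteratedFDeriv ℝ (n + 1) f z (Fin.tail w)) = fun z =>
            (fderiv ℝ (iteratedFDeriv ℝ n f) z (w 1)) (Fin.tail (Fin.tail w)) := by
          funext z
          exact iteratedFDeriv_succ_apply_left _
        rw [hev]
        have hd2 : DifferentiableAt ℝ (fderiv ℝ (iteratedFDeriv ℝ n f)) x :=
          ((hf.iteratedFDeriv_right (m := 2) (by exact_mod_cast (by omega : 2 + n ≤ N))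
            ).fderiv_right (m := 1) (by norm_num)).differentiableAt one_ne_zero
        rw [fderiv_continuousMultilinear_apply_const_apply
          (hd2.clm_apply (differentiableAt_const _)),
          fderiv_clm_apply hd2 (differentiableAt_const _)]
        simp
      rw [h2, h2, hs.eq]
      congr 1
    | succ k =>
      rw [hd hf, hd hf]
      have h0 : (v ∘ Equiv.swap k.succ.castSucc k.succ.succ) 0 = v 0 := by
        rw [Function.comp_apply, Equiv.swap_apply_of_ne_of_ne]
        · rw [Fin.castSucc_succ]
          exact (Fin.succ_ne_zero _).symm
        · exact (Fin.succ_ne_zero _).symm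
      have htail : Fin.tail (v ∘ Equiv.swap k.succ.castSucc k.succ.succ) =
          Fin.tail v ∘ Equiv.swap k.castSucc k.succ := by
        funext j
        simp only [Fin.tail, Function.comp_apply, Fin.castSucc_succ]
        rw [(Fin.succ_injective _).swap_apply]
      rw [h0, htail]
      congr 1
      refine Filter.EventuallyEq.fderiv_eq ?_
      filter_upwards [hf.eventually (by simp)] with y hy
      exact ih (by omega) k hy _

/-- Iterated derivatives of smooth maps are symmetric. -/
theorem iteratedFDeriv_comp_perm_of_contDiffAt {f : E → F} {n : ℕ} {x : E}
    (hf : ContDiffAt ℝ n f x) (v : Fin n → E) (σ : Equiv.Perm (Fin n)) :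
    iteratedFDeriv ℝ n f x (v ∘ σ) = iteratedFDeriv ℝ n f x v := by
  rcases n with _ | n
  · congr 1
    exact Subsingleton.elim _ _
  · have hσ : σ ∈ Submonoid.closure
        (Set.range fun i : Fin n => Equiv.swap i.castSucc i.succ) := by
      rw [Equiv.Perm.mclosure_swap_castSucc_succ]
      trivial
    induction hσ using Submonoid.closure_induction generalizing v with
    | mem σ hσ =>
      obtain ⟨i, rfl⟩ := hσ
      exact iteratedFDeriv_comp_swap (Nat.lt_succ_self n) i hf v
    | one => rfl
    | mul σ τ _ _ hσ hτ =>
      rw [Equiv.Perm.coe_mul, ← Function.comp_assoc, hτ, hσ]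

end Symmetric

section Taylor

variable {E F G : Type*} [NormedAddCommGroup E] [NormedSpace ℝ E] [NormedAddCommGroup F]
  [NormedSpace ℝ F] [NormedAddCommGroup G] [NormedSpace ℝ G]

theorem PolyMap.contDiff {r : ℕ} {g : E → F} (hg : g ∈ PolyMap E F r) {n : WithTop ℕ∞} :
    ContDiff ℝ n g := by
  obtain ⟨c, hc⟩ := hg
  rw [show g = _ from funext hc]
  exact ContDiff.sum fun m _ => (c m).contDiff.comp (contDiff_pi.2 fun _ => contDiff_id)

theorem taylorPoly_apply (r : ℕ) (s : Set E) (g : E → F) (x₀ x : E) :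
    (taylorPoly r s g x₀ : E → F) x = ∑ m ∈ Finset.range (r + 1),
      ((m.factorial : ℝ)⁻¹ • iteratedFDerivWithin ℝ m g s x₀) (fun _ => x) :=
  rfl

theorem taylorPoly_congr {r : ℕ} {f g : E → F} {x y : E}
    (h : ∀ m ≤ r, iteratedFDeriv ℝ m f x = iteratedFDeriv ℝ m g y) :
    taylorPoly r Set.univ f x = taylorPoly r Set.univ g y := by
  refine Subtype.ext (funext fun z => ?_)
  rw [taylorPoly_apply, taylorPoly_apply]
  refine Finset.sum_congr rfl fun m hm => ?_
  rw [iteratedFDerivWithin_univ, iteratedFDerivWithin_univ,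
    h m (Nat.lt_succ_iff.1 (Finset.mem_range.1 hm))]

theorem taylorPoly_eq_of_mem_nhds {r : ℕ} {f : E → F} {x : E} {s : Set E} (hs : s ∈ 𝓝 x) :
    taylorPoly r s f x = taylorPoly r Set.univ f x := by
  refine Subtype.ext (funext fun z => ?_)
  rw [taylorPoly_apply, taylorPoly_apply]
  refine Finset.sum_congr rfl fun m _ => ?_
  rw [iteratedFDerivWithin_congr_set (Filter.eventuallyEq_univ.2 hs)]

theorem Filter.EventuallyEq.taylorPoly_eq {r : ℕ} {f g : E → F} {x : E} (h : f =ᶠ[𝓝 x] g) :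
    taylorPoly r Set.univ f x = taylorPoly r Set.univ g x :=
  taylorPoly_congr fun m _ => (h.iteratedFDeriv ℝ m).eq_of_nhds

/-- A map and its Taylor polynomial have the same derivatives. -/
theorem iteratedFDeriv_taylorPoly [CompleteSpace F] {f : E → F} {x : E} {r m : ℕ}
    (hf : ContDiffAt ℝ r f x) (hm : m ≤ r) :
    iteratedFDeriv ℝ m (taylorPoly r Set.univ f x : E → F) 0 = iteratedFDeriv ℝ m f x := by
  let c : FormalMultilinearSeries ℝ E F := fun m =>
    if m < r + 1 then (m.factorial : ℝ)⁻¹ • iteratedFDeriv ℝ m f x else 0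
  have hc : HasFiniteFPowerSeriesOnBall (taylorPoly r Set.univ f x : E → F) c 0 (r + 1) ⊤ := by
    refine HasFiniteFPowerSeriesOnBall.mk' (fun m hm => if_neg (by omega)) (by simp) fun y _ => ?_
    rw [zero_add]
    refine Finset.sum_congr rfl fun m hm => ?_
    simp only [c, if_pos (Finset.mem_range.1 hm), iteratedFDerivWithin_univ]
  ext v
  rw [hc.toHasFPowerSeriesOnBall.iteratedFDeriv_eq_sum_of_completeSpace]
  -- The derivative of a power series at its center is the sum of a coefficient over all
  -- permutations of its arguments. By symmetry of the derivative of `f` the `m!` terms are equal,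
  -- which cancels the factor `1 / m!`.
  have h : ∀ σ : Equiv.Perm (Fin m), c m (fun i => v (σ i)) =
      (m.factorial : ℝ)⁻¹ • iteratedFDeriv ℝ m f x v := fun σ => by
    simp only [c, if_pos (Nat.lt_succ_iff.2 hm)]
    rw [← iteratedFDeriv_comp_perm_of_contDiffAt (hf.of_le (by exact_mod_cast hm)) v σ]
    rfl
  rw [Finset.sum_congr rfl fun σ _ => h σ, Finset.sum_const, Finset.card_univ, Fintype.card_perm,
    Fintype.card_fin, ← Nat.cast_smul_eq_nsmul ℝ, smul_smul,
    mul_inv_cancel₀ (by exact_mod_cast m.factorial_ne_zero), one_smul]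

/-- The derivatives of order `≤ r` of a composition depend only on those of the factors. -/
theorem taylorPoly_comp_congr {r : ℕ} {f f' : E → F} {g g' : F → G} {x x' : E}
    (hf : ContDiffAt ℝ r f x) (hf' : ContDiffAt ℝ r f' x') (hg : ContDiffAt ℝ r g (f x))
    (hg' : ContDiffAt ℝ r g' (f' x'))
    (hff : ∀ m ≤ r, iteratedFDeriv ℝ m f x = iteratedFDeriv ℝ m f' x')
    (hgg : ∀ m ≤ r, iteratedFDeriv ℝ m g (f x) = iteratedFDeriv ℝ m g' (f' x')) :
    taylorPoly r Set.univ (g ∘ f) x = taylorPoly r Set.univ (g' ∘ f') x' := by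
  refine taylorPoly_congr fun m hm => ?_
  rw [iteratedFDeriv_comp hg hf (by exact_mod_cast hm),
    iteratedFDeriv_comp hg' hf' (by exact_mod_cast hm)]
  refine Finset.sum_congr rfl fun c _ => ?_
  ext v
  change iteratedFDeriv ℝ c.length g (f x) _ = iteratedFDeriv ℝ c.length g' (f' x') _
  rw [hgg _ (c.length_le.trans hm)]
  congr 1
  funext j
  change iteratedFDeriv ℝ (c.partSize j) f x _ = iteratedFDeriv ℝ (c.partSize j) f' x' _
  rw [hff _ ((c.partSize_le j).trans hm)]

end Taylor

/-- A change of coordinates acts on Taylor polynomials through the group of coordinate changes. -/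
theorem exists_isCoordChange_taylorPoly_comp {ℓ : ℕ} (k r : ℕ)
    {τ : EuclideanSpace ℝ (Fin ℓ) → EuclideanSpace ℝ (Fin ℓ)} {a : EuclideanSpace ℝ (Fin ℓ)}
    (hτ : ContDiffAt ℝ ∞ τ a) (hbij : Function.Bijective (fderiv ℝ τ a)) :
    ∃ q, IsCoordChange q ∧ ∀ g : EuclideanSpace ℝ (Fin ℓ) → EuclideanSpace ℝ (Fin k),
      ContDiffAt ℝ ∞ g (τ a) →
        taylorPoly r Set.univ (g ∘ τ) a =
          precompTrunc q (taylorPoly r Set.univ g (τ a)) := by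
  let τ₀ : EuclideanSpace ℝ (Fin ℓ) → EuclideanSpace ℝ (Fin ℓ) := fun x => τ x - τ a
  have hτ₀ : ContDiffAt ℝ ∞ τ₀ a := hτ.sub contDiffAt_const
  -- Degree `r + 1` instead of `r` ensures that `q` has the same first derivative as `τ`, and so is
  -- invertible, even when `r = 0`.
  let q := taylorPoly (r + 1) Set.univ τ₀ a
  have hq : ∀ m ≤ r + 1, iteratedFDeriv ℝ m q.1 0 = iteratedFDeriv ℝ m τ₀ a := fun m hm =>
    iteratedFDeriv_taylorPoly (hτ₀.of_le (by exact_mod_cast le_top)) hm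
  have hq0 : q.1 0 = 0 := by
    have h := congr($(hq 0 (Nat.zero_le _)) 0)
    rw [iteratedFDeriv_zero_apply, iteratedFDeriv_zero_apply] at h
    rw [h]
    exact sub_self _
  have hq1 : fderiv ℝ q.1 0 = fderiv ℝ τ a := by
    ext1 v
    have h := congr($(hq 1 (by omega)) fun _ => v)
    rw [iteratedFDeriv_one_apply, iteratedFDeriv_one_apply] at h
    rw [h]
    exact congr($(fderiv_sub_const (𝕜 := ℝ) (f := τ) (x := a) (τ a)) v)
  refine ⟨q.1, ⟨⟨_, q.2⟩, hq0, by rwa [hq1]⟩, fun g hg => ?_⟩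
  have hcomp : g ∘ τ = (fun z => g (τ a + z)) ∘ τ₀ := by
    funext x
    simp [τ₀]
  have hr : (r : WithTop ℕ∞) ≤ ∞ := by exact_mod_cast le_top
  have h0 : τ₀ a = 0 := sub_self _
  have hg' : ContDiffAt ℝ r (fun z => g (τ a + z)) (τ₀ a) := by
    rw [h0]
    refine ContDiffAt.comp (g := g) (f := fun z => τ a + z) 0 ?_ (by fun_prop)
    simpa using hg.of_le hr
  rw [hcomp]
  refine taylorPoly_comp_congr (hτ₀.of_le hr) (PolyMap.contDiff q.2).contDiffAt hg'
    (PolyMap.contDiff (taylorPoly r Set.univ g (τ a)).2).contDiffAt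
    (fun m hm => (hq m (by omega)).symm) fun m hm => ?_
  rw [hq0, h0, iteratedFDeriv_taylorPoly (hg.of_le hr) hm, iteratedFDeriv_comp_add_left, add_zero]

/-! ## Jets in a fixed chart -/

section ChartJet

variable {ℓ k : ℕ} {H : Type v} [TopologicalSpace H]
  (I : ModelWithCorners ℝ (EuclideanSpace ℝ (Fin ℓ)) H)
  {L : Type u} [TopologicalSpace L] [ChartedSpace H L]

/-- The points in the domain of the chart at `s` which are interior points in this chart. -/
def interiorChartDomain (s : L) : Set L :=
  (extChartAt I s).source ∩ extChartAt I s ⁻¹' interior (extChartAt I s).target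

theorem isOpen_interiorChartDomain (s : L) : IsOpen (interiorChartDomain I s) :=
  (continuousOn_extChartAt s).isOpen_inter_preimage (isOpen_extChartAt_source s) isOpen_interior

theorem mem_interiorChartDomain_self {s : L} (hs : s ∈ I.interior L) :
    s ∈ interiorChartDomain I s :=
  ⟨mem_extChartAt_source s, ModelWithCorners.isInteriorPoint_iff.1 hs⟩

variable {I}

theorem extChartAt_target_mem_nhds_of_mem_interiorChartDomain {s x : L}
    (hx : x ∈ interiorChartDomain I s) : (extChartAt I s).target ∈ 𝓝 (extChartAt I s x) :=
  mem_interior_iff_mem_nhds.1 hx.2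

/-- The `r`-jet of `f` at `x` in the chart at `s`. -/
noncomputable def chartJet (r : ℕ) (f : SmoothMap k I L) (s x : L) : JetSpace ℓ k r :=
  taylorPoly r Set.univ (f ∘ (extChartAt I s).symm) (extChartAt I s x)

/-- At an interior point the range of the model is a neighborhood, so derivatives within it are
ordinary ones. -/
theorem jetAt_eq_chartJet (r : ℕ) (f : SmoothMap k I L) {x : L} (hx : x ∈ I.interior L) :
    jetAt r f x = chartJet r f x x :=
  taylorPoly_eq_of_mem_nhds (mem_interior_iff_mem_nhds.1 hx)

section Transition

variable {s s' x : L}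

theorem extChartAt_comp_symm_comp_eventuallyEq (hs : x ∈ interiorChartDomain I s)
    (hs' : x ∈ interiorChartDomain I s') {Z : Type*} (f : L → Z) :
    (f ∘ (extChartAt I s').symm) ∘ (extChartAt I s' ∘ (extChartAt I s).symm)
      =ᶠ[𝓝 (extChartAt I s x)] f ∘ (extChartAt I s).symm := by
  have hc : ContinuousAt (extChartAt I s).symm (extChartAt I s x) :=
    continuousAt_extChartAt_symm'' ((extChartAt I s).map_source hs.1)
  have hsrc : ∀ᶠ y in 𝓝 (extChartAt I s x), (extChartAt I s).symm y ∈ (extChartAt I s').source := by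
    refine hc.eventually_mem ((isOpen_extChartAt_source s').mem_nhds ?_)
    rw [(extChartAt I s).left_inv hs.1]
    exact hs'.1
  filter_upwards [hsrc] with y hy
  simp only [Function.comp_apply]
  rw [(extChartAt I s').left_inv hy]

variable [IsManifold I ∞ L]

theorem contDiffAt_comp_extChartAt_symm (hx : x ∈ interiorChartDomain I s)
    (f : SmoothMap k I L) : ContDiffAt ℝ ∞ (f ∘ (extChartAt I s).symm) (extChartAt I s x) :=
  ((f.contMDiff.comp_contMDiffOn (contMDiffOn_extChartAt_symm s)).contDiffOn _
    ((extChartAt I s).map_source hx.1)).contDiffAt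
    (extChartAt_target_mem_nhds_of_mem_interiorChartDomain hx)

theorem contDiffAt_transition (hs : x ∈ interiorChartDomain I s)
    (hs' : x ∈ interiorChartDomain I s') :
    ContDiffAt ℝ ∞ (extChartAt I s' ∘ (extChartAt I s).symm) (extChartAt I s x) := by
  refine (contDiffWithinAt_ext_coord_change (I := I) s' s ?_).contDiffAt
    (Filter.mem_of_superset (extChartAt_target_mem_nhds_of_mem_interiorChartDomain hs)
      (extChartAt_target_subset_range s))
  refine ⟨(extChartAt I s).map_source hs.1, ?_⟩
  change (extChartAt I s).symm (extChartAt I s x) ∈ (extChartAt I s').source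
  rw [(extChartAt I s).left_inv hs.1]
  exact hs'.1

/-- By the chain rule the reverse transition provides a left inverse of the derivative, which
suffices in finite dimension. -/
theorem bijective_fderiv_transition (hs : x ∈ interiorChartDomain I s)
    (hs' : x ∈ interiorChartDomain I s') :
    Function.Bijective
      (fderiv ℝ (extChartAt I s' ∘ (extChartAt I s).symm) (extChartAt I s x)) := by
  have hτx : (extChartAt I s' ∘ (extChartAt I s).symm) (extChartAt I s x) = extChartAt I s' x := by
    rw [Function.comp_apply, (extChartAt I s).left_inv hs.1]
  have hτ := (contDiffAt_transition hs hs').differentiableAt (by simp)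
  have hτ' := (contDiffAt_transition hs' hs).differentiableAt (by simp)
  have hid : (extChartAt I s ∘ (extChartAt I s').symm) ∘ (extChartAt I s' ∘ (extChartAt I s).symm)
      =ᶠ[𝓝 (extChartAt I s x)] id := by
    refine (extChartAt_comp_symm_comp_eventuallyEq hs hs' (extChartAt I s)).trans ?_
    filter_upwards [extChartAt_target_mem_nhds_of_mem_interiorChartDomain hs] with y hy
    exact (extChartAt I s).right_inv hy
  have h := hid.fderiv_eq (𝕜 := ℝ)
  rw [← hτx] at hτ'
  rw [fderiv_comp _ hτ' hτ, fderiv_id] at h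
  have hinj : Function.Injective
      (fderiv ℝ (extChartAt I s' ∘ (extChartAt I s).symm) (extChartAt I s x)) := fun v w hvw => by
    have hv := congr($h v)
    have hw := congr($h w)
    simp only [ContinuousLinearMap.comp_apply, ContinuousLinearMap.id_apply] at hv hw
    rw [← hv, ← hw, hvw]
  exact ⟨hinj, (LinearMap.injective_iff_surjective
    (f := (fderiv ℝ (extChartAt I s' ∘ (extChartAt I s).symm) (extChartAt I s x)).toLinearMap)).1
    hinj⟩

/-- Jets in different charts differ by a change of coordinates. -/
theorem exists_isCoordChange_chartJet (k r : ℕ) (hs : x ∈ interiorChartDomain I s)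
    (hs' : x ∈ interiorChartDomain I s') :
    ∃ q, IsCoordChange q ∧ ∀ f : SmoothMap k I L,
      chartJet r f s x = precompTrunc q (chartJet r f s' x) := by
  obtain ⟨q, hq, h⟩ := exists_isCoordChange_taylorPoly_comp k r (contDiffAt_transition hs hs')
    (bijective_fderiv_transition hs hs')
  have hτx : (extChartAt I s' ∘ (extChartAt I s).symm) (extChartAt I s x) = extChartAt I s' x := by
    rw [Function.comp_apply, (extChartAt I s).left_inv hs.1]
  rw [hτx] at h
  refine ⟨q, hq, fun f => ?_⟩
  rw [chartJet, chartJet, ← h _ (contDiffAt_comp_extChartAt_symm hs' f)]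
  exact (extChartAt_comp_symm_comp_eventuallyEq hs hs' f).symm.taylorPoly_eq

/-- This is the reason for fixing the chart: `jetAt` uses the preferred chart at each point, which
may change discontinuously with the point. Jets carry the topology of pointwise convergence, so
their values at each `z` are considered. -/
theorem continuousOn_chartJet (r : ℕ) (f : SmoothMap k I L) (s : L) :
    ContinuousOn (chartJet r f s) (interiorChartDomain I s) := by
  refine Topology.IsInducing.subtypeVal.continuousOn_iff.2 (continuousOn_pi.2 fun z => ?_)
  change ContinuousOn (fun x => (taylorPoly r Set.univ (f ∘ (extChartAt I s).symm)
    (extChartAt I s x) : EuclideanSpace ℝ (Fin ℓ) → EuclideanSpace ℝ (Fin k)) z) _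
  simp only [taylorPoly_apply, iteratedFDerivWithin_univ]
  refine continuousOn_finsetSum _ fun m _ => ?_
  intro x hx
  refine ContinuousAt.continuousWithinAt ?_
  have h1 : ContinuousAt (iteratedFDeriv ℝ m (f ∘ (extChartAt I s).symm)) (extChartAt I s x) :=
    ((contDiffAt_comp_extChartAt_symm hx f).iteratedFDeriv_right (m := 0) (i := m)
      (by rw [zero_add]; exact_mod_cast le_top)).continuousAt
  have h2 : ContinuousAt (fun x => iteratedFDeriv ℝ m (f ∘ (extChartAt I s).symm)
      (extChartAt I s x)) x :=
    ContinuousAt.comp (g := iteratedFDeriv ℝ m (f ∘ (extChartAt I s).symm)) h1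
      (continuousAt_extChartAt' hx.1)
  have h3 := ((ContinuousMultilinearMap.apply ℝ (fun _ : Fin m => EuclideanSpace ℝ (Fin ℓ))
    (EuclideanSpace ℝ (Fin k)) fun _ => z).continuous.continuousAt).comp h2
  exact h3.const_smul (m.factorial : ℝ)⁻¹

theorem chartJet_add (r : ℕ) (hx : x ∈ interiorChartDomain I s) (f g : SmoothMap k I L) :
    chartJet r (f + g) s x = chartJet r f s x + chartJet r g s x := by
  have hr : ∀ m : ℕ, (m : WithTop ℕ∞) ≤ ∞ := fun m => by exact_mod_cast le_top
  refine Subtype.ext (funext fun z => ?_)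
  change (chartJet r (f + g) s x).1 z = (chartJet r f s x).1 z + (chartJet r g s x).1 z
  simp only [chartJet]
  rw [taylorPoly_apply, taylorPoly_apply, taylorPoly_apply, ← Finset.sum_add_distrib]
  refine Finset.sum_congr rfl fun m _ => ?_
  simp only [iteratedFDerivWithin_univ]
  rw [show (f + g : SmoothMap k I L) ∘ (extChartAt I s).symm =
    f ∘ (extChartAt I s).symm + g ∘ (extChartAt I s).symm from rfl,
    iteratedFDeriv_add_apply ((contDiffAt_comp_extChartAt_symm hx f).of_le (hr m))
      ((contDiffAt_comp_extChartAt_symm hx g).of_le (hr m)), smul_add]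
  rfl

theorem chartJet_smul (r : ℕ) (hx : x ∈ interiorChartDomain I s) (a : ℝ) (f : SmoothMap k I L) :
    chartJet r (a • f) s x = a • chartJet r f s x := by
  have hr : ∀ m : ℕ, (m : WithTop ℕ∞) ≤ ∞ := fun m => by exact_mod_cast le_top
  refine Subtype.ext (funext fun z => ?_)
  change (chartJet r (a • f) s x).1 z = a • (chartJet r f s x).1 z
  simp only [chartJet]
  rw [taylorPoly_apply, taylorPoly_apply, Finset.smul_sum]
  refine Finset.sum_congr rfl fun m _ => ?_
  simp only [iteratedFDerivWithin_univ]
  rw [show (a • f : SmoothMap k I L) ∘ (extChartAt I s).symm =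
    a • (f ∘ (extChartAt I s).symm) from rfl,
    iteratedFDeriv_const_smul_apply ((contDiffAt_comp_extChartAt_symm hx f).of_le (hr m)),
    smul_comm]
  rfl

/-- The `r`-jet at `x` in the chart at `s`, as a linear map. -/
noncomputable def chartJetLinear (k r : ℕ) (hx : x ∈ interiorChartDomain I s) :
    SmoothMap k I L →ₗ[ℝ] JetSpace ℓ k r where
  toFun f := chartJet r f s x
  map_add' := chartJet_add r hx
  map_smul' := chartJet_smul r hx

end Transition

end ChartJet

/-! ## The Whitney topology is a Hausdorff vector space topology -/

section Whitney

variable {ℓ k : ℕ} {H : Type v} [TopologicalSpace H]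
  {I : ModelWithCorners ℝ (EuclideanSpace ℝ (Fin ℓ)) H}
  {L : Type u} [TopologicalSpace L] [ChartedSpace H L] [IsManifold I ∞ L]

theorem contDiffOn_comp_extChartAt_symm (f : SmoothMap k I L) (x : L) :
    ContDiffOn ℝ ∞ (f ∘ (extChartAt I x).symm) (extChartAt I x).target :=
  (f.contMDiff.comp_contMDiffOn (contMDiffOn_extChartAt_symm x)).contDiffOn

theorem contDiffWithinAt_range_comp_extChartAt_symm (f : SmoothMap k I L) (x : L)
    {y : EuclideanSpace ℝ (Fin ℓ)} (hy : y ∈ (extChartAt I x).target) (m : ℕ) :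
    ContDiffWithinAt ℝ m (f ∘ (extChartAt I x).symm) (Set.range I) y :=
  ((contDiffOn_comp_extChartAt_symm f x y hy).mono_of_mem_nhdsWithin
    (extChartAt_target_mem_nhdsWithin_of_mem hy)).of_le (by exact_mod_cast le_top)

theorem continuousOn_iteratedFDerivWithin_comp_extChartAt_symm (f : SmoothMap k I L) (x : L)
    (m : ℕ) : ContinuousOn (iteratedFDerivWithin ℝ m (f ∘ (extChartAt I x).symm) (Set.range I))
      (extChartAt I x).target := by
  refine ((contDiffOn_comp_extChartAt_symm f x).continuousOn_iteratedFDerivWithin (m := m)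
    (by exact_mod_cast le_top) (uniqueDiffOn_extChartAt_target x)).congr fun y hy => ?_
  exact (iteratedFDerivWithin_congr_set (nhdsWithin_eq_iff_eventuallyEq.1
    (nhdsWithin_extChartAt_target_eq_of_mem hy)) m).symm

/-- The `m`-th derivative on a subset of the chart at `x`, as a linear map. -/
noncomputable def chartDeriv (k : ℕ) (x : L) (m : ℕ) {K : Set (EuclideanSpace ℝ (Fin ℓ))}
    (hK : K ⊆ (extChartAt I x).target) :
    SmoothMap k I L →ₗ[ℝ]
      (K → EuclideanSpace ℝ (Fin ℓ) [×m]→L[ℝ] EuclideanSpace ℝ (Fin k)) where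
  toFun f y := iteratedFDerivWithin ℝ m (f ∘ (extChartAt I x).symm) (Set.range I) y
  map_add' f g := funext fun y => iteratedFDerivWithin_add_apply
    (contDiffWithinAt_range_comp_extChartAt_symm f x (hK y.2) m)
    (contDiffWithinAt_range_comp_extChartAt_symm g x (hK y.2) m) I.uniqueDiffOn
    (extChartAt_target_subset_range x (hK y.2))
  map_smul' _ f := funext fun y => iteratedFDerivWithin_const_smul_apply
    (contDiffWithinAt_range_comp_extChartAt_symm f x (hK y.2) m) I.uniqueDiffOn
    (extChartAt_target_subset_range x (hK y.2))

/-- The same map, to the space of functions with the topology of uniform convergence. -/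
noncomputable def chartDerivUniform (k : ℕ) (x : L) (m : ℕ) {K : Set (EuclideanSpace ℝ (Fin ℓ))}
    (hK : K ⊆ (extChartAt I x).target) :
    SmoothMap k I L →ₗ[ℝ]
      UniformFun K (EuclideanSpace ℝ (Fin ℓ) [×m]→L[ℝ] EuclideanSpace ℝ (Fin k)) where
  toFun f := UniformFun.ofFun (chartDeriv k x m hK f)
  map_add' f g := congrArg UniformFun.ofFun ((chartDeriv k x m hK).map_add f g)
  map_smul' a f := congrArg UniformFun.ofFun ((chartDeriv k x m hK).map_smul a f)

/-- In this form the topology is induced by linear maps, so it is compatible with the vector space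
structure. As it is also Hausdorff, finite dimensional spaces of smooth maps have their Euclidean
topology, as required by `exists_homeomorph_of_bijective`. -/
theorem whitneyTopology_eq : (whitneyTopology : TopologicalSpace (SmoothMap k I L)) =
    ⨅ (x : L) (m : ℕ) (K : Set (EuclideanSpace ℝ (Fin ℓ)))
      (hK : IsCompact K ∧ K ⊆ (extChartAt I x).target),
      TopologicalSpace.induced (chartDerivUniform k x m hK.2) inferInstance := by
  refine iInf_congr fun x => iInf_congr fun m => ?_
  simp only [UniformOnFun.topologicalSpace_eq, induced_iInf, induced_compose]
  rfl

instance : IsTopologicalAddGroup (SmoothMap k I L) := by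
  rw [whitneyTopology_eq]
  exact topologicalAddGroup_iInf fun x => topologicalAddGroup_iInf fun m =>
    topologicalAddGroup_iInf fun K => topologicalAddGroup_iInf fun hK =>
      topologicalAddGroup_induced (chartDerivUniform k x m hK.2)

/-- For uniform convergence, scalar multiplication is continuous only on functions of bounded range.
The derivatives considered are continuous on compact sets, hence bounded. -/
instance : ContinuousSMul ℝ (SmoothMap k I L) := by
  rw [whitneyTopology_eq]
  refine continuousSMul_iInf fun x => continuousSMul_iInf fun m =>
    continuousSMul_iInf fun K => continuousSMul_iInf fun hK => ?_
  let _ : TopologicalSpace (SmoothMap k I L) :=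
    TopologicalSpace.induced (chartDerivUniform k x m hK.2) inferInstance
  refine UniformFun.continuousSMul_induced_of_range_bounded ℝ K _ (SmoothMap k I L)
    (chartDeriv k x m hK.2) ⟨rfl⟩ fun f => ?_
  refine NormedSpace.isVonNBounded_of_isBounded ℝ (IsCompact.isBounded ?_)
  have h : Set.range (chartDeriv k x m hK.2 f) =
      iteratedFDerivWithin ℝ m (f ∘ (extChartAt I x).symm) (Set.range I) '' K := by
    rw [Set.image_eq_range]
    rfl
  rw [h]
  exact hK.1.image_of_continuousOn
    ((continuousOn_iteratedFDerivWithin_comp_extChartAt_symm f x m).mono hK.2)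

omit [IsManifold I ∞ L] in
theorem continuous_smoothMap_eval (x : L) : Continuous fun f : SmoothMap k I L => f x := by
  have hle : (whitneyTopology : TopologicalSpace (SmoothMap k I L)) ≤
      TopologicalSpace.induced (fun f : SmoothMap k I L =>
        UniformOnFun.ofFun {K : Set (EuclideanSpace ℝ (Fin ℓ)) |
            IsCompact K ∧ K ⊆ (extChartAt I x).target}
          (iteratedFDerivWithin ℝ 0 (f ∘ (extChartAt I x).symm) (Set.range I)))
        inferInstance :=
    iInf₂_le x 0
  have h1 := (UniformOnFun.uniformContinuous_eval_of_mem
    (EuclideanSpace ℝ (Fin ℓ) [×0]→L[ℝ] EuclideanSpace ℝ (Fin k))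
    {K : Set (EuclideanSpace ℝ (Fin ℓ)) | IsCompact K ∧ K ⊆ (extChartAt I x).target}
    (Set.mem_singleton (extChartAt I x x))
    ⟨isCompact_singleton, Set.singleton_subset_iff.2 (mem_extChartAt_target x)⟩).continuous
  have h2 := h1.comp (continuous_iff_le_induced.2 hle)
  have h3 := (ContinuousMultilinearMap.apply ℝ (fun _ : Fin 0 => EuclideanSpace ℝ (Fin ℓ))
    (EuclideanSpace ℝ (Fin k)) 0).continuous.comp h2
  refine h3.congr fun f => ?_
  change iteratedFDerivWithin ℝ 0 (f ∘ (extChartAt I x).symm) (Set.range I) (extChartAt I x x) 0 =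
    f x
  rw [iteratedFDerivWithin_zero_apply, Function.comp_apply, extChartAt_to_inv]

omit [IsManifold I ∞ L] in
instance : T2Space (SmoothMap k I L) :=
  T2Space.of_injective_continuous (f := fun (f : SmoothMap k I L) (x : L) => f x)
    (fun _ _ h => ContMDiffMap.ext fun x => congrFun h x)
    (continuous_pi fun x => continuous_smoothMap_eval x)

end Whitney

/-! ## Invariance of bad events -/

section BadEvent

variable {ℓ k r : ℕ} {X : AdmissibleFamily.{u} ℓ k r}

theorem AdmissibleFamily.comp_equiv_mem_iff {R T : Type u} [Finite R] [Nonempty R] [Finite T]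
    [Nonempty T] (e : R ≃ T) {f : T → JetSpace ℓ k r} :
    f ∘ e ∈ X.carrier R ↔ f ∈ X.carrier T := by
  refine ⟨fun h => ?_, X.comp_mem R T e e.injective f⟩
  have := X.comp_mem T R e.symm e.symm.injective _ h
  rwa [Function.comp_assoc, Equiv.self_comp_symm, Function.comp_id] at this

/-- Nothing is lost by taking the union of all minimal bad events inside `S`, so that the choice of
a family of these is replaced by a condition at each point. -/
theorem isBadEvent_iff {T : Type u} {f : T → JetSpace ℓ k r} {S : Finset T} :
    IsBadEvent X f S ↔ S.Nonempty ∧ ∀ s ∈ S, ∃ R ⊆ S, s ∈ R ∧ IsMinimalBadEvent X f R := by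
  refine and_congr_right fun _ => ⟨?_, fun h => ?_⟩
  · rintro ⟨C, hC, hS⟩ s hs
    obtain ⟨R, hR, hsR⟩ := Set.mem_iUnion₂.1 (hS ▸ Finset.mem_coe.2 hs)
    refine ⟨R, fun t ht => ?_, hsR, hC R hR⟩
    exact Finset.mem_coe.1 (hS ▸ Set.mem_biUnion hR ht)
  · refine ⟨{R | R ⊆ S ∧ IsMinimalBadEvent X f R}, fun R hR => hR.2, ?_⟩
    refine Set.Subset.antisymm (fun s hs => ?_) (Set.iUnion₂_subset fun R hR => hR.1)
    obtain ⟨R, hRS, hsR, hR⟩ := h s hs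
    exact Set.mem_biUnion (show R ∈ {R | R ⊆ S ∧ IsMinimalBadEvent X f R} from ⟨hRS, hR⟩) hsR

theorem mem_carrier_map_iff {R T : Type u} (j : R ↪ T) (f : T → JetSpace ℓ k r) {S : Finset R}
    (hS : S.Nonempty) : (fun s : S.map j => f s) ∈ X.carrier ↥(S.map j) ↔
      (fun s : S => (f ∘ j) s) ∈ X.carrier S := by
  have : Nonempty S := hS.to_subtype
  have : Nonempty ↥(S.map j) := (hS.map (f := j)).to_subtype
  let e : S ≃ ↥(S.map j) := Equiv.ofBijective
    (fun s => ⟨j s, Finset.mem_map_of_mem j s.2⟩)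
    ⟨fun s t hst => Subtype.ext (j.injective (congrArg Subtype.val hst)), fun t => by
      obtain ⟨s, hs, hst⟩ := Finset.mem_map.1 t.2
      exact ⟨⟨s, hs⟩, Subtype.ext hst⟩⟩
  exact (AdmissibleFamily.comp_equiv_mem_iff e).symm

theorem isMinimalBadEvent_map_iff {R T : Type u} (j : R ↪ T) (f : T → JetSpace ℓ k r)
    {S : Finset R} : IsMinimalBadEvent X f (S.map j) ↔ IsMinimalBadEvent X (f ∘ j) S := by
  unfold IsMinimalBadEvent
  rw [Finset.map_nonempty]
  refine and_congr_right fun hS => and_congr (not_congr (mem_carrier_map_iff j f hS)) ?_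
  constructor
  · intro h Q hQ hQ'
    exact (mem_carrier_map_iff j f hQ').1 (h _ (Finset.map_ssubset_map.2 hQ) (hQ'.map))
  · intro h Q hQ hQ'
    obtain ⟨Q, hQS, rfl⟩ := Finset.subset_map_iff.1 hQ.1
    rw [Finset.map_nonempty] at hQ'
    exact (mem_carrier_map_iff j f hQ').2 (h Q (Finset.map_ssubset_map.1 hQ) hQ')

/-- This transfers events in the manifold to subsets of a fixed index set: badness depends only on
the jets at the points of the event, up to relabelling. -/
theorem isBadEvent_map_iff {R T : Type u} (j : R ↪ T) (f : T → JetSpace ℓ k r) {S : Finset R} :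
    IsBadEvent X f (S.map j) ↔ IsBadEvent X (f ∘ j) S := by
  rw [isBadEvent_iff, isBadEvent_iff, Finset.map_nonempty]
  refine and_congr_right fun _ => ?_
  simp only [Finset.mem_map, forall_exists_index, and_imp, forall_apply_eq_imp_iff₂]
  refine forall₂_congr fun s _ => ⟨?_, ?_⟩
  · rintro ⟨Q, hQ, hsQ, hQm⟩
    obtain ⟨Q, hQS, rfl⟩ := Finset.subset_map_iff.1 hQ
    exact ⟨Q, hQS, (Finset.mem_map' j).1 hsQ, (isMinimalBadEvent_map_iff j f).1 hQm⟩
  · rintro ⟨Q, hQ, hsQ, hQm⟩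
    exact ⟨Q.map j, Finset.map_subset_map.2 hQ, (Finset.mem_map' j).2 hsQ,
      (isMinimalBadEvent_map_iff j f).2 hQm⟩

/-- Two jets differ by changes of coordinates. -/
def CoordEquiv (g h : JetSpace ℓ k r) : Prop :=
  (∃ q, IsCoordChange q ∧ g = precompTrunc q h) ∧ ∃ q, IsCoordChange q ∧ h = precompTrunc q g

theorem CoordEquiv.symm {g h : JetSpace ℓ k r} (H : CoordEquiv g h) : CoordEquiv h g :=
  ⟨H.2, H.1⟩

theorem mem_carrier_of_coordEquiv {T : Type u} [Finite T] [Nonempty T] {f g : T → JetSpace ℓ k r}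
    (h : ∀ t, CoordEquiv (f t) (g t)) (hf : f ∈ X.carrier T) : g ∈ X.carrier T := by
  choose q hq hgq using fun t => (h t).2
  rw [funext hgq]
  exact X.invariant T q hq f hf

theorem IsMinimalBadEvent.of_coordEquiv {T : Type u} {f g : T → JetSpace ℓ k r} {S : Finset T}
    (h : ∀ t, CoordEquiv (f t) (g t)) (hf : IsMinimalBadEvent X f S) :
    IsMinimalBadEvent X g S := by
  obtain ⟨hS, hbad, hmin⟩ := hf
  refine ⟨hS, fun hg => hbad ?_, fun R hR hR' => ?_⟩
  · have : Nonempty S := hS.to_subtype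
    exact mem_carrier_of_coordEquiv (fun t : S => (h t).symm) hg
  · have : Nonempty R := hR'.to_subtype
    exact mem_carrier_of_coordEquiv (fun t : R => h t) (hmin R hR hR')

theorem IsBadEvent.of_coordEquiv {T : Type u} {f g : T → JetSpace ℓ k r} {S : Finset T}
    (h : ∀ t, CoordEquiv (f t) (g t)) (hf : IsBadEvent X f S) : IsBadEvent X g S := by
  obtain ⟨hS, C, hC, hSC⟩ := hf
  exact ⟨hS, C, fun R hR => (hC R hR).of_coordEquiv h, hSC⟩

theorem isBadEvent_congr_of_coordEquiv {T : Type u} {f g : T → JetSpace ℓ k r} {S : Finset T}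
    (h : ∀ t, CoordEquiv (f t) (g t)) : IsBadEvent X f S ↔ IsBadEvent X g S :=
  ⟨fun hf => hf.of_coordEquiv h, fun hg => hg.of_coordEquiv fun t => (h t).symm⟩

/-! ### Single jets -/

/-- The functor of multijets all of whose coordinates belong to a set of admissible jets. -/
def AdmissibleFamily.ofSet (X : Set (JetSpace ℓ k r)) (hX : IsOpen X) (hX' : IsCoordInvariant X) :
    AdmissibleFamily.{u} ℓ k r where
  carrier T := {f | ∀ t, f t ∈ X}
  isOpen T _ _ := by
    rw [show {f : T → JetSpace ℓ k r | ∀ t, f t ∈ X} = Set.univ.pi fun _ => X by ext; simp]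
    exact isOpen_set_pi Set.finite_univ fun _ _ => hX
  comp_mem _ _ _ _ _ _ j _ _ hf t := hf (j t)
  invariant _ _ _ q hq _ hf t := hX' (q t) (hq t) _ (hf t)

/-- One inadmissible jet is enough to make a multijet inadmissible, so minimality leaves only a
single point. -/
theorem isMinimalBadEvent_ofSet_iff {X : Set (JetSpace ℓ k r)} {hX : IsOpen X}
    {hX' : IsCoordInvariant X} {T : Type u} {f : T → JetSpace ℓ k r} {S : Finset T} :
    IsMinimalBadEvent (AdmissibleFamily.ofSet X hX hX') f S ↔ ∃ t, S = {t} ∧ f t ∉ X := by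
  constructor
  · rintro ⟨-, hbad, hmin⟩
    obtain ⟨⟨t, ht⟩, hft⟩ := not_forall.1 (show ¬ ∀ s : S, f s ∈ X from hbad)
    refine ⟨t, ?_, hft⟩
    by_contra hne
    have hss : {t} ⊂ S := (Finset.singleton_subset_iff.2 ht).ssubset_of_ne (Ne.symm hne)
    exact hft (hmin {t} hss (Finset.singleton_nonempty t) ⟨t, Finset.mem_singleton_self t⟩)
  · rintro ⟨t, rfl, hft⟩
    refine ⟨Finset.singleton_nonempty t, fun h => hft (h ⟨t, Finset.mem_singleton_self t⟩),
      fun R hR hR' => ?_⟩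
    exact absurd (Finset.ssubset_singleton_iff.1 hR) hR'.ne_empty

theorem isBadEvent_ofSet_iff {X : Set (JetSpace ℓ k r)} {hX : IsOpen X}
    {hX' : IsCoordInvariant X} {T : Type u} {f : T → JetSpace ℓ k r} {S : Finset T} :
    IsBadEvent (AdmissibleFamily.ofSet X hX hX') f S ↔ S.Nonempty ∧ ∀ t ∈ S, f t ∉ X := by
  rw [isBadEvent_iff]
  refine and_congr_right fun _ => forall₂_congr fun s hs => ⟨?_, fun h => ?_⟩
  · rintro ⟨R, -, hsR, hR⟩
    obtain ⟨t, rfl, ht⟩ := isMinimalBadEvent_ofSet_iff.1 hR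
    rwa [Finset.mem_singleton.1 hsR]
  · exact ⟨{s}, Finset.singleton_subset_iff.2 hs, Finset.mem_singleton_self s,
      isMinimalBadEvent_ofSet_iff.2 ⟨s, rfl, h⟩⟩

end BadEvent

section Interior

variable {ℓ k r : ℕ} {H : Type v} [TopologicalSpace H]
  {I : ModelWithCorners ℝ (EuclideanSpace ℝ (Fin ℓ)) H}
  {L : Type u} [TopologicalSpace L] [ChartedSpace H L] [IsManifold I ∞ L]

theorem coordEquiv_jetAt_chartJet (r : ℕ) (f : SmoothMap k I L) {s x : L} (hx : x ∈ I.interior L)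
    (hs : x ∈ interiorChartDomain I s) : CoordEquiv (jetAt r f x) (chartJet r f s x) := by
  rw [jetAt_eq_chartJet r f hx]
  obtain ⟨q, hq, h⟩ := exists_isCoordChange_chartJet k r (mem_interiorChartDomain_self I hx) hs
  obtain ⟨q', hq', h'⟩ := exists_isCoordChange_chartJet k r hs (mem_interiorChartDomain_self I hx)
  exact ⟨⟨q, hq, h f⟩, q', hq', h' f⟩

/-- Bad events at a configuration of interior points can be computed in fixed charts. -/
theorem isBadFor_map_iff (X : AdmissibleFamily.{u} ℓ k r)
    (A : AffineSubspace ℝ (SmoothMap k I L)) (f : A) {ι : Type u} (j : ι ↪ I.interior L)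
    (c : ι → L) (hj : ∀ t, (j t : L) ∈ interiorChartDomain I (c t)) (R : Finset ι) :
    IsBadFor X A f (R.map j) ↔ IsBadEvent X (fun t => chartJet r f.1 (c t) (j t)) R := by
  unfold IsBadFor
  rw [isBadEvent_map_iff]
  exact isBadEvent_congr_of_coordEquiv fun t =>
    coordEquiv_jetAt_chartJet r f.1 (j t).2 (hj t)

end Interior

/-! ## Families of surjective linear maps -/

section LinearFamily

open Matrix in
/-- Continuous families of invertible matrices act by homeomorphisms. -/
noncomputable def Matrix.mulVecHomeomorph {B n : Type*} [TopologicalSpace B] [Fintype n]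
    [DecidableEq n] (M : B → Matrix n n ℝ) (hM : Continuous M) (hdet : ∀ u, (M u).det ≠ 0) :
    B × (n → ℝ) ≃ₜ B × (n → ℝ) where
  toFun z := (z.1, M z.1 *ᵥ z.2)
  invFun z := (z.1, (M z.1)⁻¹ *ᵥ z.2)
  left_inv z := by
    refine Prod.ext rfl ?_
    simp only [Matrix.mulVec_mulVec]
    rw [Matrix.nonsing_inv_mul _ (hdet z.1).isUnit, Matrix.one_mulVec]
  right_inv z := by
    refine Prod.ext rfl ?_
    simp only [Matrix.mulVec_mulVec]
    rw [Matrix.mul_nonsing_inv _ (hdet z.1).isUnit, Matrix.one_mulVec]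
  continuous_toFun :=
    continuous_fst.prodMk ((hM.comp continuous_fst).matrix_mulVec continuous_snd)
  continuous_invFun := by
    have hinv : Continuous fun u => (M u)⁻¹ := by
      simp only [Matrix.inv_def, Ring.inverse_eq_inv']
      exact (hM.matrix_det.inv₀ hdet).smul hM.matrix_adjugate
    exact continuous_fst.prodMk ((hinv.comp continuous_fst).matrix_mulVec continuous_snd)

variable {B D W : Type*} [TopologicalSpace B]
  [AddCommGroup D] [Module ℝ D] [TopologicalSpace D] [IsTopologicalAddGroup D]
  [ContinuousSMul ℝ D] [T2Space D] [FiniteDimensional ℝ D]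
  [AddCommGroup W] [Module ℝ W] [TopologicalSpace W] [IsTopologicalAddGroup W]
  [ContinuousSMul ℝ W] [T2Space W] [FiniteDimensional ℝ W]

/-- A continuous family of linear maps which is bijective at a point is a homeomorphism near this
point. -/
theorem exists_homeomorph_of_bijective (T : B → D →ₗ[ℝ] W) (hT : ∀ d, Continuous fun u => T u d)
    {u₀ : B} (h : Function.Bijective (T u₀)) :
    ∃ U : Set B, IsOpen U ∧ u₀ ∈ U ∧ ∃ e : U × D ≃ₜ U × W, ∀ z, e z = (z.1, T z.1 z.2) := by
  let n := Module.finrank ℝ D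
  have hn : Module.finrank ℝ W = n :=
    (LinearEquiv.ofBijective (T u₀) h).finrank_eq.symm
  let eD : D ≃L[ℝ] (Fin n → ℝ) := ContinuousLinearEquiv.ofFinrankEq (by simp [n])
  let eW : W ≃L[ℝ] (Fin n → ℝ) := ContinuousLinearEquiv.ofFinrankEq (by simp [hn])
  let T' : B → (Fin n → ℝ) →ₗ[ℝ] (Fin n → ℝ) := fun u =>
    eW.toLinearEquiv.toLinearMap ∘ₗ T u ∘ₗ eD.symm.toLinearEquiv.toLinearMap
  let M : B → Matrix (Fin n) (Fin n) ℝ := fun u => LinearMap.toMatrix' (T' u)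
  have hM : Continuous M := by
    refine continuous_matrix fun i j => ?_
    simp only [M, LinearMap.toMatrix'_apply]
    exact (continuous_apply i).comp (eW.continuous.comp (hT _))
  have hM' : ∀ u x, Matrix.mulVec (M u) x = eW (T u (eD.symm x)) := fun u x => by
    rw [LinearMap.toMatrix'_mulVec]
    rfl
  have hdet₀ : (M u₀).det ≠ 0 := by
    refine IsUnit.ne_zero ((Matrix.isUnit_iff_isUnit_det _).1
      (Matrix.mulVec_injective_iff_isUnit.1 fun x y hxy => ?_))
    rw [hM', hM'] at hxy
    exact eD.symm.injective (h.1 (eW.injective hxy))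
  let U : Set B := {u | (M u).det ≠ 0}
  refine ⟨U, isOpen_ne_fun hM.matrix_det continuous_const, hdet₀,
    (((Homeomorph.refl U).prodCongr eD.toHomeomorph).trans
      (Matrix.mulVecHomeomorph (fun u : U => M u) (hM.comp continuous_subtype_val)
        fun u => u.2)).trans ((Homeomorph.refl U).prodCongr eW.symm.toHomeomorph), fun z => ?_⟩
  refine Prod.ext rfl ?_
  change eW.symm (Matrix.mulVec (M z.1) (eD z.2)) = T z.1 z.2
  rw [hM', eD.symm_apply_apply, eW.symm_apply_apply]

/-- A continuous family of linear maps which is surjective at a point is locally trivial near this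
point. -/
theorem exists_homeomorph_of_surjective (T : B → D →ₗ[ℝ] W) (hT : ∀ d, Continuous fun u => T u d)
    {u₀ : B} (h : Function.Surjective (T u₀)) :
    ∃ b : ℕ, b + Module.finrank ℝ W = Module.finrank ℝ D ∧
      ∃ U : Set B, IsOpen U ∧ u₀ ∈ U ∧ ∃ e : U × D ≃ₜ U × ((Fin b → ℝ) × W),
        ∀ z, (e z).1 = z.1 ∧ (e z).2.2 = T z.1 z.2 := by
  let K := LinearMap.ker (T u₀)
  -- A projection `q` to the kernel at `u₀`, kept fixed while `u` varies, completes `T u₀` to a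
  -- bijection.
  obtain ⟨q, hq⟩ := K.subtype.exists_leftInverse_of_injective K.ker_subtype
  have hdim : Module.finrank ℝ K + Module.finrank ℝ W = Module.finrank ℝ D := by
    rw [← LinearMap.finrank_range_add_finrank_ker (T u₀), LinearMap.range_eq_top.2 h, finrank_top,
      add_comm]
  let q' : D →ₗ[ℝ] (Fin (Module.finrank ℝ K) → ℝ) :=
    (Module.finBasis ℝ K).equivFun.toLinearMap ∘ₗ q
  let T' : B → D →ₗ[ℝ] (Fin (Module.finrank ℝ K) → ℝ) × W := fun u => q'.prod (T u)
  have hinj : Function.Injective (T' u₀) := by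
    rw [injective_iff_map_eq_zero]
    intro d hd
    obtain ⟨h1, h2⟩ := Prod.ext_iff.1 hd
    have h3 : q d = 0 := (Module.finBasis ℝ K).equivFun.map_eq_zero_iff.1 h1
    have h4 := LinearMap.congr_fun hq ⟨d, h2⟩
    simp only [LinearMap.comp_apply, Submodule.subtype_apply, LinearMap.id_apply] at h4
    rw [h3] at h4
    exact congrArg Subtype.val h4.symm
  have hbij : Function.Bijective (T' u₀) :=
    ⟨hinj, (LinearMap.injective_iff_surjective_of_finrank_eq_finrank (by simp [hdim])).1 hinj⟩
  obtain ⟨U, hU, hu₀, e, he⟩ := exists_homeomorph_of_bijective T'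
    (fun d => continuous_const.prodMk (hT d)) hbij
  exact ⟨_, hdim, U, hU, hu₀, e, fun z => by rw [he]; exact ⟨rfl, rfl⟩⟩

end LinearFamily

/-! ## Configurations near a given one -/

namespace Config

variable {X : Type u} [TopologicalSpace X] {p : ℕ} {ι : Type v} [Fintype ι]

/-- The configurations which have a point in each of the sets `V s`. -/
def hitting (p : ℕ) (V : ι → Set X) : Set (Config X p) := {u | ∀ s, ∃ x ∈ u.1, x ∈ V s}

variable {V : ι → Set X}

theorem isOpen_hitting (hV : ∀ s, IsOpen (V s)) : IsOpen (hitting p V) := by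
  rw [show hitting p V = ⋂ s, {u : Config X p | ∃ x ∈ u.1, x ∈ V s} from Set.ext fun u => by
    simp [hitting]]
  exact isOpen_iInter_of_finite fun s => isOpen_hit (hV s)

/-- The point of a configuration in `V s`. -/
noncomputable def hitPoint (u : hitting p V) (s : ι) : X := (u.2 s).choose

omit [TopologicalSpace X] [Fintype ι] in
theorem hitPoint_mem (u : hitting p V) (s : ι) : hitPoint u s ∈ u.1.1 := (u.2 s).choose_spec.1

omit [TopologicalSpace X] [Fintype ι] in
theorem hitPoint_mem_nhd (u : hitting p V) (s : ι) : hitPoint u s ∈ V s := (u.2 s).choose_spec.2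

omit [TopologicalSpace X] [Fintype ι] in
theorem hitPoint_injective (hd : Pairwise fun s t => Disjoint (V s) (V t)) (u : hitting p V) :
    Function.Injective (hitPoint u) := by
  intro s t hst
  by_contra hne
  exact Set.disjoint_left.1 (hd hne) (hitPoint_mem_nhd u s) (hst ▸ hitPoint_mem_nhd u t)

/-- The points of a configuration, as an embedding. -/
noncomputable def hitEmbedding (hd : Pairwise fun s t => Disjoint (V s) (V t))
    (u : hitting p V) : ι ↪ X :=
  ⟨hitPoint u, hitPoint_injective hd u⟩

omit [TopologicalSpace X] in
theorem map_hitEmbedding (hd : Pairwise fun s t => Disjoint (V s) (V t))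
    (hcard : Fintype.card ι = p) (u : hitting p V) :
    Finset.univ.map (hitEmbedding hd u) = u.1.1 := by
  refine Finset.eq_of_subset_of_card_le (fun x hx => ?_) ?_
  · obtain ⟨s, -, rfl⟩ := Finset.mem_map.1 hx
    exact hitPoint_mem u s
  · rw [Finset.card_map, Finset.card_univ, hcard, u.1.2]

omit [TopologicalSpace X] in
-- A configuration of `p` points that meets `p` disjoint sets has just one point in each, so the
-- chosen point does not depend on the choice.
theorem eq_hitPoint (hd : Pairwise fun s t => Disjoint (V s) (V t))
    (hcard : Fintype.card ι = p) (u : hitting p V) {x : X} (hx : x ∈ u.1.1) {s : ι}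
    (hxs : x ∈ V s) : x = hitPoint u s := by
  rw [← map_hitEmbedding hd hcard u] at hx
  obtain ⟨t, -, rfl⟩ := Finset.mem_map.1 hx
  have hst : s = t := by
    by_contra hne
    exact Set.disjoint_left.1 (hd hne) hxs (hitPoint_mem_nhd u t)
  rw [hst]
  rfl

theorem continuous_hitPoint (hV : ∀ s, IsOpen (V s))
    (hd : Pairwise fun s t => Disjoint (V s) (V t)) (hcard : Fintype.card ι = p) (s : ι) :
    Continuous fun u : hitting p V => hitPoint u s := by
  refine continuous_def.2 fun W hW => ?_
  have h : (fun u : hitting p V => hitPoint u s) ⁻¹' W =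
      Subtype.val ⁻¹' {u : Config X p | ∃ x ∈ u.1, x ∈ W ∩ V s} := by
    ext u
    constructor
    · exact fun h => ⟨_, hitPoint_mem u s, h, hitPoint_mem_nhd u s⟩
    · rintro ⟨x, hx, hxW, hxs⟩
      rw [Set.mem_preimage, ← eq_hitPoint hd hcard u hx hxs]
      exact hxW
  rw [h]
  exact (isOpen_hit (hW.inter (hV s))).preimage continuous_subtype_val

/-- Locally, unordered configurations are ordered configurations. -/
noncomputable def hittingHomeomorph (hV : ∀ s, IsOpen (V s))
    (hd : Pairwise fun s t => Disjoint (V s) (V t)) (hcard : Fintype.card ι = p) :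
    hitting p V ≃ₜ {x : ι → X // ∀ s, x s ∈ V s} :=
  have hinj : ∀ x : {x : ι → X // ∀ s, x s ∈ V s}, Function.Injective x.1 := fun x s t hst => by
    by_contra hne
    exact Set.disjoint_left.1 (hd hne) (x.2 s) (hst ▸ x.2 t)
  let e : Fin p ≃ ι := (Fintype.equivFinOfCardEq hcard).symm
  let c : {x : ι → X // ∀ s, x s ∈ V s} → {c : Fin p → X // Function.Injective c} := fun x =>
    ⟨x.1 ∘ e, (hinj x).comp e.injective⟩
  have hc : ∀ x s, x.1 s ∈ (ofTuple (c x)).1 := fun x s =>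
    mem_ofTuple.2 ⟨e.symm s, congrArg x.1 (e.apply_symm_apply s)⟩
  have hcV : ∀ x, ofTuple (c x) ∈ hitting p V := fun x s => ⟨x.1 s, hc x s, x.2 s⟩
  { toFun := fun u => ⟨hitPoint u, hitPoint_mem_nhd u⟩
    invFun := fun x => ⟨ofTuple (c x), hcV x⟩
    left_inv := fun u => Subtype.ext (Subtype.ext (by
      rw [← map_hitEmbedding hd hcard u]
      ext y
      rw [mem_ofTuple, Finset.mem_map]
      constructor
      · rintro ⟨i, rfl⟩
        exact ⟨e i, Finset.mem_univ _, rfl⟩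
      · rintro ⟨s, -, rfl⟩
        exact ⟨e.symm s, congrArg (hitPoint u) (e.apply_symm_apply s)⟩))
    right_inv := fun x => Subtype.ext (funext fun s =>
      (eq_hitPoint hd hcard ⟨ofTuple (c x), hcV x⟩ (hc x s) (x.2 s)).symm)
    continuous_toFun := (continuous_pi fun s => continuous_hitPoint hV hd hcard s).subtype_mk _
    continuous_invFun :=
      have hcc : Continuous c := Continuous.subtype_mk
        (f := fun x : {x : ι → X // ∀ s, x s ∈ V s} => x.1 ∘ e)
        (continuous_pi fun i => (continuous_apply (e i)).comp continuous_subtype_val) _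
      (continuous_ofTuple.comp hcc).subtype_mk _ }

theorem locallyCompactSpace_hitting [LocallyCompactSpace X] (hV : ∀ s, IsOpen (V s))
    (hd : Pairwise fun s t => Disjoint (V s) (V t)) (hcard : Fintype.card ι = p) :
    LocallyCompactSpace (hitting p V) := by
  have hopen : IsOpen {x : ι → X | ∀ s, x s ∈ V s} := by
    rw [show {x : ι → X | ∀ s, x s ∈ V s} = Set.univ.pi V by ext; simp]
    exact isOpen_set_pi Set.finite_univ fun s _ => hV s
  have : LocallyCompactSpace {x : ι → X // ∀ s, x s ∈ V s} := hopen.locallyCompactSpace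
  exact (hittingHomeomorph hV hd hcard).isOpenEmbedding.locallyCompactSpace

end Config

/-! ## The local model -/

section LocalModel

/-- Translation by a continuous function of the base. -/
def Homeomorph.fiberwiseTranslate {B M W : Type*} [TopologicalSpace B] [TopologicalSpace M]
    [TopologicalSpace W] [AddGroup W] [IsTopologicalAddGroup W] (c : B → W) (hc : Continuous c) :
    B × (M × W) ≃ₜ B × (M × W) where
  toFun z := (z.1, z.2.1, z.2.2 + c z.1)
  invFun z := (z.1, z.2.1, z.2.2 - c z.1)
  left_inv z := by simp
  right_inv z := by simp
  continuous_toFun := by fun_prop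
  continuous_invFun := by fun_prop

/-- An affine subspace is homeomorphic to its direction. -/
def AffineSubspace.homeomorphDirection {V : Type*} [AddCommGroup V] [Module ℝ V]
    [TopologicalSpace V] [IsTopologicalAddGroup V] (A : AffineSubspace ℝ V) (f₀ : A) :
    A ≃ₜ A.direction where
  toFun f := ⟨f.1 - f₀.1, AffineSubspace.vsub_mem_direction f.2 f₀.2⟩
  invFun d := ⟨d.1 + f₀.1, AffineSubspace.vadd_mem_of_mem_direction d.2 f₀.2⟩
  left_inv f := by simp
  right_inv d := by simp
  continuous_toFun := by fun_prop
  continuous_invFun := by fun_prop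

variable {ℓ k r : ℕ} {H : Type v} [TopologicalSpace H]
  {I : ModelWithCorners ℝ (EuclideanSpace ℝ (Fin ℓ)) H}
  {L : Type u} [TopologicalSpace L] [ChartedSpace H L] [IsManifold I ∞ L]
  [CompactSpace L] [T2Space L]

/-- In charts fixed at the points of `S`, multijets at nearby configurations form a continuous
family `T` of linear maps on the direction of `A`. By interpolation `T` is surjective at `S`, hence
trivial nearby. The resulting coordinates of `f` are a free parameter in `ℝ^b` and its multijet,
which decides by coordinate invariance which events are bad. -/
theorem exists_eventModel {i : ℕ} {A : AffineSubspace ℝ (SmoothMap k I L)}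
    [FiniteDimensional ℝ A.direction] (hA : IsInterpolating r i A) {p : ℕ} (hp : 0 < p)
    (hpi : p ≤ i) (S : Config (I.interior L) p) :
    ∃ b : ℕ, (b : ℤ) = Module.finrank ℝ A.direction - p * Module.finrank ℝ (JetSpace ℓ k r) ∧
      ∃ U : Set (Config (I.interior L) p), S ∈ U ∧ LocallyCompactSpace U ∧
        ∀ X : AdmissibleFamily.{u} ℓ k r, Nonempty
          (EventModel (IsBadFor X A) U (Fin b → ℝ) (S.1 → JetSpace ℓ k r) (IsBadEvent X)) := by
  have hcard : Fintype.card S.1 = p := by rw [Fintype.card_coe, S.2]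
  have hint : IsOpen (I.interior L) := I.isOpen_interior (n := ∞) (by simp)
  have : LocallyCompactSpace (I.interior L) := hint.locallyCompactSpace
  obtain ⟨V, hV, hmem, hVsub, hd⟩ := exists_disjoint_opens S.1
    (O := fun s => Subtype.val ⁻¹' interiorChartDomain I (s.1 : L))
    (fun s => (isOpen_interiorChartDomain I _).preimage continuous_subtype_val)
    (fun s => mem_interiorChartDomain_self I s.1.2)
  have hdom : ∀ (u : Config.hitting p V) (s : S.1),
      (Config.hitPoint u s).1 ∈ interiorChartDomain I (s.1 : L) := fun u s =>
    hVsub s (Config.hitPoint_mem_nhd u s)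
  have hSU : S ∈ (Config.hitting p V) := fun s => ⟨s, s.2, hmem s⟩
  have hpt : ∀ s, Config.hitPoint (⟨S, hSU⟩ : Config.hitting p V) s = s := fun s =>
    (Config.eq_hitPoint hd hcard ⟨S, hSU⟩ s.2 (hmem s)).symm
  have hcont : ∀ f : SmoothMap k I L, Continuous fun u : Config.hitting p V => fun s : S.1 =>
      chartJet r f (s.1 : L) (Config.hitPoint u s).1 := fun f => continuous_pi fun s =>
    (continuousOn_chartJet r f (s.1 : L)).comp_continuous
      (continuous_subtype_val.comp (Config.continuous_hitPoint hV hd hcard s))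
      fun u => hdom u s
  let T : Config.hitting p V → A.direction →ₗ[ℝ] (S.1 → JetSpace ℓ k r) := fun u =>
    LinearMap.pi fun s => (chartJetLinear k r (hdom u s)) ∘ₗ A.direction.subtype
  have hT : ∀ d, Continuous fun u => T u d := fun d => hcont d.1
  have hA' := hA S.1 (S.2.trans_le hpi)
  -- Interpolation provides an origin `f₀`, by which `A` is identified with its direction.
  obtain ⟨f₀, -⟩ := hA' 0
  have hsurj : Function.Surjective (T ⟨S, hSU⟩) := by
    intro h
    obtain ⟨f, hf⟩ := hA' (h + fun s => jetAt r f₀.1 (s.1 : L))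
    refine ⟨A.homeomorphDirection f₀ f, funext fun s => ?_⟩
    have h1 : jetAt r f.1 (s.1 : L) = h s + jetAt r f₀.1 (s.1 : L) := congrFun hf s
    rw [jetAt_eq_chartJet r f.1 s.1.2, jetAt_eq_chartJet r f₀.1 s.1.2] at h1
    change chartJetLinear k r (hdom ⟨S, hSU⟩ s) (f.1 - f₀.1) = h s
    rw [map_sub]
    change chartJet r f.1 (s.1 : L) (Config.hitPoint (⟨S, hSU⟩ : Config.hitting p V) s).1 -
      chartJet r f₀.1 (s.1 : L) (Config.hitPoint (⟨S, hSU⟩ : Config.hitting p V) s).1 = h s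
    rw [hpt s, h1, add_sub_cancel_right]
  -- Finite dimensionality of `P^S` is inherited from the direction of `A` by surjectivity, and that
  -- of `P` follows by projecting to one factor, which exists because `p > 0`.
  have hfin : FiniteDimensional ℝ (S.1 → JetSpace ℓ k r) := Module.Finite.of_surjective _ hsurj
  have hSne : S.1.Nonempty := Finset.card_pos.1 (S.2.symm ▸ hp)
  have hfinP : FiniteDimensional ℝ (JetSpace ℓ k r) := Module.Finite.of_surjective
    (LinearMap.proj (R := ℝ) (φ := fun _ : S.1 => JetSpace ℓ k r) ⟨_, hSne.choose_spec⟩)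
    (LinearMap.proj_surjective _)
  obtain ⟨b, hb, U₂, hU₂, hSU₂, e, he⟩ := exists_homeomorph_of_surjective T hT hsurj
  refine ⟨b, ?_, ?_⟩
  · rw [Module.finrank_pi_fintype, Finset.sum_const, Finset.card_univ, hcard, smul_eq_mul] at hb
    rw [← hb]
    push_cast
    ring
  have hU₁ : IsOpen (Config.hitting p V) := Config.isOpen_hitting hV
  obtain ⟨O, hO, rfl⟩ := isOpen_induced_iff.1 hU₂
  let g : ↥(Config.hitting p V ∩ O) ≃ₜ ↥(Subtype.val ⁻¹' O : Set (Config.hitting p V)) :=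
    { toFun := fun u => ⟨⟨u.1, u.2.1⟩, u.2.2⟩
      invFun := fun u => ⟨u.1.1, u.1.2, u.2⟩
      left_inv := fun _ => rfl
      right_inv := fun _ => rfl
      continuous_toFun := (continuous_subtype_val.subtype_mk _).subtype_mk _
      continuous_invFun := (continuous_subtype_val.comp continuous_subtype_val).subtype_mk _ }
  refine ⟨Config.hitting p V ∩ O, ⟨hSU, hSU₂⟩, ?_, fun X => ⟨?_⟩⟩
  · have : LocallyCompactSpace (Config.hitting p V) := Config.locallyCompactSpace_hitting hV hd hcard
    have : LocallyCompactSpace ↥(Subtype.val ⁻¹' O : Set (Config.hitting p V)) := hU₂.locallyCompactSpace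
    exact g.isOpenEmbedding.locallyCompactSpace
  -- The linear trivialization records the multijet of `f - f₀`; translation by the multijet `c` of
  -- `f₀` yields that of `f`.
  · let c : ↥(Subtype.val ⁻¹' O : Set (Config.hitting p V)) → S.1 → JetSpace ℓ k r := fun u s =>
      chartJet r f₀.1 (s.1 : L) (Config.hitPoint u.1 s).1
    let E : ↥(Config.hitting p V ∩ O) × A ≃ₜ ↥(Config.hitting p V ∩ O) × ((Fin b → ℝ) × (S.1 → JetSpace ℓ k r)) :=
      (((g.prodCongr (A.homeomorphDirection f₀)).trans e).trans
        (Homeomorph.fiberwiseTranslate c ((hcont f₀.1).comp continuous_subtype_val))).trans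
        (g.symm.prodCongr (Homeomorph.refl _))
    have hE1 : ∀ z, (E z).1 = z.1 := fun z => by
      change g.symm (e (g z.1, _)).1 = z.1
      rw [(he _).1, g.symm_apply_apply]
    have hE2 : ∀ u f, (E (u, f)).2.2 = fun s : S.1 =>
        chartJet r f.1 (s.1 : L) (Config.hitPoint (g u).1 s).1 := fun u f => by
      change (e (g u, A.homeomorphDirection f₀ f)).2.2 +
        c (e (g u, A.homeomorphDirection f₀ f)).1 = _
      rw [(he _).1, (he _).2]
      funext s
      change chartJetLinear k r (hdom (g u).1 s) (f.1 - f₀.1) +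
        chartJetLinear k r (hdom (g u).1 s) f₀.1 = chartJetLinear k r (hdom (g u).1 s) f.1
      rw [map_sub, sub_add_cancel]
    exact
      { isOpen := hU₁.inter hO
        point := fun u => Config.hitEmbedding hd (g u).1
        map_point := fun u => Config.map_hitEmbedding hd hcard (g u).1
        continuous_point := fun s => (Config.continuous_hitPoint hV hd hcard s).comp
          (continuous_subtype_val.comp g.continuous)
        nhd := V
        isOpen_nhd := hV
        disjoint_nhd := hd
        point_mem := fun u s => Config.hitPoint_mem_nhd (g u).1 s
        coord := E
        coord_fst := hE1
        bad_iff := fun u f R => by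
          rw [hE2]
          exact isBadFor_map_iff X A f (Config.hitEmbedding hd (g u).1) (fun s => (s.1 : L))
            (hdom (g u).1) R }

end LocalModel

/-! ## The resolved discriminant -/

section Discriminant

variable {ℓ k r : ℕ} {H : Type v} [TopologicalSpace H]
  {I : ModelWithCorners ℝ (EuclideanSpace ℝ (Fin ℓ)) H}
  {L : Type u} [TopologicalSpace L] [ChartedSpace H L]

theorem FiltrationDiff.exists_bad {Y X : Type*} {bad : Y → Finset X → Prop} {p : ℕ}
    (z : FiltrationDiff bad p) : ∃ y S, S.card = p ∧ bad y S := by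
  obtain ⟨n, c, t, hz⟩ := ClassifyingSpace.exists_mk z.1
  obtain ⟨J, -, -, hJ⟩ := ClassifyingSpace.exists_mem_topEvent_eq c t
  refine ⟨_, _, ?_, (c.1 J).2⟩
  rw [← hJ, hz]
  exact (FiltrationDiff.toConfig bad p z).2

/-- A bad event of `p` points for some map can be relabelled by `S`. So the model fiber is nonempty
if the total space is, as needed to define a trivialization. -/
theorem exists_badMultijet {X : AdmissibleFamily.{u} ℓ k r}
    {A : AffineSubspace ℝ (SmoothMap k I L)} {p : ℕ} (S : Config (I.interior L) p)
    (z : FiltrationDiff (IsBadFor X A) p) :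
    ∃ h : S.1 → JetSpace ℓ k r, IsBadEvent X h Finset.univ := by
  obtain ⟨f, S', hS', hbad⟩ := z.exists_bad
  let e : S.1 ≃ S' := S.1.equivOfCardEq (S.2.trans hS'.symm)
  let j : S.1 ↪ I.interior L := e.toEmbedding.trans (Function.Embedding.subtype _)
  have hj : Finset.univ.map j = S' := by
    ext x
    simp only [Finset.mem_map, Finset.mem_univ, true_and]
    exact ⟨by rintro ⟨s, rfl⟩; exact (e s).2, fun hx => ⟨e.symm ⟨x, hx⟩, by simp [j]⟩⟩
  rw [← hj] at hbad
  exact ⟨_, (isBadEvent_map_iff j _).1 hbad⟩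

theorem isInadmissibleFor_eq {X : Set (JetSpace ℓ k r)} (hX : IsOpen X)
    (hX' : IsCoordInvariant X) (A : AffineSubspace ℝ (SmoothMap k I L)) :
    IsInadmissibleFor X A = IsBadFor (AdmissibleFamily.ofSet X hX hX') A :=
  funext₂ fun _ _ => propext isBadEvent_ofSet_iff.symm

end Discriminant

section SingleJets

variable {ℓ k r : ℕ} {X : Set (JetSpace ℓ k r)} (hX : IsOpen X) (hX' : IsCoordInvariant X)
  {S : Type u} [Fintype S]

theorem BadMultijet.notMem (h : BadMultijet (AdmissibleFamily.ofSet X hX hX') S) (s : S) :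
    h.1 s ∉ X :=
  (isBadEvent_ofSet_iff.1 h.2).2 s (Finset.mem_univ s)

/-- The multijets for which the whole index set is a bad event, for single jets. -/
def BadMultijet.homeomorphPi [Nonempty S] {p : ℕ} (e : Fin p ≃ S) :
    BadMultijet (AdmissibleFamily.ofSet X hX hX') S ≃ₜ (Fin p → ↥Xᶜ) where
  toFun h i := ⟨h.1 (e i), h.notMem hX hX' (e i)⟩
  invFun g := ⟨fun s => (g (e.symm s)).1,
    isBadEvent_ofSet_iff.2 ⟨Finset.univ_nonempty, fun s _ => (g (e.symm s)).2⟩⟩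
  left_inv h := Subtype.ext (funext fun s => congrArg h.1 (e.apply_symm_apply s))
  right_inv g := funext fun i => Subtype.ext (congrArg (fun j => (g j).1) (e.symm_apply_apply i))
  continuous_toFun := continuous_pi fun i =>
    ((continuous_apply (e i)).comp continuous_subtype_val).subtype_mk _
  continuous_invFun := Continuous.subtype_mk (continuous_pi fun s =>
    continuous_subtype_val.comp (continuous_apply (e.symm s))) _

/-- All coordinates of `h` are inadmissible, so no nonempty proper subset is excluded. The poset is
thus independent of `h`, which makes the fiberwise cone a product. -/
theorem isProperBadEvent_ofSet_iff (h : BadMultijet (AdmissibleFamily.ofSet X hX hX') S)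
    (R : Finset S) : IsProperBadEvent (AdmissibleFamily.ofSet X hX hX') h R ↔
      R.Nonempty ∧ R ≠ Finset.univ := by
  unfold IsProperBadEvent
  rw [isBadEvent_ofSet_iff, and_comm]
  exact and_congr_left fun _ => and_iff_left fun s _ => h.notMem hX hX' s

theorem nonempty_homeomorph_decoratedBadMultijet [TopologicalSpace S] [DiscreteTopology S]
    {p : ℕ} (hp : 0 < p) (hcard : Fintype.card S = p) :
    Nonempty (DecoratedBadMultijet (AdmissibleFamily.ofSet X hX hX') S ≃ₜ
      (Fin (p - 1) → ℝ) × (Fin p → ↥Xᶜ)) := by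
  let e : Fin p ≃ S := (Fintype.equivFinOfCardEq hcard).symm
  have : Nonempty S := ⟨e ⟨0, hp⟩⟩
  obtain ⟨a⟩ := nonempty_homeomorph_fullCone (isProperBadEvent_ofSet_iff (S := S) hX hX')
    ((finCongr (Nat.sub_add_cancel hp)).trans e)
  exact ⟨(a.trans (Homeomorph.prodComm _ _)).trans
    ((Homeomorph.refl _).prodCongr (BadMultijet.homeomorphPi hX hX' e))⟩

end SingleJets

theorem mainTheorem4 {ℓ k r : ℕ} {H : Type v} [TopologicalSpace H]
    (I : ModelWithCorners ℝ (EuclideanSpace ℝ (Fin ℓ)) H)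
    {L : Type u} [TopologicalSpace L] [ChartedSpace H L] [IsManifold I ∞ L]
    [CompactSpace L] [T2Space L]
    (φ : SmoothMap k I L) (i : ℕ)
    (A : AffineSubspace ℝ (SmoothMap k I L)) [FiniteDimensional ℝ A.direction]
    (hAφ : ∀ f ∈ A, SameBoundaryJets r φ f)
    (hA : IsInterpolating r i A)
    (p : ℕ) (hp : 0 < p) (hpi : p ≤ i) :
    (∀ X : AdmissibleFamily.{u} ℓ k r, (∀ x ∈ I.boundary L, IsPure X (jetAt r φ x)) →
      ∀ S : Config (I.interior L) p,
        ∃ b : ℕ, (b : ℤ) = Module.finrank ℝ A.direction - p * Module.finrank ℝ (JetSpace ℓ k r) ∧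
          IsLocallyTrivialAt (FiltrationDiff.toConfig (IsBadFor X A) p)
            ((Fin b → ℝ) × DecoratedBadMultijet X S.1) S) ∧
    (∀ X : Set (JetSpace ℓ k r), IsOpen X → IsCoordInvariant X →
      (∀ x ∈ I.boundary L, jetAt r φ x ∈ X) →
      ∀ S : Config (I.interior L) p,
        ∃ b : ℕ, (b : ℤ) = Module.finrank ℝ A.direction - p * Module.finrank ℝ (JetSpace ℓ k r) ∧
          IsLocallyTrivialAt (FiltrationDiff.toConfig (IsInadmissibleFor X A) p)
            ((Fin b → ℝ) × (Fin (p - 1) → ℝ) × (Fin p → ↥Xᶜ)) S) := by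
  refine ⟨fun X _ S => ?_, fun X hX hX' _ S => ?_⟩
  · obtain ⟨b, hb, U, hS, _, hE⟩ := exists_eventModel hA hp hpi S
    obtain ⟨E⟩ := hE X
    exact ⟨b, hb, E.isLocallyTrivialAt (bad₀ := IsProperBadEvent X) (fun _ _ => Iff.rfl) hp hS
      (exists_badMultijet S)⟩
  · obtain ⟨b, hb, U, hS, _, hE⟩ := exists_eventModel hA hp hpi S
    obtain ⟨E⟩ := hE (AdmissibleFamily.ofSet X hX hX')
    refine ⟨b, hb, ?_⟩
    rw [isInadmissibleFor_eq hX hX']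
    -- The trivialization for multijets applies to the functor of pointwise admissible multijets;
    -- only its fiber remains to be identified.
    obtain ⟨t, ht⟩ := E.isLocallyTrivialAt
      (bad₀ := IsProperBadEvent (AdmissibleFamily.ofSet X hX hX')) (fun _ _ => Iff.rfl) hp hS
      (exists_badMultijet S)
    obtain ⟨a⟩ := nonempty_homeomorph_decoratedBadMultijet hX hX' (S := S.1) hp
      ((Fintype.card_coe S.1).trans S.2)
    exact ⟨t.transFiberHomeomorph ((Homeomorph.refl _).prodCongr a), ht⟩
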